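/- Let $n\ge 2$, let $\Omega\subset\mathbb R^n$ be a bounded domain with boundary of class $C^4$ and outward unit normal $\vec n$, let $T>0$, $Q=\Omega\times(0,T)$, $\Sigma=\partial\Omega\times(0,T)$. Put $$X=\{u\in L^2(0,T;H_0^2(\Omega)) : u_t\in L^2(0,T;H^{-2}(\Omega))\},\qquad \|u\|_X=\big(\|u\|_{L^2(0,T;H^2_0(\Omega))}^2+\|u_t\|_{L^2(0,T;H^{-2}(\Omega))}^2\big)^{1/2}.$$ For every $M\ge 0$ there are constants $\varepsilon>0$ and $C>0$, depending only on $n,\Omega,T,M$, such that the following holds. Let $a\in L^\infty(Q)$ and $B\in L^\infty(Q;\mathbb R^n)$ have norms at most $M$; let $\mathcal O,\mathcal O_1,\mathcal O_2,\mathcal O_{1,d},\mathcal O_{2,d}\subset\Omega$ be nonempty open sets; let $\alpha_1,\alpha_2,\mu_1,\mu_2>0$ satisfy $$\frac{\max\{\alpha_1,\alpha_2\}}{\min\{\mu_1,\mu_2\}}\le\varepsilon ;$$ and let $w_0\in L^2(\Omega)$, $f\in L^2(\mathcal O\times(0,T))$, $w_{i,d}\in L^2(\mathcal O_{i,d}\times(0,T))$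 for $i=1,2$. Then the system $$\begin{cases} w_t+\Delta^2 w+a w+B\cdot\nabla w=f\chi_{\mathcal O}-\sum_{i=1}^2\frac{\phi_i}{\mu_i}\chi_{\mathcal O_i} & \text{in } Q,\\ -\phi_{i,t}+\Delta^2\phi_i+a\phi_i-\nabla\cdot(B\phi_i)=\alpha_i(w-w_{i,d})\chi_{\mathcal O_{i,d}} & \text{in } Q,\ i=1,2,\\ w=\frac{\partial w}{\partial\vec n}=0,\quad \phi_i=\frac{\partial\phi_i}{\partial\vec n}=0 & \text{on }\Sigma,\\ w(\cdot,0)=w_0,\quad \phi_i(\cdot,T)=0 & \text{in }\Omega \end{cases}$$ has a unique weak solution $(w,\phi_1,\phi_2)\in X\times X\times X$, and $$\|w\|_X\le C\Big(\|w_0\|_{L^2(\Omega)}+\|f\|_{L^2(\mathcal O\times(0,T))}+\sum_{i=1}^2\|w_{i,d}\|_{L^2(\mathcal O_{i,d}\times(0,T))}\Big).$$ Here $(w,\phi_1,\phi_2)\in X^3$ is a weak solution if, for almost every $t\in(0,T)$ and all $v\in H_0^2(\Omega)$, $$\langle w_t,v\rangle+\int_\Omega\big(\Delta w\,\Delta v+a\,w\,v+(B\cdot\nabla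 w)\,v\big)dx=\int_{\mathcal O}f v\,dx-\sum_{i=1}^2\frac1{\mu_i}\int_{\mathcal O_i}\phi_i v\,dx,$$ $$-\langle\phi_{i,t},v\rangle+\int_\Omega\big(\Delta\phi_i\,\Delta v+a\,\phi_i v+\phi_i\,B\cdot\nabla v\big)dx=\alpha_i\int_{\mathcal O_{i,d}}(w-w_{i,d})\,v\,dx\quad(i=1,2),$$ and the continuous representatives in $C([0,T];L^2(\Omega))$ satisfy $w(0)=w_0$, $\phi_i(T)=0$. -/

import Mathlib

open MeasureTheory Set Filter Topology
open scoped ContDiff ENNReal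

noncomputable section

namespace FourthOrderParabolic

/-- The Euclidean space `ℝⁿ`. -/
abbrev Rn (n : ℕ) : Type := EuclideanSpace ℝ (Fin n)

/-- Bounded domains of class `C⁴`: bounded, open and connected, and near each boundary point the
domain is the strict sublevel set of a `C⁴` function with nonzero derivative at that point. -/
structure IsC4Domain {n : ℕ} (Ω : Set (Rn n)) : Prop where
  isOpen : IsOpen Ω
  isConnected : IsConnected Ω
  isBounded : Bornology.IsBounded Ω
  boundary : ∀ x ∈ frontier Ω, ∃ (U : Set (Rn n)) (ρ : Rn n → ℝ), IsOpen U ∧ x ∈ U ∧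
    ContDiffOn ℝ 4 ρ U ∧ ρ x = 0 ∧ fderiv ℝ ρ x ≠ 0 ∧ Ω ∩ U = {y ∈ U | ρ y < 0}

/-- The space `L²(Ω)`. -/
abbrev L2 {n : ℕ} (Ω : Set (Rn n)) : Type := Lp ℝ 2 (volume.restrict Ω)

/-- The cylinder `A × (0,T)`; its points are written `(x, t)`. -/
abbrev cyl {n : ℕ} (A : Set (Rn n)) (T : ℝ) : Set (Rn n × ℝ) := A ×ˢ Ioo 0 T

/-- The space `L²(0,T;V)`. -/
abbrev L2T (T : ℝ) (V : Type) [NormedAddCommGroup V] : Type :=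
  Lp V 2 (volume.restrict (Ioo (0 : ℝ) T))

/-! ### The Sobolev space `H₀²(Ω)` and its dual `H⁻²(Ω)` -/

/-- Test functions on `Ω`, i.e. the elements of `C_c^∞(Ω)`. -/
structure IsTest {n : ℕ} (Ω : Set (Rn n)) (η : Rn n → ℝ) : Prop where
  contDiff : ContDiff ℝ ∞ η
  hasCompactSupport : HasCompactSupport η
  tsupport_subset : tsupport η ⊆ Ω

/-- The classical partial derivative `∂ᵢη`. -/
def pderiv {n : ℕ} (i : Fin n) (η : Rn n → ℝ) : Rn n → ℝ :=
  fun x => fderiv ℝ η x (EuclideanSpace.single i 1)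

/-- Indices of the entries of a 2-jet: the function, the `∂ᵢ`, and the `∂ⱼ∂ᵢ`. -/
abbrev JetIdx (n : ℕ) : Type := Unit ⊕ Fin n ⊕ (Fin n × Fin n)

/-- `(L²(Ω))^{1+n+n²}` with the `ℓ²` norm. On a tuple `(u, ∂ᵢu, ∂ⱼ∂ᵢu)` this is the `H²(Ω)` norm
`(‖u‖² + ∑ᵢ ‖∂ᵢu‖² + ∑ᵢⱼ ‖∂ⱼ∂ᵢu‖²)^{1/2}`. -/
abbrev Jet {n : ℕ} (Ω : Set (Rn n)) : Type := PiLp 2 (fun _ : JetIdx n => L2 Ω)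

/-- The entries of the classical 2-jet of a function. -/
def jetFun {n : ℕ} (η : Rn n → ℝ) : JetIdx n → Rn n → ℝ
  | Sum.inl _ => η
  | Sum.inr (Sum.inl i) => pderiv i η
  | Sum.inr (Sum.inr (i, j)) => pderiv j (pderiv i η)

theorem IsTest.pderiv {n : ℕ} {Ω : Set (Rn n)} {η : Rn n → ℝ} (h : IsTest Ω η) (i : Fin n) :
    IsTest Ω (pderiv i η) where
  contDiff := (h.contDiff.fderiv_right (m := ∞) (by simp)).clm_apply contDiff_const
  hasCompactSupport := h.hasCompactSupport.fderiv_apply ℝ _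
  tsupport_subset := (tsupport_fderiv_apply_subset ℝ _).trans h.tsupport_subset

theorem IsTest.jetFun {n : ℕ} {Ω : Set (Rn n)} {η : Rn n → ℝ} (h : IsTest Ω η) :
    ∀ k : JetIdx n, IsTest Ω (jetFun η k)
  | Sum.inl _ => h
  | Sum.inr (Sum.inl i) => h.pderiv i
  | Sum.inr (Sum.inr (i, j)) => (h.pderiv i).pderiv j

theorem pderiv_add {n : ℕ} {Ω : Set (Rn n)} {η θ : Rn n → ℝ} (h : IsTest Ω η) (h' : IsTest Ω θ)
    (i : Fin n) : pderiv i (η + θ) = pderiv i η + pderiv i θ := by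
  ext x
  simp only [pderiv, Pi.add_apply]
  rw [fderiv_add (h.contDiff.differentiable (by simp) x)
    (h'.contDiff.differentiable (by simp) x)]
  rfl

theorem pderiv_smul {n : ℕ} {Ω : Set (Rn n)} {η : Rn n → ℝ} (h : IsTest Ω η) (c : ℝ)
    (i : Fin n) : pderiv i (c • η) = c • pderiv i η := by
  ext x
  simp only [pderiv, Pi.smul_apply]
  rw [fderiv_const_smul (h.contDiff.differentiable (by simp) x)]
  rfl

theorem jetFun_add {n : ℕ} {Ω : Set (Rn n)} {η θ : Rn n → ℝ} (h : IsTest Ω η)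
    (h' : IsTest Ω θ) : ∀ k : JetIdx n, jetFun (η + θ) k = jetFun η k + jetFun θ k
  | Sum.inl _ => rfl
  | Sum.inr (Sum.inl i) => pderiv_add h h' i
  | Sum.inr (Sum.inr (i, j)) => by
    simp only [jetFun]
    rw [pderiv_add h h' i, pderiv_add (h.pderiv i) (h'.pderiv i) j]

theorem jetFun_smul {n : ℕ} {Ω : Set (Rn n)} {η : Rn n → ℝ} (h : IsTest Ω η) (c : ℝ) :
    ∀ k : JetIdx n, jetFun (c • η) k = c • jetFun η k
  | Sum.inl _ => rfl
  | Sum.inr (Sum.inl i) => pderiv_smul h c i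
  | Sum.inr (Sum.inr (i, j)) => by
    simp only [jetFun]
    rw [pderiv_smul h c i, pderiv_smul (h.pderiv i) c j]

/-- The 2-jets of test functions, as a subspace of `(L²(Ω))^{1+n+n²}`. -/
def testJets {n : ℕ} (Ω : Set (Rn n)) : Submodule ℝ (Jet Ω) where
  carrier := {J | ∃ η : Rn n → ℝ, IsTest Ω η ∧ ∀ k, J k =ᵐ[volume.restrict Ω] jetFun η k}
  zero_mem' := by
    refine ⟨0, ⟨contDiff_const, HasCompactSupport.zero, by simp [tsupport]⟩, fun k => ?_⟩
    have h0 : jetFun (0 : Rn n → ℝ) k = 0 := by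
      have h : IsTest (univ : Set (Rn n)) (0 : Rn n → ℝ) :=
        ⟨contDiff_const, HasCompactSupport.zero, by simp⟩
      simpa using jetFun_smul h 0 k
    rw [h0]
    exact Lp.coeFn_zero ℝ 2 _
  add_mem' := by
    rintro J K ⟨η, hη, hJ⟩ ⟨θ, hθ, hK⟩
    refine ⟨η + θ, ⟨hη.contDiff.add hθ.contDiff, hη.hasCompactSupport.add hθ.hasCompactSupport,
      (tsupport_add η θ).trans (union_subset hη.tsupport_subset hθ.tsupport_subset)⟩,
      fun k => ?_⟩
    rw [jetFun_add hη hθ k]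
    exact (Lp.coeFn_add (J k) (K k)).trans ((hJ k).add (hK k))
  smul_mem' := by
    rintro c J ⟨η, hη, hJ⟩
    refine ⟨c • η, ⟨contDiff_const.smul hη.contDiff, hη.hasCompactSupport.smul_left,
      (tsupport_smul_subset_right (fun _ => c) η).trans hη.tsupport_subset⟩, fun k => ?_⟩
    rw [jetFun_smul hη c k]
    exact (Lp.coeFn_smul c (J k)).trans ((hJ k).const_smul c)

/-- `H₀²(Ω)` as a closed subspace of `(L²(Ω))^{1+n+n²}`: the closure of the 2-jets of the functions in
`C_c^∞(Ω)`. -/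
def H02Submodule {n : ℕ} (Ω : Set (Rn n)) : Submodule ℝ (Jet Ω) := (testJets Ω).topologicalClosure

/-- The Hilbert space `H₀²(Ω)`, the closure of `C_c^∞(Ω)` in the `H²(Ω)` norm. An element is stored
together with its weak derivatives up to order 2, which it determines (`H02.val_injective`). -/
def H02 {n : ℕ} (Ω : Set (Rn n)) : Type := H02Submodule Ω

instance {n : ℕ} (Ω : Set (Rn n)) : NormedAddCommGroup (H02 Ω) :=
  inferInstanceAs (NormedAddCommGroup (H02Submodule Ω))

instance {n : ℕ} (Ω : Set (Rn n)) : InnerProductSpace ℝ (H02 Ω) :=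
  inferInstanceAs (InnerProductSpace ℝ (H02Submodule Ω))

instance {n : ℕ} (Ω : Set (Rn n)) : CompleteSpace (H02 Ω) :=
  (Submodule.isClosed_topologicalClosure (testJets Ω)).completeSpace_coe

/-- The dual space `H⁻²(Ω)` of `H₀²(Ω)` with the dual norm. -/
abbrev Hm2 {n : ℕ} (Ω : Set (Rn n)) : Type := StrongDual ℝ (H02 Ω)

namespace H02

variable {n : ℕ} {Ω : Set (Rn n)}

/-- The entries of the 2-jet of `v ∈ H₀²(Ω)`: `v` itself and its weak derivatives. -/
def jet (k : JetIdx n) : H02 Ω →L[ℝ] L2 Ω :=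
  (PiLp.proj (𝕜 := ℝ) 2 (fun _ : JetIdx n => L2 Ω) k).comp (H02Submodule Ω).subtypeL

/-- The embedding `H₀²(Ω) → L²(Ω)`. -/
def val : H02 Ω →L[ℝ] L2 Ω := jet (Sum.inl ())

/-- The weak derivative `∂ᵢv` of `v ∈ H₀²(Ω)`. -/
def partialD (i : Fin n) : H02 Ω →L[ℝ] L2 Ω := jet (Sum.inr (Sum.inl i))

/-- The weak Laplacian `Δv = ∑ᵢ ∂ᵢ∂ᵢv` of `v ∈ H₀²(Ω)`. -/
def lap : H02 Ω →L[ℝ] L2 Ω := ∑ i : Fin n, jet (Sum.inr (Sum.inr (i, i)))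

/-- The embedding `H₀²(Ω) → H⁻²(Ω)` given by `⟨u, v⟩ = ∫_Ω u v`. -/
def toDual : H02 Ω →L[ℝ] Hm2 Ω := (innerSL ℝ (E := L2 Ω)).bilinearComp val val

theorem toDual_apply (u v : H02 Ω) : toDual u v = inner ℝ (val u) (val v) := rfl

/-- The entries of an element of `H₀²(Ω)` are weak derivatives of one another: the classical
integration by parts formula passes to the closure. -/
theorem weak_deriv_of_test {η : Rn n → ℝ} (hη : IsTest Ω η) (i : Fin n) (k l : JetIdx n)
    (hkl : ∀ θ : Rn n → ℝ, jetFun θ l = pderiv i (jetFun θ k)) (v : H02 Ω) :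
    ∫ x in Ω, pderiv i η x * jet k v x = - ∫ x in Ω, η x * jet l v x := by
  have hmem : ∀ {θ : Rn n → ℝ}, IsTest Ω θ → MemLp θ 2 (volume.restrict Ω) := fun h =>
    (h.contDiff.continuous.memLp_of_hasCompactSupport h.hasCompactSupport).restrict _
  have hin : ∀ {θ : Rn n → ℝ} (h : IsTest Ω θ) (g : L2 Ω),
      inner ℝ (hmem h).toLp g = ∫ x in Ω, θ x * g x := by
    intro θ h g
    rw [L2.inner_def]
    refine integral_congr_ae ?_
    filter_upwards [(hmem h).coeFn_toLp] with x hx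
    rw [hx]
    simp [mul_comm]
  rw [← hin (hη.pderiv i), ← hin hη]
  have hcl : IsClosed {J : Jet Ω | inner ℝ (hmem (hη.pderiv i)).toLp (J k)
      = - inner ℝ (hmem hη).toLp (J l)} := by
    refine isClosed_eq ?_ ?_
    · exact continuous_const.inner (PiLp.continuous_apply 2 _ k)
    · exact (continuous_const.inner (PiLp.continuous_apply 2 _ l)).neg
  refine closure_minimal ?_ hcl v.2
  rintro J ⟨θ, hθ, hJ⟩
  have hk := hθ.jetFun k
  have hJ' : ∀ k, J k =ᵐ[volume.restrict Ω] FourthOrderParabolic.jetFun θ k := hJ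
  have hres : ∀ {ξ : Rn n → ℝ}, IsTest Ω ξ → ∀ m, ∫ x in Ω, ξ x * J m x
      = ∫ x, ξ x * jetFun θ m x := by
    intro ξ hξ m
    rw [← setIntegral_eq_integral_of_forall_compl_eq_zero (s := Ω)
      (f := fun x => ξ x * FourthOrderParabolic.jetFun θ m x)]
    · refine integral_congr_ae ?_
      filter_upwards [hJ' m] with x hx
      rw [hx]
    · intro x hx
      rw [image_eq_zero_of_notMem_tsupport (fun h => hx (hξ.tsupport_subset h)), zero_mul]
  have hint : ∀ {ξ ζ : Rn n → ℝ}, IsTest Ω ξ → IsTest Ω ζ →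
      Integrable (fun x => ξ x * ζ x) := fun h h' =>
    (h.contDiff.continuous.mul h'.contDiff.continuous).integrable_of_hasCompactSupport
      (HasCompactSupport.mul_right h.hasCompactSupport)
  change inner ℝ (hmem (hη.pderiv i)).toLp (J k) = - inner ℝ (hmem hη).toLp (J l)
  rw [hin (hη.pderiv i), hin hη, hres (hη.pderiv i), hres hη, hkl θ]
  have := integral_mul_fderiv_eq_neg_fderiv_mul_of_integrable (𝕜 := ℝ) (μ := (volume : Measure (Rn n)))
    (f := η) (g := jetFun θ k) (v := EuclideanSpace.single i 1)
    (hint (hη.pderiv i) hk) (hint hη (hk.pderiv i)) (hint hη hk)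
    (fun x _ => hη.contDiff.differentiable (by simp) x)
    (fun x _ => hk.contDiff.differentiable (by simp) x)
  simp only [pderiv]
  rw [this, neg_neg]

/-- An element of `H₀²(Ω)` is determined by its underlying function. -/
theorem val_injective (hΩ : IsOpen Ω) : Function.Injective (val : H02 Ω → L2 Ω) := by
  rw [injective_iff_map_eq_zero]
  intro v hv
  have key : ∀ (i : Fin n) (k l : JetIdx n),
      (∀ θ : Rn n → ℝ, jetFun θ l = pderiv i (jetFun θ k)) →
      jet k v = 0 → jet l v = 0 := by
    intro i k l hkl hk
    have h := hΩ.ae_eq_zero_of_integral_contDiff_smul_eq_zero (μ := volume)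
      (f := jet l v)
      (fun x _ => by
        obtain ⟨s, hs, hi⟩ := ((Lp.memLp (jet l v)).locallyIntegrable (by norm_num)) x
        refine ⟨s ∩ Ω, inter_mem (mem_nhdsWithin_of_mem_nhds hs) self_mem_nhdsWithin, ?_⟩
        rwa [IntegrableOn, Measure.restrict_restrict' hΩ.measurableSet] at hi)
      ?_
    · exact (Lp.eq_zero_iff_ae_eq_zero).2 ((ae_restrict_iff' hΩ.measurableSet).2 h)
    · intro g h1 h2 h3
      have hw := weak_deriv_of_test ⟨h1, h2, h3⟩ i k l hkl v
      have hz : ∫ x in Ω, pderiv i g x * jet k v x = 0 := by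
        refine integral_eq_zero_of_ae ?_
        filter_upwards [(Lp.eq_zero_iff_ae_eq_zero).1 hk] with x hx
        rw [hx]
        simp
      rw [← setIntegral_eq_integral_of_forall_compl_eq_zero (s := Ω)]
      · simpa [hz, eq_comm] using hw
      · intro x hx
        rw [image_eq_zero_of_notMem_tsupport (fun h => hx (h3 h)), zero_smul]
  have hall : ∀ m, jet m v = 0 := by
    rintro (u | i | ⟨i, j⟩)
    · exact hv
    · exact key i (Sum.inl ()) _ (fun _ => rfl) hv
    · exact key j (Sum.inr (Sum.inl i)) _ (fun _ => rfl)
        (key i (Sum.inl ()) _ (fun _ => rfl) hv)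
  exact Subtype.ext (PiLp.ext hall)

end H02

/-! ### The space `X` -/

variable {n : ℕ}

/-- `u' ∈ L²(0,T;H⁻²(Ω))` is the weak time derivative of `u ∈ L²(0,T;H₀²(Ω))`:
`∫₀ᵀ ψ'(t) u(t) dt = -∫₀ᵀ ψ(t) u'(t) dt` in `H⁻²(Ω)` for all `ψ ∈ C_c^∞(0,T)`. -/
def IsTimeDeriv {Ω : Set (Rn n)} {T : ℝ} (u : L2T T (H02 Ω)) (u' : L2T T (Hm2 Ω)) : Prop :=
  ∀ ψ : ℝ → ℝ, ContDiff ℝ ∞ ψ → HasCompactSupport ψ → tsupport ψ ⊆ Ioo 0 T →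
    ∫ t in Ioo 0 T, deriv ψ t • H02.toDual (u t) = - ∫ t in Ioo 0 T, ψ t • u' t

theorem integrable_smul_L2T {T : ℝ} {V : Type} [NormedAddCommGroup V] [NormedSpace ℝ V]
    {ψ : ℝ → ℝ} (hψ : Continuous ψ) (hc : HasCompactSupport ψ) (g : L2T T V) :
    Integrable (fun t => ψ t • g t) (volume.restrict (Ioo 0 T)) := by
  obtain ⟨C, hC⟩ := hψ.bounded_above_of_compact_support hc
  exact ((Lp.memLp g).integrable (by norm_num)).bdd_smul C hψ.aestronglyMeasurable
    (Eventually.of_forall hC)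

theorem integrable_smul_toDual {Ω : Set (Rn n)} {T : ℝ} {ψ : ℝ → ℝ} (hψ : Continuous ψ)
    (hc : HasCompactSupport ψ) (u : L2T T (H02 Ω)) :
    Integrable (fun t => ψ t • H02.toDual (u t)) (volume.restrict (Ioo 0 T)) := by
  have := (H02.toDual (Ω := Ω)).integrable_comp (integrable_smul_L2T hψ hc u)
  simpa using this

/-- The weak time derivative is unique. -/
theorem IsTimeDeriv.unique {Ω : Set (Rn n)} {T : ℝ} {u : L2T T (H02 Ω)} {u' u'' : L2T T (Hm2 Ω)}
    (h' : IsTimeDeriv u u') (h'' : IsTimeDeriv u u'') : u' = u'' := by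
  have hli : ∀ g : L2T T (Hm2 Ω), LocallyIntegrableOn g (Ioo 0 T) volume := fun g => by
    have : IntegrableOn g (Ioo 0 T) volume := (Lp.memLp g).integrable (by norm_num)
    exact this.locallyIntegrableOn
  have h := isOpen_Ioo.ae_eq_zero_of_integral_contDiff_smul_eq_zero (μ := volume)
    (f := fun t => u' t - u'' t) ((hli u').sub (hli u'')) ?_
  · refine Lp.ext ?_
    filter_upwards [(ae_restrict_iff' measurableSet_Ioo).2 h] with t ht
    exact sub_eq_zero.1 ht
  · intro ψ h1 h2 h3
    have e := neg_inj.1 ((h' ψ h1 h2 h3).symm.trans (h'' ψ h1 h2 h3))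
    rw [← setIntegral_eq_integral_of_forall_compl_eq_zero (s := Ioo 0 T)]
    · simp only [smul_sub]
      rw [integral_sub (integrable_smul_L2T h1.continuous h2 u')
        (integrable_smul_L2T h1.continuous h2 u''), e, sub_self]
    · intro t ht
      rw [image_eq_zero_of_notMem_tsupport (fun h => ht (h3 h)), zero_smul]

/-- `X` as a subspace of `L²(0,T;H₀²(Ω)) × L²(0,T;H⁻²(Ω))`: the pairs `(u, u_t)`. -/
def XSubmodule (Ω : Set (Rn n)) (T : ℝ) : Submodule ℝ (WithLp 2 (L2T T (H02 Ω) × L2T T (Hm2 Ω))) where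
  carrier := {p | IsTimeDeriv p.fst p.snd}
  zero_mem' := by
    intro ψ h1 h2 h3
    have e1 : ∫ t in Ioo 0 T, deriv ψ t • H02.toDual ((0 : L2T T (H02 Ω)) t) = 0 := by
      refine integral_eq_zero_of_ae ?_
      filter_upwards [Lp.coeFn_zero (H02 Ω) 2 (volume.restrict (Ioo 0 T))] with t ht
      rw [ht]
      simp
    have e2 : ∫ t in Ioo 0 T, ψ t • (0 : L2T T (Hm2 Ω)) t = 0 := by
      refine integral_eq_zero_of_ae ?_
      filter_upwards [Lp.coeFn_zero (Hm2 Ω) 2 (volume.restrict (Ioo 0 T))] with t ht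
      rw [ht]
      simp
    simp only [WithLp.zero_fst, WithLp.zero_snd]
    rw [e1, e2, neg_zero]
  add_mem' := by
    intro p q hp hq ψ h1 h2 h3
    have hd : Continuous (deriv ψ) := h1.continuous_deriv (by simp)
    have e1 : ∫ t in Ioo 0 T, deriv ψ t • H02.toDual ((p.fst + q.fst) t)
        = ∫ t in Ioo 0 T, (deriv ψ t • H02.toDual (p.fst t) + deriv ψ t • H02.toDual (q.fst t)) := by
      refine integral_congr_ae ?_
      filter_upwards [Lp.coeFn_add p.fst q.fst] with t ht
      rw [ht]
      simp
    have e2 : ∫ t in Ioo 0 T, ψ t • (p.snd + q.snd) t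
        = ∫ t in Ioo 0 T, (ψ t • p.snd t + ψ t • q.snd t) := by
      refine integral_congr_ae ?_
      filter_upwards [Lp.coeFn_add p.snd q.snd] with t ht
      rw [ht]
      simp
    simp only [WithLp.add_fst, WithLp.add_snd]
    rw [e1, e2, integral_add (integrable_smul_toDual hd h2.deriv p.fst)
      (integrable_smul_toDual hd h2.deriv q.fst),
      integral_add (integrable_smul_L2T h1.continuous h2 p.snd)
      (integrable_smul_L2T h1.continuous h2 q.snd), hp ψ h1 h2 h3, hq ψ h1 h2 h3, neg_add]
  smul_mem' := by
    intro c p hp ψ h1 h2 h3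
    have e1 : ∫ t in Ioo 0 T, deriv ψ t • H02.toDual ((c • p.fst) t)
        = ∫ t in Ioo 0 T, c • deriv ψ t • H02.toDual (p.fst t) := by
      refine integral_congr_ae ?_
      filter_upwards [Lp.coeFn_smul c p.fst] with t ht
      rw [ht]
      simp [smul_comm c]
    have e2 : ∫ t in Ioo 0 T, ψ t • (c • p.snd) t = ∫ t in Ioo 0 T, c • ψ t • p.snd t := by
      refine integral_congr_ae ?_
      filter_upwards [Lp.coeFn_smul c p.snd] with t ht
      rw [ht]
      simp [smul_comm c]
    simp only [WithLp.smul_fst, WithLp.smul_snd]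
    rw [e1, e2, integral_smul, integral_smul, hp ψ h1 h2 h3, smul_neg]

/-- The space `X = {u ∈ L²(0,T;H₀²(Ω)) : u_t ∈ L²(0,T;H⁻²(Ω))}`. An element `u` is stored together
with its weak time derivative `u_t`, which it determines (`IsTimeDeriv.unique`); the norm is
`(‖u‖²_{L²(0,T;H₀²)} + ‖u_t‖²_{L²(0,T;H⁻²)})^{1/2}`. -/
def X (Ω : Set (Rn n)) (T : ℝ) : Type := XSubmodule Ω T

instance (Ω : Set (Rn n)) (T : ℝ) : NormedAddCommGroup (X Ω T) :=
  inferInstanceAs (NormedAddCommGroup (XSubmodule Ω T))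

instance (Ω : Set (Rn n)) (T : ℝ) : NormedSpace ℝ (X Ω T) :=
  inferInstanceAs (NormedSpace ℝ (XSubmodule Ω T))

namespace X

variable {Ω : Set (Rn n)} {T : ℝ}

/-- `u` as an element of `L²(0,T;H₀²(Ω))`. -/
def toL2 (u : X Ω T) : L2T T (H02 Ω) := WithLp.fst (Subtype.val u)

/-- The weak time derivative `u_t` as an element of `L²(0,T;H⁻²(Ω))`. -/
def deriv (u : X Ω T) : L2T T (Hm2 Ω) := WithLp.snd (Subtype.val u)

theorem isTimeDeriv (u : X Ω T) : IsTimeDeriv u.toL2 u.deriv := Subtype.property u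

theorem norm_eq (u : X Ω T) : ‖u‖ = √(‖u.toL2‖ ^ 2 + ‖u.deriv‖ ^ 2) :=
  WithLp.prod_norm_eq_of_L2 _

/-- `u(·,s) = g` in the sense of `C([0,T];L²(Ω))`: `u` has a representative that is continuous from
`[0,T]` to `L²(Ω)` and takes the value `g` at time `s`. -/
def HasTrace (u : X Ω T) (s : ℝ) (g : L2 Ω) : Prop :=
  ∃ U : ℝ → L2 Ω, ContinuousOn U (Icc 0 T) ∧
    (∀ᵐ t ∂volume.restrict (Ioo 0 T), H02.val (u.toL2 t) = U t) ∧ U s = g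

end X

/-! ### Weak solutions of the optimality system -/

/-- `w ∈ X` is a weak solution of `w_t + Δ²w + a w + B·∇w = f χ_O - ∑ᵢ (φᵢ/μᵢ) χ_{Oᵢ}` in
`Ω × (0,T)`, `w = ∂w/∂n = 0` on `∂Ω × (0,T)`, `w(·,0) = w₀`. The boundary conditions are contained
in `w(t) ∈ H₀²(Ω)`. -/
structure IsForwardSolution {Ω : Set (Rn n)} {T : ℝ} (O : Set (Rn n)) (Of : Fin 2 → Set (Rn n))
    (a : Lp ℝ ∞ (volume.restrict (cyl Ω T))) (B : Lp (Rn n) ∞ (volume.restrict (cyl Ω T)))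
    (μ : Fin 2 → ℝ) (f : Lp ℝ 2 (volume.restrict (cyl O T))) (w₀ : L2 Ω)
    (w : X Ω T) (φ : Fin 2 → X Ω T) : Prop where
  equation : ∀ᵐ t ∂volume.restrict (Ioo 0 T), ∀ v : H02 Ω,
    w.deriv t v
      + (∫ x in Ω, H02.lap (w.toL2 t) x * H02.lap v x)
      + (∫ x in Ω, a (x, t) * H02.val (w.toL2 t) x * H02.val v x)
      + (∫ x in Ω, (∑ j, B (x, t) j * H02.partialD j (w.toL2 t) x) * H02.val v x)
    = (∫ x in O, f (x, t) * H02.val v x)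
      - ∑ i, (μ i)⁻¹ * (∫ x in Of i, H02.val ((φ i).toL2 t) x * H02.val v x)
  initial : w.HasTrace 0 w₀

/-- `φ ∈ X` is a weak solution of `-φ_t + Δ²φ + a φ - ∇·(B φ) = α (w - w_d) χ_{O_d}` in
`Ω × (0,T)`, `φ = ∂φ/∂n = 0` on `∂Ω × (0,T)`, `φ(·,T) = 0`. -/
structure IsAdjointSolution {Ω : Set (Rn n)} {T : ℝ} (Od : Set (Rn n))
    (a : Lp ℝ ∞ (volume.restrict (cyl Ω T))) (B : Lp (Rn n) ∞ (volume.restrict (cyl Ω T)))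
    (α : ℝ) (wd : Lp ℝ 2 (volume.restrict (cyl Od T))) (w φ : X Ω T) : Prop where
  equation : ∀ᵐ t ∂volume.restrict (Ioo 0 T), ∀ v : H02 Ω,
    - φ.deriv t v
      + (∫ x in Ω, H02.lap (φ.toL2 t) x * H02.lap v x)
      + (∫ x in Ω, a (x, t) * H02.val (φ.toL2 t) x * H02.val v x)
      + (∫ x in Ω, H02.val (φ.toL2 t) x * (∑ j, B (x, t) j * H02.partialD j v x))
    = α * (∫ x in Od, (H02.val (w.toL2 t) x - wd (x, t)) * H02.val v x)
  final : φ.HasTrace T 0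

end FourthOrderParabolic
end

/-! The system is treated as an abstract parabolic problem for an injective map i : V → H with dense
range between Hilbert spaces, here V = H₀²(Ω), H = L²(Ω). Elements of V* are replaced by their Riesz
representatives, so "u has time derivative y" means that i*i u has weak derivative y in L²(0,T;V)
(`HasWeakDeriv`), and both equations become σ y + A u = F in L²(0,T;V), with σ = 1 for the state and
σ = -1 for the adjoint states.

Three facts carry the linear theory. Functions with a weak derivative are limits of C¹ functions
with values in V (`HasWeakDeriv.exists_approx`); this gives representatives in C([0,T];H) and
integration by parts in time. A Gårding inequality for A gives the energy estimate with constant K =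
`energyConst` (`IsGarding.energy`): an exponential weight in time turns the inequality into
coercivity. The same estimate for the transposed operator, run in the opposite time direction, gives
existence by the Lions projection lemma (`IsGarding.exists_solution`).

For the coupled system, send u to the adjoint states driven by u, and these to the state that they
drive. Each of the two solves costs a factor K, so the map is a contraction with ratio 1/2 once ∑
αₖ/μₖ ≤ 1/(2K²) (`norm_sub_le_of_coupled`). Its fixed point is the solution, the contraction
estimate gives uniqueness, and the bound follows by absorbing half of ‖u‖ into the left-hand side.

The concrete input is the Gårding inequality for Δ² + a + B·∇. It rests on ‖v‖²_{H²} ≤ 2(‖v‖² +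
‖Δv‖²) for v ∈ H₀²(Ω), which holds by integration by parts on test functions (`H02.norm_sq_le`).
Multiplication by a, by the components of B and by indicators is realized as bounded operators on
L²(0,T;L²(Ω)) with the help of Pettis' theorem. -/

noncomputable section

namespace FourthOrderParabolic

/-! ### Weak derivatives of vector-valued functions on (0,T). -/

section WeakDerivative

variable {E : Type*} [NormedAddCommGroup E] [NormedSpace ℝ E]

/-- A smooth function with compact support in `(0,T)` and vanishing integral has a primitive that is
again a test function. -/
theorem exists_test_primitive {T : ℝ} {θ : ℝ → ℝ} (h1 : ContDiff ℝ ∞ θ)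
    (h2 : HasCompactSupport θ) (h3 : tsupport θ ⊆ Ioo 0 T) (h0 : ∫ t, θ t = 0) :
    ∃ ψ : ℝ → ℝ, ContDiff ℝ ∞ ψ ∧ HasCompactSupport ψ ∧ tsupport ψ ⊆ Ioo 0 T ∧ deriv ψ = θ := by
  rcases (tsupport θ).eq_empty_or_nonempty with he | hne
  · refine ⟨0, contDiff_const, HasCompactSupport.zero, by simp [tsupport], ?_⟩
    rw [tsupport_eq_empty_iff.1 he]
    exact deriv_zero
  obtain ⟨a, ha, hal⟩ := h2.isCompact.exists_isLeast hne
  obtain ⟨b, hb, hbu⟩ := h2.isCompact.exists_isGreatest hne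
  have hz : ∀ s, s ∉ tsupport θ → θ s = 0 := fun s hs => image_eq_zero_of_notMem_tsupport hs
  have hder : ∀ t, HasDerivAt (fun t => ∫ s in (0 : ℝ)..t, θ s) (θ t) t := fun t =>
    h1.continuous.integral_hasStrictDerivAt 0 t |>.hasDerivAt
  have hd : deriv (fun t => ∫ s in (0 : ℝ)..t, θ s) = θ := funext fun t => (hder t).deriv
  -- To the left of a nothing has been accumulated, because 0 < a; to the right of b the whole
  -- integral has been, and it is zero.
  have hts : tsupport (fun t => ∫ s in (0 : ℝ)..t, θ s) ⊆ Icc a b := by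
    refine closure_minimal ?_ isClosed_Icc
    intro t ht
    by_contra hn
    apply ht
    rcases lt_or_ge t a with hta | hta
    · change ∫ s in (0 : ℝ)..t, θ s = 0
      rw [intervalIntegral.integral_congr (g := fun _ => (0 : ℝ))]
      · simp
      · intro s hs
        refine hz s fun hs' => ?_
        have h4 : a ≤ s := hal hs'
        have h5 := (h3 ha).1
        rcases le_total 0 t with h6 | h6
        · rw [uIcc_of_le h6] at hs; linarith [hs.2]
        · rw [uIcc_of_ge h6] at hs; linarith [hs.2]
    · have htb : b < t := by
        by_contra h
        exact hn ⟨hta, not_lt.1 h⟩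
      change ∫ s in (0 : ℝ)..t, θ s = 0
      rw [intervalIntegral.integral_eq_integral_of_support_subset, h0]
      intro s hs
      have := subset_tsupport θ hs
      exact ⟨(h3 this).1, (hbu this).trans htb.le⟩
  refine ⟨_, ?_, ?_, ?_, hd⟩
  · rw [contDiff_infty_iff_deriv, hd]
    exact ⟨fun t => (hder t).differentiableAt, h1⟩
  · exact HasCompactSupport.of_support_subset_isCompact isCompact_Icc ((subset_tsupport _).trans hts)
  · exact hts.trans fun t ht => ⟨(h3 ha).1.trans_le ht.1, ht.2.trans_lt (h3 hb).2⟩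

theorem test_smul_integrable {T : ℝ} {f : ℝ → E} (hf : IntegrableOn f (Ioo 0 T)) {ψ : ℝ → ℝ}
    (hψ : Continuous ψ) (hc : HasCompactSupport ψ) : IntegrableOn (fun t => ψ t • f t) (Ioo 0 T) := by
  obtain ⟨C, hC⟩ := hψ.bounded_above_of_compact_support hc
  exact hf.bdd_smul C hψ.aestronglyMeasurable (Eventually.of_forall hC)

theorem integral_test_eq_setIntegral {T : ℝ} {ψ : ℝ → ℝ} (h3 : tsupport ψ ⊆ Ioo 0 T) (f : ℝ → E) :
    ∫ t in Ioo 0 T, ψ t • f t = ∫ t, ψ t • f t := by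
  refine setIntegral_eq_integral_of_forall_compl_eq_zero fun t ht => ?_
  rw [image_eq_zero_of_notMem_tsupport (fun h => ht (h3 h)), zero_smul]

variable [CompleteSpace E]

/-- The lemma of du Bois-Reymond. -/
theorem ae_eq_const_of_integral_deriv_smul_eq_zero {T : ℝ} (hT : 0 < T) {f : ℝ → E}
    (hf : IntegrableOn f (Ioo 0 T))
    (h : ∀ ψ : ℝ → ℝ, ContDiff ℝ ∞ ψ → HasCompactSupport ψ → tsupport ψ ⊆ Ioo 0 T →
      ∫ t in Ioo 0 T, deriv ψ t • f t = 0) :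
    ∃ c : E, ∀ᵐ t ∂volume.restrict (Ioo 0 T), f t = c := by
  let B : ContDiffBump (T / 2 : ℝ) := ⟨T / 8, T / 4, by positivity, by linarith⟩
  let χ : ℝ → ℝ := B.normed volume
  have χ1 : ContDiff ℝ ∞ χ := B.contDiff_normed
  have χ2 : HasCompactSupport χ := B.hasCompactSupport_normed
  have χ3 : tsupport χ ⊆ Ioo 0 T := by
    rw [B.tsupport_normed_eq, Real.closedBall_eq_Icc]
    change Icc (T / 2 - T / 4) (T / 2 + T / 4) ⊆ _
    intro t ht
    exact ⟨by linarith [ht.1], by linarith [ht.2]⟩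
  have χ4 : ∫ t, χ t = 1 := B.integral_normed
  set c : E := ∫ t in Ioo 0 T, χ t • f t with hc
  refine ⟨c, ?_⟩
  have key := isOpen_Ioo.ae_eq_zero_of_integral_contDiff_smul_eq_zero (μ := volume)
    (U := Ioo 0 T) (f := fun t => f t - c)
    (hf.sub (integrableOn_const (by simp))).locallyIntegrableOn ?_
  · filter_upwards [(ae_restrict_iff' measurableSet_Ioo).2 key] with t ht using sub_eq_zero.1 ht
  intro η h1 h2 h3
  have iη : Integrable η := h1.continuous.integrable_of_hasCompactSupport h2
  have iχ : Integrable χ := χ1.continuous.integrable_of_hasCompactSupport χ2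
  set m : ℝ := ∫ t, η t with hm
  -- Subtracting m χ removes the mean of η, so the difference is the derivative of a test function
  -- and the hypothesis says that it annihilates f. Hence η integrates f to m c, as it does the
  -- constant c.
  obtain ⟨ψ, p1, p2, p3, p4⟩ := exists_test_primitive (T := T) (θ := fun t => η t - m * χ t)
    (h1.sub (contDiff_const.mul χ1)) (h2.sub (χ2.mul_left))
    ((tsupport_sub _ _).trans (union_subset h3 ((tsupport_mul_subset_right).trans χ3)))
    (by rw [integral_sub iη (iχ.const_mul m), integral_const_mul, χ4, ← hm]; ring)
  have e := h ψ p1 p2 p3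
  rw [p4] at e
  have e1 : ∫ t in Ioo 0 T, (η t - m * χ t) • f t
      = (∫ t in Ioo 0 T, η t • f t) - m • c := by
    rw [hc, ← integral_smul, ← integral_sub (test_smul_integrable hf h1.continuous h2)
      (by exact (test_smul_integrable hf χ1.continuous χ2).smul m)]
    simp only [sub_smul, mul_smul]
  rw [← integral_test_eq_setIntegral h3]
  simp only [smul_sub]
  rw [integral_sub (test_smul_integrable hf h1.continuous h2)
    (test_smul_integrable (integrableOn_const (by simp)) h1.continuous h2), integral_smul_const]
  have e2 : ∫ t in Ioo 0 T, η t = m := by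
    have := integral_test_eq_setIntegral h3 (fun _ => (1 : ℝ))
    simpa using this
  rw [e2, ← e1, e]

/-- Fubini on the triangle s < t: the inner integral of ψ' over (s,T) is -ψ(s), because ψ vanishes
at T. -/
theorem integral_deriv_smul_primitive {T : ℝ} {y : ℝ → E} (hy : IntegrableOn y (Ioo 0 T))
    {ψ : ℝ → ℝ} (h1 : ContDiff ℝ ∞ ψ) (h2 : HasCompactSupport ψ) (h3 : tsupport ψ ⊆ Ioo 0 T) :
    ∫ t in Ioo 0 T, deriv ψ t • ∫ s in Ioo 0 t, y s = - ∫ t in Ioo 0 T, ψ t • y t := by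
  have hd : Continuous (deriv ψ) := h1.continuous_deriv (by simp)
  have hprod : Integrable (fun p : ℝ × ℝ => deriv ψ p.1 • y p.2)
      ((volume.restrict (Ioo 0 T)).prod (volume.restrict (Ioo 0 T))) :=
    Integrable.smul_prod ((hd.integrable_of_hasCompactSupport h2.deriv).restrict) hy
  have hms : MeasurableSet {p : ℝ × ℝ | p.2 < p.1} :=
    measurableSet_lt measurable_snd measurable_fst
  have e1 : ∀ t ∈ Ioo 0 T, deriv ψ t • ∫ s in Ioo 0 t, y s
      = ∫ s in Ioo 0 T, {p : ℝ × ℝ | p.2 < p.1}.indicator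
        (fun p : ℝ × ℝ => deriv ψ p.1 • y p.2) (t, s) := by
    intro t ht
    rw [← integral_smul, ← integral_indicator measurableSet_Ioo, ← integral_indicator measurableSet_Ioo]
    congr 1 with s
    by_cases hs : s ∈ Ioo 0 t
    · rw [indicator_of_mem hs, indicator_of_mem (show s ∈ Ioo 0 T from ⟨hs.1, hs.2.trans ht.2⟩),
        indicator_of_mem (by exact hs.2)]
    · rw [indicator_of_notMem hs]
      by_cases hs' : s ∈ Ioo 0 T
      · rw [indicator_of_mem hs', indicator_of_notMem]
        exact fun h => hs ⟨hs'.1, h⟩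
      · rw [indicator_of_notMem hs']
  rw [setIntegral_congr_fun measurableSet_Ioo e1,
    integral_integral_swap (f := fun t s => {p : ℝ × ℝ | p.2 < p.1}.indicator
        (fun p : ℝ × ℝ => deriv ψ p.1 • y p.2) (t, s)) (hprod.indicator hms), ← integral_neg]
  refine setIntegral_congr_fun measurableSet_Ioo fun s hs => ?_
  have e2 : ∀ t, {p : ℝ × ℝ | p.2 < p.1}.indicator
        (fun p : ℝ × ℝ => deriv ψ p.1 • y p.2) (t, s) = (Ioi s).indicator (deriv ψ) t • y s := by
    intro t
    by_cases h : s < t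
    · rw [indicator_of_mem (by exact h), indicator_of_mem (by exact h)]
    · rw [indicator_of_notMem (by exact h), indicator_of_notMem (by exact h), zero_smul]
  simp only [e2]
  rw [integral_smul_const, setIntegral_indicator measurableSet_Ioi]
  have e3 : Ioo 0 T ∩ Ioi s = Ioo s T := by
    ext t; simp only [mem_inter_iff, mem_Ioo, mem_Ioi]
    exact ⟨fun h => ⟨h.2, h.1.2⟩, fun h => ⟨⟨hs.1.trans h.1, h.2⟩, h.1⟩⟩
  rw [e3, ← integral_Ioc_eq_integral_Ioo, ← intervalIntegral.integral_of_le hs.2.le,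
    intervalIntegral.integral_deriv_eq_sub (fun x _ => h1.differentiable (by simp) x)
      (hd.intervalIntegrable _ _),
    image_eq_zero_of_notMem_tsupport (fun h => (h3 h).2.false)]
  simp

/-- A function with an integrable weak derivative is a primitive of it. -/
theorem ae_eq_const_add_integral {T : ℝ} (hT : 0 < T) {f y : ℝ → E}
    (hf : IntegrableOn f (Ioo 0 T)) (hy : IntegrableOn y (Ioo 0 T))
    (h : ∀ ψ : ℝ → ℝ, ContDiff ℝ ∞ ψ → HasCompactSupport ψ → tsupport ψ ⊆ Ioo 0 T →
      ∫ t in Ioo 0 T, deriv ψ t • f t = - ∫ t in Ioo 0 T, ψ t • y t) :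
    ∃ c : E, ∀ᵐ t ∂volume.restrict (Ioo 0 T), f t = c + ∫ s in Ioo 0 t, y s := by
  have hY : IntegrableOn (fun t => ∫ s in Ioo 0 t, y s) (Ioo 0 T) := by
    have hc : ContinuousOn (fun t => ∫ s in Ioc 0 t, y s) (Icc 0 T) :=
      intervalIntegral.continuousOn_primitive (by rwa [integrableOn_Icc_iff_integrableOn_Ioo])
    simp only [integral_Ioc_eq_integral_Ioo] at hc
    exact hc.integrableOn_Icc.mono_set Ioo_subset_Icc_self
  obtain ⟨c, hc⟩ := ae_eq_const_of_integral_deriv_smul_eq_zero hT (hf.sub hY) (by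
    intro ψ h1 h2 h3
    have hd : Continuous (deriv ψ) := h1.continuous_deriv (by simp)
    simp only [Pi.sub_apply, smul_sub]
    rw [integral_sub (test_smul_integrable hf hd h2.deriv) (test_smul_integrable hY hd h2.deriv),
      h ψ h1 h2 h3, integral_deriv_smul_primitive hy h1 h2 h3, sub_self])
  refine ⟨c, ?_⟩
  filter_upwards [hc] with t ht
  rw [← ht]; simp

end WeakDerivative

/-! ### Resolvents of positive operators. -/

section Resolvent

variable {E : Type*} [NormedAddCommGroup E] [InnerProductSpace ℝ E] [CompleteSpace E]

/-- The resolvent of a positive symmetric operator. -/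
theorem exists_resolvent (S : E →L[ℝ] E) (hpos : ∀ u, 0 ≤ inner ℝ (S u) u) {l : ℝ} (hl : 0 < l) :
    ∃ J : E →L[ℝ] E, (∀ x, S (J x) + l • J x = x) ∧ ∀ x, J (S x) + l • J x = x := by
  -- Lax–Milgram for the form of S + l: positivity of S leaves l as coercivity constant.
  let B : E →L[ℝ] E →L[ℝ] ℝ := (innerSL ℝ (E := E)).comp (S + l • ContinuousLinearMap.id ℝ E)
  have hB : ∀ v w, B v w = inner ℝ (S v + l • v) w := fun v w => rfl
  have hco : IsCoercive B := by
    refine ⟨l, hl, fun u => ?_⟩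
    rw [hB, inner_add_left, real_inner_smul_left, real_inner_self_eq_norm_mul_norm]
    nlinarith [hpos u]
  let e := hco.continuousLinearEquivOfBilin
  have he : ∀ v, e v = S v + l • v := fun v => by
    refine ext_inner_right ℝ fun w => ?_
    rw [hco.continuousLinearEquivOfBilin_apply, hB]
  refine ⟨(e.symm : E →L[ℝ] E), fun x => ?_, fun x => ?_⟩
  · have := he (e.symm x)
    rw [e.apply_symm_apply] at this
    exact this.symm
  · have := e.symm_apply_apply x
    rw [he, map_add, map_smul] at this
    exact this

/-- `S (S + l)⁻¹ → 1` strongly as `l → 0`, for a positive symmetric injective operator `S`. -/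
theorem exists_norm_resolvent_sub_le (S : E →L[ℝ] E) (hsym : ∀ u v, inner ℝ (S u) v = inner ℝ u (S v))
    (hpos : ∀ u, 0 ≤ inner ℝ (S u) u) (hinj : ∀ u, S u = 0 → u = 0) (x : E) {δ : ℝ} (hδ : 0 < δ) :
    ∃ l₀ : ℝ, 0 < l₀ ∧ ∀ l : ℝ, 0 < l → l ≤ l₀ → ∀ J : E →L[ℝ] E, (∀ x, S (J x) + l • J x = x) →
      (∀ x, J (S x) + l • J x = x) → ‖S (J x) - x‖ ≤ δ := by
  -- A vector orthogonal to the range of S is annihilated by S, by symmetry, and so vanishes by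
  -- injectivity.
  have hdense : Dense (Set.range S) := by
    have h1 : S.rangeᗮ = ⊥ := by
      rw [Submodule.eq_bot_iff]
      intro v hv
      refine hinj v ?_
      rw [← inner_self_eq_zero (𝕜 := ℝ), hsym]
      exact (Submodule.mem_orthogonal' _ _).1 hv _ ⟨S v, rfl⟩
    have h2 := Submodule.topologicalClosure_eq_top_iff.2 h1
    rw [← Submodule.dense_iff_topologicalClosure_eq_top] at h2
    exact h2
  obtain ⟨_, hz, ⟨z, rfl⟩⟩ := Metric.dense_iff.1 hdense x (δ / 2) (by positivity)
  rw [Metric.mem_ball, dist_eq_norm] at hz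
  refine ⟨δ / 2 / (‖z‖ + 1), by positivity, fun l hl hl0 J h1 h2 => ?_⟩
  -- In the expansion of ‖S J w + l J w‖² = ‖w‖² the cross term is nonnegative, so each square is at
  -- most ‖w‖².
  have hsq : ∀ w, ‖l • J w‖ ≤ ‖w‖ ∧ ‖S (J w)‖ ≤ ‖w‖ := by
    intro w
    have e : ‖w‖ ^ 2 = ‖S (J w)‖ ^ 2 + 2 * (l * inner ℝ (S (J w)) (J w)) + ‖l • J w‖ ^ 2 := by
      conv_lhs => rw [← h1 w]
      rw [norm_add_sq_real, real_inner_smul_right]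
    have := mul_nonneg hl.le (hpos (J w))
    constructor
    · exact abs_le_of_sq_le_sq' (by nlinarith [sq_nonneg ‖S (J w)‖]) (norm_nonneg _) |>.2
    · exact abs_le_of_sq_le_sq' (by nlinarith [sq_nonneg ‖l • J w‖]) (norm_nonneg _) |>.2
  -- The error is -l J x. Splitting x at S z, the first piece has norm at most ‖x - S z‖ < δ/2, and
  -- the second is l S J z, of norm at most l ‖z‖.
  have e1 : S (J x) - x = -(l • J (x - S z)) - l • J (S z) := by
    have h3 := h1 x
    rw [map_sub, smul_sub]
    nth_rewrite 2 [← h3]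
    abel
  have e2 : J (S z) = S (J z) := by
    have := (h1 z).trans (h2 z).symm
    exact (add_right_cancel this).symm
  rw [e1, e2]
  refine (norm_sub_le _ _).trans ?_
  rw [norm_neg, norm_smul l (S (J z)), Real.norm_of_nonneg hl.le]
  have a1 := (hsq (x - S z)).1
  rw [norm_sub_rev] at hz
  have a2 : l * ‖S (J z)‖ ≤ δ / 2 := by
    calc l * ‖S (J z)‖ ≤ δ / 2 / (‖z‖ + 1) * (‖z‖ + 1) := by
          gcongr
          exact (hsq z).2.trans (by linarith)
      _ = δ / 2 := by field_simp
  linarith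

end Resolvent

/-! ### Functions of time in L²(0,T;E): continuous representatives, pointwise operators,
multipliers. -/

section ContinuousFunctions

variable {E : Type} [NormedAddCommGroup E]

/-- Cauchy–Schwarz on (0,T); the constant is the square root of the total mass. -/
theorem integral_norm_le {T : ℝ} (u : L2T T E) :
    ∫ t in Ioo 0 T, ‖u t‖ ≤ ((volume.restrict (Ioo (0 : ℝ) T)) univ ^ (1 / 2 : ℝ)).toReal * ‖u‖ := by
  have h := eLpNorm_le_eLpNorm_mul_rpow_measure_univ (p := 1) (q := 2) (by norm_num)
    (Lp.aestronglyMeasurable u)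
  have h1 : ∫ t in Ioo 0 T, ‖u t‖ = (eLpNorm u 1 (volume.restrict (Ioo 0 T))).toReal := by
    rw [eLpNorm_one_eq_lintegral_enorm, integral_norm_eq_lintegral_enorm (Lp.aestronglyMeasurable u)]
  rw [h1, Lp.norm_def, ← ENNReal.toReal_mul, mul_comm]
  refine ENNReal.toReal_mono (ENNReal.mul_ne_top (Lp.eLpNorm_ne_top u) ?_) (h.trans (le_of_eq ?_))
  · exact ENNReal.rpow_ne_top_of_nonneg (by norm_num) (measure_ne_top _ _)
  · norm_num

theorem memLp_of_continuous {T : ℝ} {f : ℝ → E} (hf : Continuous f) :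
    MemLp f 2 (volume.restrict (Ioo (0 : ℝ) T)) := by
  obtain ⟨C, hC⟩ := (isCompact_Icc (a := (0 : ℝ)) (b := T)).exists_bound_of_continuousOn hf.continuousOn
  refine MemLp.of_bound hf.aestronglyMeasurable C ?_
  filter_upwards [ae_restrict_mem measurableSet_Ioo] with t ht
  exact hC t (Ioo_subset_Icc_self ht)

/-- The class in `L²(0,T;E)` of a continuous function. -/
def ofCont (T : ℝ) (f : ℝ → E) (hf : Continuous f) : L2T T E := (memLp_of_continuous hf).toLp f

theorem coeFn_ofCont {T : ℝ} {f : ℝ → E} (hf : Continuous f) :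
    ∀ᵐ t ∂volume.restrict (Ioo 0 T), ofCont T f hf t = f t := (memLp_of_continuous hf).coeFn_toLp

end ContinuousFunctions

section Lift

variable {E F G : Type} [NormedAddCommGroup E] [NormedSpace ℝ E] [NormedAddCommGroup F]
  [NormedSpace ℝ F] [NormedAddCommGroup G] [NormedSpace ℝ G]

/-- The operator on `L²(0,T;·)` which applies `L` pointwise. -/
def lift (T : ℝ) (L : E →L[ℝ] F) : L2T T E →L[ℝ] L2T T F :=
  L.compLpL 2 (volume.restrict (Ioo (0 : ℝ) T))

theorem coeFn_lift {T : ℝ} (L : E →L[ℝ] F) (u : L2T T E) :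
    ∀ᵐ t ∂volume.restrict (Ioo 0 T), lift T L u t = L (u t) :=
  L.coeFn_compLpL u

theorem norm_lift_le {T : ℝ} (L : E →L[ℝ] F) (u : L2T T E) : ‖lift T L u‖ ≤ ‖L‖ * ‖u‖ :=
  ((lift T L).le_opNorm u).trans (by gcongr; exact L.norm_compLpL_le)

theorem lift_lift {T : ℝ} (L : F →L[ℝ] G) (L' : E →L[ℝ] F) (u : L2T T E) :
    lift T L (lift T L' u) = lift T (L.comp L') u := by
  refine Lp.ext ?_
  filter_upwards [coeFn_lift L (lift T L' u), coeFn_lift L' u, coeFn_lift (L.comp L') u]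
    with t h1 h2 h3
  rw [h1, h2, h3]; rfl

theorem exists_norm_ofCont_sub_le {T : ℝ} (u : L2T T E) {δ : ℝ} (hδ : 0 < δ) :
    ∃ (h : ℝ → E) (hc : Continuous h), ‖ofCont T h hc - u‖ ≤ δ := by
  obtain ⟨g, -, h2, h3, -⟩ := (Lp.memLp u).exists_hasCompactSupport_eLpNorm_sub_le
    (by norm_num) (ε := ENNReal.ofReal δ) (by simpa using hδ)
  refine ⟨g, h3, ?_⟩
  rw [norm_sub_rev, Lp.norm_def]
  refine ENNReal.toReal_le_of_le_ofReal hδ.le (le_trans (le_of_eq (eLpNorm_congr_ae ?_)) h2)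
  filter_upwards [Lp.coeFn_sub u (ofCont T g h3), coeFn_ofCont (T := T) h3] with t e1 e2
  rw [e1, Pi.sub_apply, Pi.sub_apply, e2]

theorem memLp_smul {T : ℝ} {e : ℝ → ℝ} (he : Continuous e) (u : L2T T E) :
    MemLp (fun t => e t • u t) 2 (volume.restrict (Ioo (0 : ℝ) T)) := by
  obtain ⟨C, hC⟩ := (isCompact_Icc (a := (0 : ℝ)) (b := T)).exists_bound_of_continuousOn he.continuousOn
  refine (Lp.memLp u).of_le_mul (c := C)
    (he.aestronglyMeasurable.smul (Lp.aestronglyMeasurable u)) ?_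
  filter_upwards [ae_restrict_mem measurableSet_Ioo] with t ht
  rw [norm_smul]
  gcongr
  exact hC t (Ioo_subset_Icc_self ht)

/-- The product of `u ∈ L²(0,T;E)` with a continuous function of time. -/
def timeMul {T : ℝ} (e : ℝ → ℝ) (he : Continuous e) (u : L2T T E) : L2T T E := (memLp_smul he u).toLp _

theorem coeFn_timeMul {T : ℝ} {e : ℝ → ℝ} (he : Continuous e) (u : L2T T E) :
    ∀ᵐ t ∂volume.restrict (Ioo 0 T), timeMul e he u t = e t • u t := (memLp_smul he u).coeFn_toLp

theorem norm_timeMul_le {T : ℝ} {e : ℝ → ℝ} (he : Continuous e) {C : ℝ}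
    (hC : ∀ t ∈ Ioo 0 T, |e t| ≤ C) (u : L2T T E) : ‖timeMul e he u‖ ≤ C * ‖u‖ := by
  refine Lp.norm_le_mul_norm_of_ae_le_mul ?_
  filter_upwards [coeFn_timeMul he u, ae_restrict_mem measurableSet_Ioo] with t h1 ht
  rw [h1, norm_smul]
  gcongr
  exact hC t ht

end Lift

/-! ### Approximation of functions with a weak time derivative. -/

section Evolution

variable {V H : Type} [NormedAddCommGroup V] [InnerProductSpace ℝ V] [CompleteSpace V]
  [NormedAddCommGroup H] [InnerProductSpace ℝ H] [CompleteSpace H]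

/-- `⟨u, v⟩_{L²(0,T;V)} = ∫ ⟨u(t), v(t)⟩ dt`. -/
theorem L2T_inner {E : Type} [NormedAddCommGroup E] [InnerProductSpace ℝ E] {T : ℝ} (u v : L2T T E) :
    inner ℝ u v = ∫ t in Ioo 0 T, inner ℝ (u t) (v t) := L2.inner_def u v

theorem L2T_norm_sq {E : Type} [NormedAddCommGroup E] [InnerProductSpace ℝ E] {T : ℝ} (u : L2T T E) :
    ‖u‖ ^ 2 = ∫ t in Ioo 0 T, ‖u t‖ ^ 2 := by
  rw [← real_inner_self_eq_norm_sq, L2T_inner]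
  simp only [real_inner_self_eq_norm_sq]

theorem inner_lift_left {E F : Type} [NormedAddCommGroup E] [InnerProductSpace ℝ E] [CompleteSpace E]
    [NormedAddCommGroup F] [InnerProductSpace ℝ F] [CompleteSpace F] {T : ℝ} (L : E →L[ℝ] F)
    (u : L2T T E) (v : L2T T F) :
    inner ℝ (lift T L u) v = inner ℝ u (lift T (ContinuousLinearMap.adjoint L) v) := by
  rw [L2T_inner, L2T_inner]
  refine integral_congr_ae ?_
  filter_upwards [coeFn_lift L u, coeFn_lift (ContinuousLinearMap.adjoint L) v] with t h1 h2
  rw [h1, h2, ContinuousLinearMap.adjoint_inner_right]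

/-- The operator `i* i`, which represents the inner product of `H` on `V`. -/
def gram (i : V →L[ℝ] H) : V →L[ℝ] V := (ContinuousLinearMap.adjoint i).comp i

theorem gram_inner (i : V →L[ℝ] H) (u v : V) : inner ℝ (gram i u) v = inner ℝ (i u) (i v) :=
  ContinuousLinearMap.adjoint_inner_left i v (i u)

theorem gram_symm (i : V →L[ℝ] H) (u v : V) : inner ℝ (gram i u) v = inner ℝ u (gram i v) := by
  rw [gram_inner, real_inner_comm _ u, gram_inner, real_inner_comm]

theorem inner_lift_gram {T : ℝ} (i : V →L[ℝ] H) (u v : L2T T V) :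
    inner ℝ (lift T (gram i) u) v = inner ℝ (lift T i u) (lift T i v) := by
  rw [inner_lift_left i, lift_lift, ← gram, L2T_inner, L2T_inner]
  refine integral_congr_ae ?_
  filter_upwards [coeFn_lift (gram i) u, coeFn_lift (gram i) v] with t h1 h2
  rw [h1, h2, gram_symm]

/-- `y` is the weak derivative of `i* i u` in `L²(0,T;V)`. -/
def HasWeakDeriv {T : ℝ} (i : V →L[ℝ] H) (u y : L2T T V) : Prop :=
  ∀ ψ : ℝ → ℝ, ContDiff ℝ ∞ ψ → HasCompactSupport ψ → tsupport ψ ⊆ Ioo 0 T →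
    ∫ t in Ioo 0 T, deriv ψ t • gram i (u t) = - ∫ t in Ioo 0 T, ψ t • y t

theorem L2T_integrableOn {E : Type} [NormedAddCommGroup E] {T : ℝ} (u : L2T T E) :
    IntegrableOn u (Ioo 0 T) := (Lp.memLp u).integrable (by norm_num)

/-- Functions with a weak time derivative are approximated by continuously differentiable ones. -/
theorem HasWeakDeriv.exists_approx {T : ℝ} (hT : 0 < T) {i : V →L[ℝ] H}
    (hi : Function.Injective i) {u y : L2T T V} (h : HasWeakDeriv i u y) {δ : ℝ} (hδ : 0 < δ) :
    ∃ (v v' : ℝ → V) (hv : Continuous v) (hv' : Continuous v'), (∀ t, HasDerivAt v (v' t) t) ∧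
      ‖ofCont T v hv - u‖ ≤ δ ∧ ‖lift T (gram i) (ofCont T v' hv') - y‖ ≤ δ := by
  set S := gram i with hS
  have hpos : ∀ u, 0 ≤ inner ℝ (S u) u := fun u => by
    rw [gram_inner]; exact real_inner_self_nonneg
  have hsym' : ∀ u v : L2T T V, inner ℝ (lift T S u) v = inner ℝ u (lift T S v) := fun u v => by
    rw [inner_lift_gram, real_inner_comm _ u, inner_lift_gram, real_inner_comm]
  have hpos' : ∀ u : L2T T V, 0 ≤ inner ℝ (lift T S u) u := fun u => by
    rw [inner_lift_gram]; exact real_inner_self_nonneg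
  have hinj' : ∀ u : L2T T V, lift T S u = 0 → u = 0 := fun u hu => by
    have h0 : lift T i u = 0 := by
      rw [← inner_self_eq_zero (𝕜 := ℝ), ← inner_lift_gram, ← hS, hu, inner_zero_left]
    refine (Lp.eq_zero_iff_ae_eq_zero).2 ?_
    filter_upwards [coeFn_lift i u, (Lp.eq_zero_iff_ae_eq_zero).1 h0] with t h1 h2
    exact hi (by rw [← h1, h2]; simp)
  obtain ⟨l₁, hl₁, H₁⟩ := exists_norm_resolvent_sub_le _ hsym' hpos' hinj' u (half_pos hδ)
  obtain ⟨l₂, hl₂, H₂⟩ := exists_norm_resolvent_sub_le _ hsym' hpos' hinj' y (half_pos hδ)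
  set l := min l₁ l₂ with hl
  have hl0 : 0 < l := lt_min hl₁ hl₂
  -- J = (S + l)⁻¹. The regularization of u is J S u, close to u for small l; the corresponding
  -- derivative S J y is close to y for the same l.
  obtain ⟨J, hJ1, hJ2⟩ := exists_resolvent S hpos hl0
  have hJ1' : ∀ x : L2T T V, lift T S (lift T J x) + l • lift T J x = x := fun x => by
    refine Lp.ext ?_
    filter_upwards [Lp.coeFn_add (lift T S (lift T J x)) (l • lift T J x),
      Lp.coeFn_smul l (lift T J x), coeFn_lift J x, coeFn_lift S (lift T J x)] with t h1 h2 h3 h4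
    rw [h1, Pi.add_apply, h2, Pi.smul_apply, h4, h3, hJ1]
  have hJ2' : ∀ x : L2T T V, lift T J (lift T S x) + l • lift T J x = x := fun x => by
    refine Lp.ext ?_
    filter_upwards [Lp.coeFn_add (lift T J (lift T S x)) (l • lift T J x),
      Lp.coeFn_smul l (lift T J x), coeFn_lift J x, coeFn_lift S x, coeFn_lift J (lift T S x)]
      with t h1 h2 h3 h4 h5
    rw [h1, Pi.add_apply, h2, Pi.smul_apply, h5, h4, h3, hJ2]
  have A₁ := H₁ l hl0 (min_le_left _ _) _ hJ1' hJ2'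
  have A₂ := H₂ l hl0 (min_le_right _ _) _ hJ1' hJ2'
  have hcomm : lift T S (lift T J u) = lift T J (lift T S u) :=
    add_right_cancel ((hJ1' u).trans (hJ2' u).symm)
  rw [hcomm] at A₁
  -- Since S u = c + ∫ y, the regularization J S u = J c + ∫ J y is absolutely continuous with
  -- values in V. To be C¹ it only needs a continuous g in place of J y.
  obtain ⟨c, hc⟩ := ae_eq_const_add_integral hT (S.integrable_comp (L2T_integrableOn u))
    (L2T_integrableOn y) h
  set K₁ : ℝ := ((volume.restrict (Ioo (0 : ℝ) T)) univ ^ (1 / 2 : ℝ)).toReal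
  set K₂ : ℝ := measureUnivNNReal (volume.restrict (Ioo (0 : ℝ) T)) ^ (2 : ℝ≥0∞).toReal⁻¹
  have hK₁ : 0 ≤ K₁ := ENNReal.toReal_nonneg
  have hK₂ : 0 ≤ K₂ := by positivity
  -- K₁ bounds the L¹ norm by the L² norm on (0,T) and K₂ the L² norm by the sup norm. Replacing J y
  -- by g thus costs K₂ K₁ η for the function and ‖S‖ η for its derivative; the tolerance η keeps
  -- both within δ/2.
  obtain ⟨g, hg, hgy⟩ := exists_norm_ofCont_sub_le (lift T J y)
    (δ := δ / 2 / (K₂ * K₁ + ‖S‖ + 1)) (by positivity)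
  set η := δ / 2 / (K₂ * K₁ + ‖S‖ + 1) with hη
  have hη0 : 0 < η := by positivity
  have hη1 : η * (K₂ * K₁ + ‖S‖ + 1) = δ / 2 := by rw [hη]; field_simp
  have hder : ∀ t, HasDerivAt (fun t => J c + ∫ s in (0 : ℝ)..t, g s) (g t) t := fun t =>
    (hg.integral_hasStrictDerivAt 0 t).hasDerivAt.const_add _
  have hv : Continuous (fun t => J c + ∫ s in (0 : ℝ)..t, g s) :=
    continuous_iff_continuousAt.2 fun t => (hder t).continuousAt
  refine ⟨_, g, hv, hg, hder, ?_, ?_⟩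
  · have B : ‖ofCont T _ hv - lift T J (lift T S u)‖ ≤ K₂ * (K₁ * η) := by
      refine Lp.norm_le_of_ae_bound (by positivity) ?_
      filter_upwards [Lp.coeFn_sub (ofCont T _ hv) (lift T J (lift T S u)), coeFn_ofCont (T := T) hv,
        coeFn_lift J (lift T S u), coeFn_lift S u, hc, ae_restrict_mem measurableSet_Ioo]
        with t h1 h2 h3 h4 h5 ht
      have hsub : Ioo 0 t ⊆ Ioo 0 T := Ioo_subset_Ioo_right ht.2.le
      have iy : IntegrableOn y (Ioo 0 t) := (L2T_integrableOn y).mono_set hsub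
      have ig : IntegrableOn g (Ioo 0 t) := hg.integrableOn_Ioc.mono_set Ioo_subset_Ioc_self
      rw [h1, Pi.sub_apply, h2, h3, h4, h5, map_add, intervalIntegral.integral_of_le ht.1.le,
        integral_Ioc_eq_integral_Ioo, ← J.integral_comp_comm iy, add_sub_add_left_eq_sub,
        ← integral_sub ig (J.integrable_comp iy)]
      refine (norm_integral_le_integral_norm _).trans ?_
      have e : ∫ s in Ioo 0 T, ‖g s - J (y s)‖ = ∫ s in Ioo 0 T, ‖(ofCont T g hg - lift T J y) s‖ := by
        refine integral_congr_ae ?_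
        filter_upwards [Lp.coeFn_sub (ofCont T g hg) (lift T J y), coeFn_ofCont (T := T) hg,
          coeFn_lift J y] with s e1 e2 e3
        rw [e1, Pi.sub_apply, e2, e3]
      have ig' : IntegrableOn g (Ioo 0 T) := hg.integrableOn_Ioc.mono_set Ioo_subset_Ioc_self
      refine (setIntegral_mono_set (ig'.sub (J.integrable_comp (L2T_integrableOn y))).norm
        (Eventually.of_forall fun s => norm_nonneg _) hsub.eventuallyLE).trans ?_
      change ∫ s in Ioo 0 T, ‖g s - J (y s)‖ ≤ _
      rw [e]
      exact (integral_norm_le _).trans (by gcongr)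
    have := norm_sub_le_norm_sub_add_norm_sub (ofCont T _ hv) (lift T J (lift T S u)) u
    nlinarith [norm_nonneg S]
  · have B : ‖lift T S (ofCont T g hg) - lift T S (lift T J y)‖ ≤ ‖S‖ * η := by
      rw [← map_sub]
      exact (norm_lift_le _ _).trans (by gcongr)
    have := norm_sub_le_norm_sub_add_norm_sub (lift T S (ofCont T g hg)) (lift T S (lift T J y)) y
    have : 0 ≤ η * (K₂ * K₁) := by positivity
    nlinarith [norm_nonneg S]

/-- The fundamental theorem of calculus for ⟨i v, i w⟩. The operator `gram` moves the inner products
from H to V, so that only `gram i v'` occurs and not v' itself; this is the quantity that converges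
in the approximation. -/
theorem inner_sub_inner_eq_integral {i : V →L[ℝ] H} {v v' w w' : ℝ → V} (hv : Continuous v)
    (hv' : Continuous v') (hw : Continuous w) (hw' : Continuous w')
    (dv : ∀ t, HasDerivAt v (v' t) t) (dw : ∀ t, HasDerivAt w (w' t) t) (s t : ℝ) :
    inner ℝ (i (v t)) (i (w t)) - inner ℝ (i (v s)) (i (w s))
      = ∫ r in s..t, (inner ℝ (gram i (v' r)) (w r) + inner ℝ (gram i (w' r)) (v r)) := by
  rw [intervalIntegral.integral_eq_sub_of_hasDerivAt
    (f := fun r => inner ℝ (i (v r)) (i (w r)))]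
  · intro r _
    have h1 := (i.hasFDerivAt.comp_hasDerivAt r (dv r)).inner ℝ (i.hasFDerivAt.comp_hasDerivAt r (dw r))
    refine h1.congr_deriv ?_
    simp only [Function.comp]
    rw [gram_inner, gram_inner, add_comm, real_inner_comm (i (v r)) (i (w' r))]
  · exact Continuous.intervalIntegrable (by fun_prop) _ _

theorem inner_sub_inner_eq_inner {T : ℝ} (hT : 0 < T) {i : V →L[ℝ] H} {v v' w w' : ℝ → V}
    (hv : Continuous v) (hv' : Continuous v') (hw : Continuous w) (hw' : Continuous w')
    (dv : ∀ t, HasDerivAt v (v' t) t) (dw : ∀ t, HasDerivAt w (w' t) t) :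
    inner ℝ (i (v T)) (i (w T)) - inner ℝ (i (v 0)) (i (w 0))
      = inner ℝ (lift T (gram i) (ofCont T v' hv')) (ofCont T w hw)
        + inner ℝ (lift T (gram i) (ofCont T w' hw')) (ofCont T v hv) := by
  rw [inner_sub_inner_eq_integral hv hv' hw hw' dv dw, L2T_inner, L2T_inner,
    intervalIntegral.integral_of_le hT.le, integral_Ioc_eq_integral_Ioo, ← integral_add
      (L2.integrable_inner _ _) (L2.integrable_inner _ _)]
  refine integral_congr_ae ?_
  filter_upwards [coeFn_ofCont (T := T) hv, coeFn_ofCont (T := T) hv', coeFn_ofCont (T := T) hw,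
    coeFn_ofCont (T := T) hw', coeFn_lift (gram i) (ofCont T v' hv'),
    coeFn_lift (gram i) (ofCont T w' hw')] with t h1 h2 h3 h4 h5 h6
  rw [h5, h6, h1, h2, h3, h4]

/-- The energy identity between s and t gives ‖i v(t)‖² ≤ ‖i v(s)‖² + a² + b², where a and b are the
L² norms of v and `gram i v'`. Averaging over s in (0,T) replaces ‖i v(s)‖² by ‖i‖² a²/T. The
estimate is what makes C¹ approximations converge uniformly in H. -/
theorem exists_norm_le_of_hasDerivAt {T : ℝ} (hT : 0 < T) (i : V →L[ℝ] H) :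
    ∃ C : ℝ, 0 ≤ C ∧ ∀ (v v' : ℝ → V) (hv : Continuous v) (hv' : Continuous v'),
      (∀ t, HasDerivAt v (v' t) t) → ∀ t ∈ Icc 0 T,
      ‖i (v t)‖ ≤ C * (‖ofCont T v hv‖ + ‖lift T (gram i) (ofCont T v' hv')‖) := by
  refine ⟨√(‖i‖ ^ 2 / T + 1), Real.sqrt_nonneg _, fun v v' hv hv' dv t ht => ?_⟩
  set a := ‖ofCont T v hv‖
  set b := ‖lift T (gram i) (ofCont T v' hv')‖
  have ha : 0 ≤ a := norm_nonneg _
  have hb : 0 ≤ b := norm_nonneg _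
  have ea : a ^ 2 = ∫ s in Ioo 0 T, ‖v s‖ ^ 2 := by
    rw [L2T_norm_sq]
    refine integral_congr_ae ?_
    filter_upwards [coeFn_ofCont (T := T) hv] with s hs
    rw [hs]
  have eb : b ^ 2 = ∫ s in Ioo 0 T, ‖gram i (v' s)‖ ^ 2 := by
    rw [L2T_norm_sq]
    refine integral_congr_ae ?_
    filter_upwards [coeFn_lift (gram i) (ofCont T v' hv'), coeFn_ofCont (T := T) hv'] with s h1 h2
    rw [h1, h2]
  have hint : ∀ {f : ℝ → ℝ}, Continuous f → IntegrableOn f (Ioo 0 T) := fun hf =>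
    hf.integrableOn_Ioc.mono_set Ioo_subset_Ioc_self
  have hN : ∀ s ∈ Ioo 0 T, ‖i (v t)‖ ^ 2 ≤ ‖i (v s)‖ ^ 2 + (a ^ 2 + b ^ 2) := by
    intro s hs
    have e := inner_sub_inner_eq_integral (i := i) hv hv' hv hv' dv dv s t
    rw [real_inner_self_eq_norm_sq, real_inner_self_eq_norm_sq] at e
    have h1 : |∫ r in s..t, (inner ℝ (gram i (v' r)) (v r) + inner ℝ (gram i (v' r)) (v r))|
        ≤ a ^ 2 + b ^ 2 := by
      rw [← Real.norm_eq_abs, intervalIntegral.norm_intervalIntegral_eq]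
      refine (norm_integral_le_integral_norm _).trans ?_
      have hsub : uIoc s t ⊆ Ioc 0 T := by
        intro r hr
        rw [mem_uIoc] at hr
        rcases hr with hr | hr
        · exact ⟨hs.1.trans hr.1, hr.2.trans ht.2⟩
        · exact ⟨ht.1.trans_lt hr.1, hr.2.trans hs.2.le⟩
      have hc1 : Continuous fun r => ‖v r‖ ^ 2 + ‖gram i (v' r)‖ ^ 2 := by fun_prop
      have hc2 : Continuous fun r =>
        ‖inner ℝ (gram i (v' r)) (v r) + inner ℝ (gram i (v' r)) (v r)‖ := by fun_prop
      calc _ ≤ ∫ r in uIoc s t, (‖v r‖ ^ 2 + ‖gram i (v' r)‖ ^ 2) := by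
            refine integral_mono ((hc2.integrableOn_Ioc).mono_set hsub)
              ((hc1.integrableOn_Ioc).mono_set hsub) fun r => ?_
            have := abs_real_inner_le_norm (gram i (v' r)) (v r)
            rw [← two_mul, norm_mul, Real.norm_eq_abs, Real.norm_eq_abs, abs_two]
            nlinarith [sq_nonneg (‖gram i (v' r)‖ - ‖v r‖)]
        _ ≤ ∫ r in Ioc 0 T, (‖v r‖ ^ 2 + ‖gram i (v' r)‖ ^ 2) :=
            setIntegral_mono_set hc1.integrableOn_Ioc
              (Eventually.of_forall fun r => by positivity) hsub.eventuallyLE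
        _ = a ^ 2 + b ^ 2 := by
            rw [integral_Ioc_eq_integral_Ioo, ea, eb, integral_add (hint (by fun_prop))
              (hint (by fun_prop))]
    linarith [le_abs_self (∫ r in s..t, (inner ℝ (gram i (v' r)) (v r) + inner ℝ (gram i (v' r)) (v r)))]
  have hI : T * ‖i (v t)‖ ^ 2 ≤ ‖i‖ ^ 2 * a ^ 2 + T * (a ^ 2 + b ^ 2) := by
    have h1 := setIntegral_mono_on (integrableOn_const (by simp))
      (hint (f := fun s => ‖i‖ ^ 2 * ‖v s‖ ^ 2 + (a ^ 2 + b ^ 2)) (by fun_prop)) measurableSet_Ioo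
      (fun s hs => (hN s hs).trans (by
        have := i.le_opNorm (v s)
        gcongr
        rw [← mul_pow]
        gcongr))
    rw [integral_add (hint (by fun_prop)) (hint (by fun_prop)), integral_const_mul, ← ea] at h1
    simpa [hT.le] using h1
  have hfin : ‖i (v t)‖ ^ 2 ≤ (√(‖i‖ ^ 2 / T + 1) * (a + b)) ^ 2 := by
    rw [mul_pow, Real.sq_sqrt (by positivity)]
    have h2 : ‖i (v t)‖ ^ 2 ≤ ‖i‖ ^ 2 / T * a ^ 2 + (a ^ 2 + b ^ 2) := by
      have : T * ‖i (v t)‖ ^ 2 ≤ T * (‖i‖ ^ 2 / T * a ^ 2 + (a ^ 2 + b ^ 2)) := by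
        refine hI.trans (le_of_eq ?_)
        field_simp
      exact le_of_mul_le_mul_left this hT
    have h3 : 0 ≤ ‖i‖ ^ 2 / T := by positivity
    nlinarith [mul_nonneg ha hb, mul_nonneg h3 (mul_nonneg ha hb), mul_nonneg h3 (sq_nonneg b)]
  exact abs_le_of_sq_le_sq' hfin (by positivity) |>.2

end Evolution

/-! ### Continuous representatives and integration by parts in time. -/

section Traces

set_option linter.unusedSectionVars false

variable {V H : Type} [NormedAddCommGroup V] [InnerProductSpace ℝ V] [CompleteSpace V]
  [NormedAddCommGroup H] [InnerProductSpace ℝ H] [CompleteSpace H]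

/-- `U` is a representative of `i u` that is continuous from `[0,T]` to `H`. -/
def IsRep {T : ℝ} (i : V →L[ℝ] H) (u : L2T T V) (U : ℝ → H) : Prop :=
  ContinuousOn U (Icc 0 T) ∧ ∀ᵐ t ∂volume.restrict (Ioo 0 T), i (u t) = U t

/-- Continuous functions that agree almost everywhere on (0,T) agree up to the endpoints, so initial
and final values do not depend on the representative. -/
theorem IsRep.eqOn {T : ℝ} (hT : 0 < T) {i : V →L[ℝ] H} {u : L2T T V} {U U' : ℝ → H}
    (h : IsRep i u U) (h' : IsRep i u U') : EqOn U U' (Icc 0 T) := by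
  refine Measure.eqOn_Icc_of_ae_eq volume hT.ne ?_ h.1 h'.1
  rw [← restrict_Ioo_eq_restrict_Icc]
  filter_upwards [h.2, h'.2] with t h1 h2
  rw [← h1, h2]

theorem IsRep.add {T : ℝ} {i : V →L[ℝ] H} {u u' : L2T T V} {U U' : ℝ → H}
    (h : IsRep i u U) (h' : IsRep i u' U') : IsRep i (u + u') (U + U') := by
  refine ⟨h.1.add h'.1, ?_⟩
  filter_upwards [h.2, h'.2, Lp.coeFn_add u u'] with t h1 h2 h3
  rw [h3, Pi.add_apply, Pi.add_apply, map_add, h1, h2]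

theorem IsRep.smul {T : ℝ} {i : V →L[ℝ] H} {u : L2T T V} {U : ℝ → H} (c : ℝ)
    (h : IsRep i u U) : IsRep i (c • u) (c • U) := by
  refine ⟨h.1.const_smul c, ?_⟩
  filter_upwards [h.2, Lp.coeFn_smul c u] with t h1 h3
  rw [h3, Pi.smul_apply, Pi.smul_apply, map_smul, h1]

theorem IsRep.sub {T : ℝ} {i : V →L[ℝ] H} {u u' : L2T T V} {U U' : ℝ → H}
    (h : IsRep i u U) (h' : IsRep i u' U') : IsRep i (u - u') (U - U') := by
  have := h.add (h'.smul (-1))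
  rwa [neg_one_smul, neg_one_smul, ← sub_eq_add_neg, ← sub_eq_add_neg] at this

/-- Approximation by continuously differentiable functions, together with the convergence of their
values in `H`. -/
theorem HasWeakDeriv.exists_approx_seq {T : ℝ} (hT : 0 < T) {i : V →L[ℝ] H}
    (hi : Function.Injective i) {u y : L2T T V} (h : HasWeakDeriv i u y) :
    ∃ (U : ℝ → H) (v v' : ℕ → ℝ → V) (hv : ∀ k, Continuous (v k)) (hv' : ∀ k, Continuous (v' k)),
      (∀ k t, HasDerivAt (v k) (v' k t) t) ∧
      Tendsto (fun k => ofCont T (v k) (hv k)) atTop (𝓝 u) ∧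
      Tendsto (fun k => lift T (gram i) (ofCont T (v' k) (hv' k))) atTop (𝓝 y) ∧
      IsRep i u U ∧ ∀ t ∈ Icc 0 T, Tendsto (fun k => i (v k t)) atTop (𝓝 (U t)) := by
  have hpos : ∀ k : ℕ, (0 : ℝ) < 1 / ((k : ℝ) + 1) := fun k => by positivity
  choose v v' hv hv' dv h1 h2 using fun k : ℕ => h.exists_approx hT hi (hpos k)
  have hlim := tendsto_one_div_add_atTop_nhds_zero_nat (𝕜 := ℝ)
  have t1 : Tendsto (fun k => ofCont T (v k) (hv k)) atTop (𝓝 u) :=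
    tendsto_iff_norm_sub_tendsto_zero.2 (squeeze_zero (fun _ => norm_nonneg _) h1 hlim)
  have t2 : Tendsto (fun k => lift T (gram i) (ofCont T (v' k) (hv' k))) atTop (𝓝 y) :=
    tendsto_iff_norm_sub_tendsto_zero.2 (squeeze_zero (fun _ => norm_nonneg _) h2 hlim)
  obtain ⟨C, hC, hb⟩ := exists_norm_le_of_hasDerivAt hT i
  let W : ℕ → C(Icc (0 : ℝ) T, H) := fun k => ⟨fun t => i (v k t), by
    have := hv k
    fun_prop⟩
  have hW : CauchySeq W := by
    -- The sup estimate is applied to v k - v m. Four errors enter, those of the functions and of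
    -- the derivatives for k and for m, each at most 1/(N+1).
    refine cauchySeq_of_le_tendsto_0 (fun N : ℕ => C * 4 * (1 / ((N : ℝ) + 1))) ?_ ?_
    · intro k m N hk hm
      have hmono : ∀ k, N ≤ k → 1 / ((k : ℝ) + 1) ≤ 1 / ((N : ℝ) + 1) := fun k hk => by gcongr
      refine (ContinuousMap.dist_le (by positivity)).2 fun t => ?_
      rw [dist_eq_norm]
      change ‖i (v k t) - i (v m t)‖ ≤ _
      rw [← map_sub]
      have e1 : ofCont T (fun t => v k t - v m t) ((hv k).sub (hv m))
          = ofCont T (v k) (hv k) - ofCont T (v m) (hv m) := rfl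
      have e2 : ofCont T (fun t => v' k t - v' m t) ((hv' k).sub (hv' m))
          = ofCont T (v' k) (hv' k) - ofCont T (v' m) (hv' m) := rfl
      refine (hb (fun t => v k t - v m t) (fun t => v' k t - v' m t) ((hv k).sub (hv m))
        ((hv' k).sub (hv' m)) (fun t => (dv k t).sub (dv m t)) t t.2).trans ?_
      rw [e1, e2, map_sub, mul_assoc]
      refine mul_le_mul_of_nonneg_left ?_ hC
      have a1 := norm_sub_le_norm_sub_add_norm_sub (ofCont T (v k) (hv k)) u (ofCont T (v m) (hv m))
      have a2 := norm_sub_le_norm_sub_add_norm_sub (lift T (gram i) (ofCont T (v' k) (hv' k))) y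
        (lift T (gram i) (ofCont T (v' m) (hv' m)))
      rw [norm_sub_rev u] at a1
      rw [norm_sub_rev y] at a2
      linarith [h1 k, h1 m, h2 k, h2 m, hmono k hk, hmono m hm]
    · simpa using hlim.const_mul (C * 4)
  obtain ⟨W₀, hW₀⟩ := cauchySeq_tendsto_of_complete hW
  have hpt : ∀ t (ht : t ∈ Icc 0 T), Tendsto (fun k => i (v k t)) atTop (𝓝 (W₀ ⟨t, ht⟩)) :=
    fun t ht => ((continuous_eval_const (F := C(Icc (0 : ℝ) T, H)) (⟨t, ht⟩ : Icc (0 : ℝ) T)).tendsto W₀).comp hW₀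
  have hpt' : ∀ t ∈ Icc 0 T, Tendsto (fun k => i (v k t)) atTop (𝓝 (IccExtend hT.le W₀ t)) :=
    fun t ht => by
      rw [IccExtend_of_mem hT.le W₀ ht]
      exact hpt t ht
  refine ⟨IccExtend hT.le W₀, v, v', hv, hv', dv, t1, t2,
    ⟨(W₀.continuous.Icc_extend' (h := hT.le)).continuousOn, ?_⟩, hpt'⟩
  -- L² convergence yields convergence almost everywhere only along a subsequence, which suffices to
  -- identify the uniform limit with i u.
  obtain ⟨ns, hns, hae⟩ := (tendstoInMeasure_of_tendsto_Lp t1).exists_seq_tendsto_ae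
  filter_upwards [hae, ae_all_iff.2 fun k => coeFn_ofCont (T := T) (hv k),
    ae_restrict_mem measurableSet_Ioo] with t a1 a2 a3
  simp only [a2] at a1
  exact tendsto_nhds_unique ((i.continuous.tendsto _).comp a1)
    ((hpt' t (Ioo_subset_Icc_self a3)).comp hns.tendsto_atTop)

theorem HasWeakDeriv.exists_isRep {T : ℝ} (hT : 0 < T) {i : V →L[ℝ] H}
    (hi : Function.Injective i) {u y : L2T T V} (h : HasWeakDeriv i u y) : ∃ U, IsRep i u U := by
  obtain ⟨U, -, -, -, -, -, -, -, hU, -⟩ := h.exists_approx_seq hT hi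
  exact ⟨U, hU⟩

/-- Integration by parts in time. -/
theorem HasWeakDeriv.inner_sub_inner {T : ℝ} (hT : 0 < T) {i : V →L[ℝ] H}
    (hi : Function.Injective i) {u y z x : L2T T V} {U Z : ℝ → H} (h : HasWeakDeriv i u y)
    (h' : HasWeakDeriv i z x) (hU : IsRep i u U) (hZ : IsRep i z Z) :
    inner ℝ (U T) (Z T) - inner ℝ (U 0) (Z 0) = inner ℝ y z + inner ℝ x u := by
  obtain ⟨U', v, v', hv, hv', dv, a1, a2, a3, a4⟩ := h.exists_approx_seq hT hi
  obtain ⟨Z', w, w', hw, hw', dw, b1, b2, b3, b4⟩ := h'.exists_approx_seq hT hi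
  have m0 : (0 : ℝ) ∈ Icc 0 T := left_mem_Icc.2 hT.le
  have mT : T ∈ Icc 0 T := right_mem_Icc.2 hT.le
  rw [hU.eqOn hT a3 m0, hU.eqOn hT a3 mT, hZ.eqOn hT b3 m0, hZ.eqOn hT b3 mT]
  -- The formula for C¹ functions passes to the limit: boundary values converge in H, the remaining
  -- terms in L²(0,T;V).
  refine tendsto_nhds_unique (((a4 T mT).inner (𝕜 := ℝ) (b4 T mT)).sub ((a4 0 m0).inner (b4 0 m0))) ?_
  refine ((a2.inner b1).add (b2.inner a1)).congr fun k => ?_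
  exact (inner_sub_inner_eq_inner hT (hv k) (hv' k) (hw k) (hw' k) (dv k) (dw k)).symm

theorem integrableOn_smul_gram {T : ℝ} (i : V →L[ℝ] H) {ψ : ℝ → ℝ} (hψ : Continuous ψ)
    (hc : HasCompactSupport ψ) (u : L2T T V) :
    IntegrableOn (fun t => ψ t • gram i (u t)) (Ioo 0 T) :=
  test_smul_integrable ((gram i).integrable_comp (L2T_integrableOn u)) hψ hc

theorem HasWeakDeriv.add {T : ℝ} {i : V →L[ℝ] H} {u y z x : L2T T V} (h : HasWeakDeriv i u y)
    (h' : HasWeakDeriv i z x) : HasWeakDeriv i (u + z) (y + x) := by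
  intro ψ h1 h2 h3
  have hd : Continuous (deriv ψ) := h1.continuous_deriv (by simp)
  have e1 : ∫ t in Ioo 0 T, deriv ψ t • gram i ((u + z) t)
      = ∫ t in Ioo 0 T, (deriv ψ t • gram i (u t) + deriv ψ t • gram i (z t)) := by
    refine integral_congr_ae ?_
    filter_upwards [Lp.coeFn_add u z] with t ht
    rw [ht, Pi.add_apply, map_add, smul_add]
  have e2 : ∫ t in Ioo 0 T, ψ t • (y + x) t = ∫ t in Ioo 0 T, (ψ t • y t + ψ t • x t) := by
    refine integral_congr_ae ?_
    filter_upwards [Lp.coeFn_add y x] with t ht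
    rw [ht, Pi.add_apply, smul_add]
  rw [e1, e2, integral_add (integrableOn_smul_gram i hd h2.deriv u)
    (integrableOn_smul_gram i hd h2.deriv z), integral_add
    (test_smul_integrable (L2T_integrableOn y) h1.continuous h2)
    (test_smul_integrable (L2T_integrableOn x) h1.continuous h2), h ψ h1 h2 h3, h' ψ h1 h2 h3,
    neg_add]

theorem HasWeakDeriv.smul {T : ℝ} {i : V →L[ℝ] H} {u y : L2T T V} (c : ℝ) (h : HasWeakDeriv i u y) :
    HasWeakDeriv i (c • u) (c • y) := by
  intro ψ h1 h2 h3
  have e1 : ∫ t in Ioo 0 T, deriv ψ t • gram i ((c • u) t)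
      = ∫ t in Ioo 0 T, c • (deriv ψ t • gram i (u t)) := by
    refine integral_congr_ae ?_
    filter_upwards [Lp.coeFn_smul c u] with t ht
    rw [ht, Pi.smul_apply, map_smul, smul_comm]
  have e2 : ∫ t in Ioo 0 T, ψ t • (c • y) t = ∫ t in Ioo 0 T, c • (ψ t • y t) := by
    refine integral_congr_ae ?_
    filter_upwards [Lp.coeFn_smul c y] with t ht
    rw [ht, Pi.smul_apply, smul_comm]
  rw [e1, e2, integral_smul, integral_smul, h ψ h1 h2 h3, smul_neg]

theorem HasWeakDeriv.sub {T : ℝ} {i : V →L[ℝ] H} {u y z x : L2T T V} (h : HasWeakDeriv i u y)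
    (h' : HasWeakDeriv i z x) : HasWeakDeriv i (u - z) (y - x) := by
  have := h.add (h'.smul (-1))
  rwa [neg_one_smul, neg_one_smul, ← sub_eq_add_neg, ← sub_eq_add_neg] at this

theorem HasWeakDeriv.unique {T : ℝ} {i : V →L[ℝ] H} {u y y' : L2T T V} (h : HasWeakDeriv i u y)
    (h' : HasWeakDeriv i u y') : y = y' := by
  have hli : ∀ g : L2T T V, LocallyIntegrableOn g (Ioo 0 T) volume := fun g =>
    (L2T_integrableOn g).locallyIntegrableOn
  have key := isOpen_Ioo.ae_eq_zero_of_integral_contDiff_smul_eq_zero (μ := volume)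
    (f := fun t => y t - y' t) ((hli y).sub (hli y')) ?_
  · refine Lp.ext ?_
    filter_upwards [(ae_restrict_iff' measurableSet_Ioo).2 key] with t ht
    exact sub_eq_zero.1 ht
  · intro ψ h1 h2 h3
    have e := neg_inj.1 ((h ψ h1 h2 h3).symm.trans (h' ψ h1 h2 h3))
    rw [← integral_test_eq_setIntegral h3]
    simp only [smul_sub]
    rw [integral_sub (test_smul_integrable (L2T_integrableOn y) h1.continuous h2)
      (test_smul_integrable (L2T_integrableOn y') h1.continuous h2), e, sub_self]

theorem inner_timeMul_left {T : ℝ} {e : ℝ → ℝ} (he : Continuous e) (u v : L2T T V) :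
    inner ℝ (timeMul e he u) v = inner ℝ u (timeMul e he v) := by
  rw [L2T_inner, L2T_inner]
  refine integral_congr_ae ?_
  filter_upwards [coeFn_timeMul he u, coeFn_timeMul he v] with t h1 h2
  rw [h1, h2, real_inner_smul_left, real_inner_smul_right]

theorem IsRep.timeMul {T : ℝ} {i : V →L[ℝ] H} {u : L2T T V} {U : ℝ → H} {e : ℝ → ℝ}
    (he : Continuous e) (h : IsRep i u U) :
    IsRep i (timeMul e he u) (fun t => e t • U t) := by
  refine ⟨he.continuousOn.smul h.1, ?_⟩
  filter_upwards [h.2, coeFn_timeMul he u] with t h1 h2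
  rw [h2, map_smul, h1]

/-- The product rule for multiplication by a smooth function of time. -/
theorem HasWeakDeriv.timeMul {T : ℝ} {i : V →L[ℝ] H} {u y : L2T T V} (h : HasWeakDeriv i u y)
    {e : ℝ → ℝ} (he : ContDiff ℝ ∞ e) :
    HasWeakDeriv i (timeMul e he.continuous u) (timeMul e he.continuous y
      + timeMul (deriv e) (he.continuous_deriv (by simp)) (lift T (gram i) u)) := by
  intro ψ h1 h2 h3
  have hd : Continuous (deriv ψ) := h1.continuous_deriv (by simp)
  have hde : Continuous (deriv e) := he.continuous_deriv (by simp)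
  have c2 : HasCompactSupport fun t => ψ t * e t := h2.mul_right
  -- The product ψ e is again a test function, since ψ brings the compact support.
  have key := h (fun t => ψ t * e t) (h1.mul he) c2 ((tsupport_mul_subset_left).trans h3)
  have ed : ∀ t, deriv (fun t => ψ t * e t) t = deriv ψ t * e t + ψ t * deriv e t := fun t =>
    deriv_fun_mul (h1.differentiable (by simp) t) (he.differentiable (by simp) t)
  have i1 : IntegrableOn (fun t => (deriv ψ t * e t) • gram i (u t)) (Ioo 0 T) :=
    integrableOn_smul_gram i (hd.mul he.continuous) (h2.deriv.mul_right) u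
  have i2 : IntegrableOn (fun t => (ψ t * deriv e t) • gram i (u t)) (Ioo 0 T) :=
    integrableOn_smul_gram i (h1.continuous.mul hde) (h2.mul_right) u
  have i3 : IntegrableOn (fun t => (ψ t * e t) • y t) (Ioo 0 T) :=
    test_smul_integrable (L2T_integrableOn y) (h1.continuous.mul he.continuous) c2
  simp only [ed, add_smul] at key
  rw [integral_add i1 i2] at key
  have e1 : ∫ t in Ioo 0 T, deriv ψ t • gram i (FourthOrderParabolic.timeMul e he.continuous u t)
      = ∫ t in Ioo 0 T, (deriv ψ t * e t) • gram i (u t) := by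
    refine integral_congr_ae ?_
    filter_upwards [coeFn_timeMul he.continuous u] with t ht
    rw [ht, map_smul, mul_smul]
  rw [e1, eq_sub_of_add_eq key]
  have e2 : ∫ t in Ioo 0 T, ψ t • (FourthOrderParabolic.timeMul e he.continuous y
      + FourthOrderParabolic.timeMul (deriv e) hde (lift T (gram i) u)) t
      = ∫ t in Ioo 0 T, ((ψ t * e t) • y t + (ψ t * deriv e t) • gram i (u t)) := by
    refine integral_congr_ae ?_
    filter_upwards [Lp.coeFn_add (FourthOrderParabolic.timeMul e he.continuous y)
      (FourthOrderParabolic.timeMul (deriv e) hde (lift T (gram i) u)), coeFn_timeMul he.continuous y,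
      coeFn_timeMul hde (lift T (gram i) u), coeFn_lift (gram i) u] with t a1 a2 a3 a4
    rw [a1, Pi.add_apply, a2, a3, a4, smul_add, mul_smul, mul_smul]
  rw [e2, integral_add i3 i2]
  abel

/-- Products `ψ(t) v` with `v` independent of time. -/
theorem hasWeakDeriv_smul_const {T : ℝ} (i : V →L[ℝ] H) {e : ℝ → ℝ} (he : ContDiff ℝ ∞ e) (v : V) :
    HasWeakDeriv i (ofCont T (fun t => e t • v) (he.continuous.smul continuous_const))
      (ofCont T (fun t => deriv e t • gram i v)
        ((he.continuous_deriv (by simp)).smul continuous_const)) := by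
  intro ψ h1 h2 h3
  have hd : Continuous (deriv ψ) := h1.continuous_deriv (by simp)
  have hde : Continuous (deriv e) := he.continuous_deriv (by simp)
  have e1 : ∫ t in Ioo 0 T, deriv ψ t • gram i
        (ofCont T (fun t => e t • v) (he.continuous.smul continuous_const) t)
      = ∫ t in Ioo 0 T, (deriv ψ t * e t) • gram i v := by
    refine integral_congr_ae ?_
    filter_upwards [coeFn_ofCont (T := T) (f := fun t => e t • v) (he.continuous.smul continuous_const)] with t ht
    rw [ht, map_smul, mul_smul]
  have e2 : ∫ t in Ioo 0 T, ψ t • ofCont T (fun t => deriv e t • gram i v)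
        (hde.smul continuous_const) t
      = ∫ t in Ioo 0 T, (ψ t * deriv e t) • gram i v := by
    refine integral_congr_ae ?_
    filter_upwards [coeFn_ofCont (T := T) (f := fun t => deriv e t • gram i v) (hde.smul continuous_const)] with t ht
    rw [ht, mul_smul]
  rw [e1, e2, integral_smul_const, integral_smul_const, ← neg_smul]
  congr 1
  have e3 : ∫ t in Ioo 0 T, deriv ψ t * e t = ∫ t, deriv ψ t * e t :=
    integral_test_eq_setIntegral ((tsupport_deriv_subset).trans h3) e
  have e4 : ∫ t in Ioo 0 T, ψ t * deriv e t = ∫ t, ψ t * deriv e t :=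
    integral_test_eq_setIntegral h3 (deriv e)
  rw [e3, e4]
  -- No boundary terms arise because ψ has compact support; e itself may be nonzero at the
  -- endpoints. An affine e is used later to detect the initial value.
  have := integral_mul_deriv_eq_deriv_mul_of_integrable (u := ψ) (v := e) (u' := deriv ψ)
    (v' := deriv e) (fun t _ => (h1.differentiable (by simp) t).hasDerivAt)
    (fun t _ => (he.differentiable (by simp) t).hasDerivAt)
    ((h1.continuous.mul hde).integrable_of_hasCompactSupport h2.mul_right)
    ((hd.mul he.continuous).integrable_of_hasCompactSupport h2.deriv.mul_right)
    ((h1.continuous.mul he.continuous).integrable_of_hasCompactSupport h2.mul_right)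
  rw [this, neg_neg]

theorem isRep_smul_const {T : ℝ} (i : V →L[ℝ] H) {e : ℝ → ℝ} (he : Continuous e) (v : V) :
    IsRep i (ofCont T (fun t => e t • v) (he.smul continuous_const)) (fun t => e t • i v) := by
  refine ⟨(he.smul continuous_const).continuousOn, ?_⟩
  filter_upwards [coeFn_ofCont (T := T) (f := fun t => e t • v) (he.smul continuous_const)] with t ht
  rw [ht, map_smul]

end Traces

/-! ### Linear parabolic problems in either time direction: energy estimate and solvability. -/

/-- A direction of time on `[0,T]`: forward (`σ = 1`) from `s = 0` to `e = T`, or backward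
(`σ = -1`) from `s = T` to `e = 0`. -/
def IsTimeDirection (T σ s e : ℝ) : Prop := (σ = 1 ∧ s = 0 ∧ e = T) ∨ (σ = -1 ∧ s = T ∧ e = 0)

theorem IsTimeDirection.reverse {T σ s e : ℝ} (h : IsTimeDirection T σ s e) :
    IsTimeDirection T (-σ) e s := by
  rcases h with ⟨rfl, rfl, rfl⟩ | ⟨rfl, rfl, rfl⟩
  · exact Or.inr ⟨rfl, rfl, rfl⟩
  · exact Or.inl ⟨neg_neg 1, rfl, rfl⟩

theorem IsTimeDirection.sub_eq {T σ s e : ℝ} (h : IsTimeDirection T σ s e) (f : ℝ → ℝ) :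
    f e - f s = σ * (f T - f 0) := by
  rcases h with ⟨rfl, rfl, rfl⟩ | ⟨rfl, rfl, rfl⟩ <;> ring

theorem IsTimeDirection.mul_self {T σ s e : ℝ} (h : IsTimeDirection T σ s e) : σ * σ = 1 := by
  rcases h with ⟨rfl, -, -⟩ | ⟨rfl, -, -⟩ <;> norm_num

theorem IsTimeDirection.abs_eq {T σ s e : ℝ} (h : IsTimeDirection T σ s e) : |σ| = 1 := by
  rcases h with ⟨rfl, -, -⟩ | ⟨rfl, -, -⟩ <;> norm_num

theorem IsTimeDirection.mem {T σ s e : ℝ} (h : IsTimeDirection T σ s e) (hT : 0 < T) :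
    s ∈ Icc 0 T ∧ e ∈ Icc 0 T := by
  rcases h with ⟨-, rfl, rfl⟩ | ⟨-, rfl, rfl⟩ <;>
  simp [hT.le]

theorem IsTimeDirection.ne {T σ s e : ℝ} (h : IsTimeDirection T σ s e) (hT : 0 < T) : s ≠ e := by
  rcases h with ⟨-, rfl, rfl⟩ | ⟨-, rfl, rfl⟩
  · exact hT.ne
  · exact hT.ne'

/-- If p exceeded E(1 + 1/c)(a + b), then E a ≤ p, so (E a)² ≤ E a p, and division by p would give
2cp ≤ E a + 2E b, against cp > (c + 1)E(a + b). With p bounded, the inequality bounds we; 1 + 2q ≤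
4q² for q = 1 + 1/c ≥ 1 gives the factor 2. -/
theorem le_of_energy_inequality {E c a b p we : ℝ} (hE1 : 1 ≤ E) (hc : 0 < c) (ha : 0 ≤ a)
    (hb : 0 ≤ b) (hp : 0 ≤ p)
    (hmain : we ^ 2 + 2 * c * p ^ 2 ≤ (E * a) ^ 2 + 2 * (E * b) * p) :
    p ≤ E * (1 + 1 / c) * (a + b) ∧ we ≤ 2 * E * (1 + 1 / c) * (a + b) := by
  set q := 1 + 1 / c with hq
  have hcq : c * q = c + 1 := by rw [hq]; field_simp
  have hq1 : 1 ≤ q := by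
    have : 0 < 1 / c := by positivity
    linarith
  have hpN : p ≤ E * q * (a + b) := by
    by_contra hcon
    push Not at hcon
    have k1 : c * (E * q * (a + b)) = (c + 1) * (E * (a + b)) := by
      rw [← hcq]; ring
    have k2 : (c + 1) * (E * (a + b)) < c * p := by rw [← k1]; gcongr
    have hEa : 0 ≤ E * a := by positivity
    have hEb : 0 ≤ E * b := by positivity
    have hEab : E * a ≤ p := by
      have : E * (a + b) ≤ E * q * (a + b) := by
        have : 0 ≤ E * (a + b) := by positivity
        nlinarith
      nlinarith
    have hp0 : 0 < p := lt_of_le_of_lt (by positivity) hcon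
    have k3 : (E * a) ^ 2 ≤ E * a * p := by nlinarith
    have k4 : 2 * c * p * p ≤ (E * a + 2 * (E * b)) * p := by nlinarith [sq_nonneg we]
    have k5 : 2 * c * p ≤ E * a + 2 * (E * b) := le_of_mul_le_mul_right k4 hp0
    nlinarith
  have hweN : we ≤ 2 * E * q * (a + b) := by
    refine abs_le_of_sq_le_sq' ?_ (by positivity) |>.2
    have k1 : 2 * (E * b) * p ≤ 2 * (E * (a + b)) * (E * q * (a + b)) := by
      gcongr
      linarith
    have k2 : (E * a) ^ 2 ≤ (E * (a + b)) ^ 2 := by gcongr; linarith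
    have k3 : we ^ 2 ≤ (E * (a + b)) ^ 2 * (1 + 2 * q) := by nlinarith [mul_nonneg hc.le (sq_nonneg p)]
    have k4 : 1 + 2 * q ≤ 4 * q ^ 2 := by nlinarith
    calc we ^ 2 ≤ (E * (a + b)) ^ 2 * (1 + 2 * q) := k3
      _ ≤ (E * (a + b)) ^ 2 * (4 * q ^ 2) := by gcongr
      _ = (2 * E * q * (a + b)) ^ 2 := by ring
  exact ⟨hpN, hweN⟩

section Parabolic

variable {V H : Type} [NormedAddCommGroup V] [InnerProductSpace ℝ V] [CompleteSpace V]
  [NormedAddCommGroup H] [InnerProductSpace ℝ H] [CompleteSpace H]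

/-- An operator on `L²(0,T;V)` which is local in time and satisfies a Gårding inequality. -/
structure IsGarding {T : ℝ} (i : V →L[ℝ] H) (A : L2T T V →L[ℝ] L2T T V) (c l : ℝ) : Prop where
  coercive : ∀ w, c * ‖w‖ ^ 2 ≤ inner ℝ (A w) w + l * inner ℝ (lift T (gram i) w) w
  comm : ∀ (e : ℝ → ℝ) (he : Continuous e) (u : L2T T V), A (timeMul e he u) = timeMul e he (A u)

/-- An operator and its transpose have the same quadratic form, and multiplication by a function of
time is symmetric. This makes the energy estimate available for the dual problem. -/
theorem IsGarding.transpose {T : ℝ} {i : V →L[ℝ] H} {A A' : L2T T V →L[ℝ] L2T T V} {c l : ℝ}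
    (h : IsGarding i A c l) (hA : ∀ u z, inner ℝ (A u) z = inner ℝ u (A' z)) :
    IsGarding i A' c l where
  coercive w := by
    rw [real_inner_comm, ← hA]
    exact h.coercive w
  comm e he u := by
    refine ext_inner_left ℝ fun z => ?_
    rw [← hA, ← inner_timeMul_left, ← h.comm, hA, inner_timeMul_left]

/-- The constant in the energy estimate. -/
def energyConst (T c l : ℝ) : ℝ := 2 * Real.exp (l * T) ^ 2 * (1 + 1 / c)

theorem energyConst_pos {T c l : ℝ} (hc : 0 < c) : 0 < energyConst T c l := by
  unfold energyConst; positivity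

/-- The energy estimate for `σ y + A u = F`, where `y` is the time derivative of `u`. -/
theorem IsGarding.energy {T : ℝ} (hT : 0 < T) {i : V →L[ℝ] H} (hi : Function.Injective i)
    {A : L2T T V →L[ℝ] L2T T V} {c l : ℝ} (hA : IsGarding i A c l) (hc : 0 < c) (hl : 0 ≤ l)
    {σ s e : ℝ} (hσ : IsTimeDirection T σ s e) {u y : L2T T V} {U : ℝ → H}
    (h : HasWeakDeriv i u y) (hU : IsRep i u U) :
    ‖u‖ ≤ energyConst T c l * (‖U s‖ + ‖σ • y + A u‖) ∧
      ‖U e‖ ≤ energyConst T c l * (‖U s‖ + ‖σ • y + A u‖) := by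
  set F := σ • y + A u with hF
  set E := Real.exp (l * T) with hE
  have hE1 : 1 ≤ E := Real.one_le_exp (by positivity)
  have hbd : ∀ τ : ℝ, |τ| = 1 → ∀ t ∈ Icc 0 T, |Real.exp (τ * l * t)| ≤ E := by
    intro τ hτ t ht
    rw [abs_of_pos (Real.exp_pos _), hE, Real.exp_le_exp]
    have h1 : τ ≤ 1 := hτ ▸ le_abs_self τ
    have h2 := mul_nonneg hl ht.1
    nlinarith [ht.2]
  have hm : ContDiff ℝ ∞ fun t : ℝ => Real.exp (-σ * l * t) := by fun_prop
  have hn : Continuous fun t : ℝ => Real.exp (σ * l * t) := by fun_prop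
  have hde : deriv (fun t : ℝ => Real.exp (-σ * l * t)) = fun t => (-σ * l) * Real.exp (-σ * l * t) := by
    ext t
    have : HasDerivAt (fun t : ℝ => -σ * l * t) (-σ * l) t := by
      simpa using (hasDerivAt_id t).const_mul (-σ * l)
    rw [this.exp.deriv, mul_comm]
  -- The weight exp(-σ l t) decays in the chosen direction of time. Differentiating it produces the
  -- term l i*i w that completes the Gårding inequality to coercivity.
  set w := timeMul _ hm.continuous u with hw
  have hinv : timeMul _ hn w = u := by
    refine Lp.ext ?_
    filter_upwards [coeFn_timeMul hn w, coeFn_timeMul hm.continuous u] with t h1 h2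
    rw [h1, hw, h2, smul_smul, ← Real.exp_add]
    simp
  have huw : ‖u‖ ≤ E * ‖w‖ := by
    conv_lhs => rw [← hinv]
    exact norm_timeMul_le hn (fun t ht => hbd σ hσ.abs_eq t (Ioo_subset_Icc_self ht)) w
  have hGF : ‖timeMul _ hm.continuous F‖ ≤ E * ‖F‖ :=
    norm_timeMul_le _ (fun t ht => hbd (-σ) (by rw [abs_neg, hσ.abs_eq]) t (Ioo_subset_Icc_self ht)) F
  have ibp := (h.timeMul hm).inner_sub_inner hT hi (h.timeMul hm) (hU.timeMul hm.continuous)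
    (hU.timeMul hm.continuous)
  -- The equation for w: σ w' + A w + l i*i w equals the weighted right-hand side. It uses that A
  -- commutes with the weight and that σ² = 1.
  have hy : σ • (timeMul _ hm.continuous y
      + timeMul _ (hm.continuous_deriv (by simp)) (lift T (gram i) u))
      = timeMul _ hm.continuous F - A w - l • lift T (gram i) w := by
    rw [hw, hA.comm]
    refine Lp.ext ?_
    filter_upwards [Lp.coeFn_smul σ (timeMul _ hm.continuous y
      + timeMul _ (hm.continuous_deriv (by simp)) (lift T (gram i) u)),
      Lp.coeFn_add (timeMul _ hm.continuous y)
        (timeMul _ (hm.continuous_deriv (by simp)) (lift T (gram i) u)),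
      coeFn_timeMul hm.continuous y,
      coeFn_timeMul (hm.continuous_deriv (by simp)) (lift T (gram i) u),
      coeFn_timeMul hm.continuous F, coeFn_timeMul hm.continuous (A u),
      Lp.coeFn_add (σ • y) (A u), Lp.coeFn_smul σ y, coeFn_lift (gram i) u,
      coeFn_lift (gram i) w, coeFn_timeMul hm.continuous u,
      Lp.coeFn_smul l (lift T (gram i) w),
      Lp.coeFn_sub (timeMul _ hm.continuous F) (timeMul _ hm.continuous (A u)),
      Lp.coeFn_sub (timeMul _ hm.continuous F - timeMul _ hm.continuous (A u))
        (l • lift T (gram i) w)] with t a1 a2 a3 a4 a5 a6 a7 a8 a9 a10 a11 a12 a13 a14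
    rw [a14, Pi.sub_apply, a13, Pi.sub_apply, a12, Pi.smul_apply, a10, hw, a11, a6, a5, a7,
      Pi.add_apply, a8, Pi.smul_apply, a1, Pi.smul_apply, a2, Pi.add_apply, a3, a4, a9, hde]
    simp only [map_smul, smul_add, smul_smul]
    have : σ * (-σ * l * Real.exp (-σ * l * t)) = -(l * Real.exp (-σ * l * t)) := by
      linear_combination (-l * Real.exp (-σ * l * t)) * hσ.mul_self
    rw [this, neg_smul, mul_comm σ]
    abel
  have hsum := hσ.sub_eq (fun t => inner ℝ (Real.exp (-σ * l * t) • U t) (Real.exp (-σ * l * t) • U t))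
  simp only [real_inner_self_eq_norm_sq] at hsum ibp
  have hflux := congrArg (fun x => 2 * inner ℝ x w) hy
  simp only [inner_sub_left, real_inner_smul_left] at hflux
  rw [ibp, ← hw] at hsum
  have hco := hA.coercive w
  have hcs := real_inner_le_norm (timeMul _ hm.continuous F) w
  have hm1 := hbd (-σ) (by rw [abs_neg, hσ.abs_eq]) s (hσ.mem hT).1
  have hWs : ‖Real.exp (-σ * l * s) • U s‖ ≤ E * ‖U s‖ := by
    rw [norm_smul]; gcongr; exact hm1
  have hWe : ‖U e‖ ≤ E * ‖Real.exp (-σ * l * e) • U e‖ := by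
    have : U e = Real.exp (σ * l * e) • Real.exp (-σ * l * e) • U e := by
      rw [smul_smul, ← Real.exp_add]; simp
    conv_lhs => rw [this]
    rw [norm_smul (Real.exp (σ * l * e))]
    gcongr
    exact hbd σ hσ.abs_eq e (hσ.mem hT).2
  set a := ‖U s‖
  set b := ‖F‖
  set p := ‖w‖
  set ws := ‖Real.exp (-σ * l * s) • U s‖
  set we := ‖Real.exp (-σ * l * e) • U e‖
  have ha : 0 ≤ a := norm_nonneg _
  have hb : 0 ≤ b := norm_nonneg _
  have hp : 0 ≤ p := norm_nonneg _
  have hws : 0 ≤ ws := norm_nonneg _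
  have hE0 : 0 ≤ E := by linarith
  set q := 1 + 1 / c with hq
  -- The weighted equation tested with w and integrated by parts; the weights are at most E on
  -- [0,T].
  have hmain : we ^ 2 + 2 * c * p ^ 2 ≤ (E * a) ^ 2 + 2 * (E * b) * p := by
    have h1 : ws ^ 2 ≤ (E * a) ^ 2 := by gcongr
    have h2 : ‖timeMul _ hm.continuous F‖ * p ≤ E * b * p := by gcongr
    nlinarith
  have hq0 : 0 ≤ q := by rw [hq]; positivity
  obtain ⟨hpN, hweN⟩ := le_of_energy_inequality hE1 hc ha hb hp hmain
  rw [← hq] at hpN hweN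
  unfold energyConst
  rw [← hE, ← hq]
  constructor
  -- A further factor E comes from undoing the weight, whence E² in the constant.
  · calc ‖u‖ ≤ E * p := huw
      _ ≤ E * (E * q * (a + b)) := by gcongr
      _ ≤ 2 * E ^ 2 * q * (a + b) := by
        have : 0 ≤ E ^ 2 * q * (a + b) := by positivity
        nlinarith
  · calc ‖U e‖ ≤ E * we := hWe
      _ ≤ E * (2 * E * q * (a + b)) := by gcongr
      _ = 2 * E ^ 2 * q * (a + b) := by ring

/-- The Lions projection lemma. -/
theorem exists_inner_eq_of_abs_le {Z W : Type*} [AddCommGroup Z] [Module ℝ Z] [NormedAddCommGroup W]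
    [InnerProductSpace ℝ W] [CompleteSpace W] (Q : Z →ₗ[ℝ] W) (f : Z →ₗ[ℝ] ℝ) {C : ℝ}
    (h : ∀ z, |f z| ≤ C * ‖Q z‖) : ∃ u : W, ∀ z, inner ℝ u (Q z) = f z := by
  -- The bound forces f to vanish on ker Q, so f descends to a bounded functional on the range of Q.
  -- Hahn–Banach extends it to W, and Riesz represents the extension.
  have hker : LinearMap.ker Q ≤ LinearMap.ker f := fun z hz => by
    have := h z
    rw [LinearMap.mem_ker.1 hz, norm_zero, mul_zero] at this
    exact abs_nonpos_iff.1 this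
  let g : LinearMap.range Q →ₗ[ℝ] ℝ :=
    ((LinearMap.ker Q).liftQ f hker).comp Q.quotKerEquivRange.symm.toLinearMap
  have hg : ∀ z, g ⟨Q z, z, rfl⟩ = f z := fun z => by
    have : Q.quotKerEquivRange.symm ⟨Q z, z, rfl⟩ = (LinearMap.ker Q).mkQ z := by
      rw [LinearEquiv.symm_apply_eq]
      rfl
    change ((LinearMap.ker Q).liftQ f hker) (Q.quotKerEquivRange.symm ⟨Q z, z, rfl⟩) = f z
    rw [this]
    rfl
  let g' : StrongDual ℝ (LinearMap.range Q) := g.mkContinuous C (by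
    rintro ⟨_, z, rfl⟩
    rw [hg]
    exact h z)
  obtain ⟨G, hG, -⟩ := exists_extension_norm_eq (LinearMap.range Q) g'
  refine ⟨(InnerProductSpace.toDual ℝ W).symm G, fun z => ?_⟩
  rw [InnerProductSpace.toDual_symm_apply, ← hg]
  exact hG ⟨Q z, z, rfl⟩

theorem inner_integral_smul_eq {T : ℝ} {ψ : ℝ → ℝ} (h1 : Continuous ψ) (h2 : HasCompactSupport ψ)
    (g : L2T T V) (v : V) :
    inner ℝ (∫ t in Ioo 0 T, ψ t • g t) v
      = inner ℝ g (ofCont T (fun t => ψ t • v) (h1.smul continuous_const)) := by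
  rw [real_inner_comm, ← integral_inner (test_smul_integrable (L2T_integrableOn g) h1 h2), L2T_inner]
  refine integral_congr_ae ?_
  filter_upwards [coeFn_ofCont (T := T) (f := fun t => ψ t • v) (h1.smul continuous_const)] with t ht
  rw [ht, real_inner_smul_right, real_inner_smul_right, real_inner_comm]

/-- Solvability of `σ y + A u = F`, `u(s) = g`, where `y` is the time derivative of `u`. -/
theorem IsGarding.exists_solution {T : ℝ} (hT : 0 < T) {i : V →L[ℝ] H} (hi : Function.Injective i)
    (hd : DenseRange i) {A A' : L2T T V →L[ℝ] L2T T V} {c l : ℝ} (hA : IsGarding i A c l)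
    (hAA : ∀ u z, inner ℝ (A u) z = inner ℝ u (A' z)) (hc : 0 < c) (hl : 0 ≤ l)
    {σ s e : ℝ} (hσ : IsTimeDirection T σ s e) (F : L2T T V) (g : H) :
    ∃ (u y : L2T T V) (U : ℝ → H), HasWeakDeriv i u y ∧ IsRep i u U ∧ U s = g ∧
      σ • y + A u = F := by
  have hA' := hA.transpose hAA
  -- The test space for the Lions lemma: triples of a function, its derivative and its value at s,
  -- with the function vanishing at the final time e.
  let Z : Submodule ℝ (L2T T V × L2T T V × H) :=
    { carrier := {p | HasWeakDeriv i p.1 p.2.1 ∧ ∃ P, IsRep i p.1 P ∧ P e = 0 ∧ P s = p.2.2}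
      zero_mem' := by
        have h0 := hasWeakDeriv_smul_const (T := T) i (e := fun _ => 0) contDiff_const 0
        have h1 := isRep_smul_const (T := T) i (e := fun _ => 0) continuous_const 0
        exact ⟨by simpa using h0.smul 0, 0, by simpa using h1.smul 0, rfl, rfl⟩
      add_mem' := by
        rintro p q ⟨h1, P, h2, h3, h4⟩ ⟨k1, K, k2, k3, k4⟩
        refine ⟨h1.add k1, P + K, h2.add k2, ?_, ?_⟩
        · rw [Pi.add_apply, h3, k3, add_zero]
        · rw [Pi.add_apply, h4, k4]; rfl
      smul_mem' := by
        rintro r p ⟨h1, P, h2, h3, h4⟩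
        refine ⟨h1.smul r, r • P, h2.smul r, ?_, ?_⟩
        · rw [Pi.smul_apply, h3, smul_zero]
        · rw [Pi.smul_apply, h4]; rfl }
  let p1 : Z →ₗ[ℝ] L2T T V := (LinearMap.fst ℝ _ _).comp Z.subtype
  let p2 : Z →ₗ[ℝ] L2T T V := (LinearMap.fst ℝ _ _).comp ((LinearMap.snd ℝ _ _).comp Z.subtype)
  let p3 : Z →ₗ[ℝ] H := (LinearMap.snd ℝ _ _).comp ((LinearMap.snd ℝ _ _).comp Z.subtype)
  let Q : Z →ₗ[ℝ] L2T T V := (-σ) • p2 + (A' : L2T T V →ₗ[ℝ] L2T T V).comp p1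
  let f : Z →ₗ[ℝ] ℝ := (innerSL ℝ F : L2T T V →ₗ[ℝ] ℝ).comp p1 + (innerSL ℝ g : H →ₗ[ℝ] ℝ).comp p3
  have hest : ∀ z, |f z| ≤ (‖F‖ + ‖g‖) * energyConst T c l * ‖Q z‖ := by
    rintro ⟨⟨z, x, k⟩, h1, P, h2, h3, h4⟩
    -- For the transposed operator with time reversed, e is the starting point. The starting value
    -- is zero there, so the right-hand side alone bounds both z and its value at s.
    have he := hA'.energy hT hi hc hl hσ.reverse h1 h2
    rw [h3, h4, norm_zero, zero_add] at he
    change |inner ℝ F z + inner ℝ g k| ≤ (‖F‖ + ‖g‖) * energyConst T c l * ‖-σ • x + A' z‖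
    calc _ ≤ ‖F‖ * ‖z‖ + ‖g‖ * ‖k‖ := (abs_add_le _ _).trans
          (add_le_add (abs_real_inner_le_norm _ _) (abs_real_inner_le_norm _ _))
      _ ≤ ‖F‖ * (energyConst T c l * ‖-σ • x + A' z‖)
          + ‖g‖ * (energyConst T c l * ‖-σ • x + A' z‖) := by
          gcongr
          · exact he.1
          · exact he.2
      _ = _ := by ring
  obtain ⟨u, hu⟩ := exists_inner_eq_of_abs_le Q f hest
  have hu' : ∀ (z x : L2T T V) (P : ℝ → H), HasWeakDeriv i z x → IsRep i z P → P e = 0 →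
      inner ℝ u (-σ • x + A' z) = inner ℝ F z + inner ℝ g (P s) := fun z x P h1 h2 h3 =>
    hu ⟨(z, x, P s), h1, P, h2, h3, rfl⟩
  -- Test functions ψ(t) v with ψ compactly supported in (0,T) show that the functional identity
  -- contains the equation.
  have hw : HasWeakDeriv i u (σ • (F - A u)) := by
    intro ψ h1 h2 h3
    have hdψ : Continuous (deriv ψ) := h1.continuous_deriv (by simp)
    have hz : ∀ t, t ∉ Ioo 0 T → ψ t = 0 := fun t ht =>
      image_eq_zero_of_notMem_tsupport fun h => ht (h3 h)
    have hz0 : ψ 0 = 0 := hz 0 (by simp)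
    have hzT : ψ T = 0 := hz T (by simp)
    have hse : ψ e = 0 ∧ ψ s = 0 := by
      rcases hσ with ⟨-, rfl, rfl⟩ | ⟨-, rfl, rfl⟩
      exacts [⟨hzT, hz0⟩, ⟨hz0, hzT⟩]
    refine ext_inner_right ℝ fun v => ?_
    have e0 := hu' _ _ _ (hasWeakDeriv_smul_const i h1 v) (isRep_smul_const i h1.continuous v)
      (by rw [hse.1, zero_smul])
    rw [hse.2, zero_smul, inner_zero_right, add_zero, inner_add_right, real_inner_smul_right, ← hAA] at e0
    have e1 : ∫ t in Ioo 0 T, deriv ψ t • gram i (u t)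
        = ∫ t in Ioo 0 T, deriv ψ t • lift T (gram i) u t := by
      refine integral_congr_ae ?_
      filter_upwards [coeFn_lift (gram i) u] with t ht
      rw [ht]
    have e2 : inner ℝ (lift T (gram i) u) (ofCont T (fun t => deriv ψ t • v)
        (hdψ.smul continuous_const)) = inner ℝ u (ofCont T (fun t => deriv ψ t • gram i v)
        (hdψ.smul continuous_const)) := by
      rw [L2T_inner, L2T_inner]
      refine integral_congr_ae ?_
      filter_upwards [coeFn_lift (gram i) u, coeFn_ofCont (T := T) (f := fun t => deriv ψ t • v)
        (hdψ.smul continuous_const), coeFn_ofCont (T := T) (f := fun t => deriv ψ t • gram i v)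
        (hdψ.smul continuous_const)] with t a1 a2 a3
      rw [a1, a2, a3, gram_symm, map_smul]
    rw [e1, inner_integral_smul_eq hdψ h2.deriv, e2, inner_neg_left,
      inner_integral_smul_eq h1.continuous h2, real_inner_smul_left, inner_sub_left]
    linear_combination (-σ) * e0 + (-inner ℝ u (ofCont T (fun t => deriv ψ t • gram i v)
        (hdψ.smul continuous_const))) * hσ.mul_self
  obtain ⟨U, hU⟩ := hw.exists_isRep hT hi
  refine ⟨u, _, U, hw, hU, ?_, ?_⟩
  -- The affine function equal to 1 at s and 0 at e makes ψ(t) v admissible. Integration by parts,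
  -- compared with the functional identity, leaves ⟨U s - g, i v⟩ = 0, and the range of i is dense.
  · have hψ : ContDiff ℝ ∞ fun t : ℝ => (t - e) / (s - e) := by fun_prop
    have hψs : (s - e) / (s - e) = 1 := div_self (sub_ne_zero.2 (hσ.ne hT))
    have key : ∀ v, inner ℝ (U s - g) (i v) = 0 := by
      intro v
      have e0 := hu' _ _ _ (hasWeakDeriv_smul_const i hψ v) (isRep_smul_const i hψ.continuous v)
        (by simp)
      have ibp := hw.inner_sub_inner hT hi (hasWeakDeriv_smul_const i hψ v) hU
        (isRep_smul_const i hψ.continuous v)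
      have hsum := hσ.sub_eq (fun t => inner ℝ (U t) (((t - e) / (s - e)) • i v))
      rw [ibp] at hsum
      simp only [hψs, one_smul, sub_self, zero_div, zero_smul, inner_zero_right] at hsum e0
      rw [inner_add_right, real_inner_smul_right, ← hAA] at e0
      rw [real_inner_smul_left, inner_sub_left, real_inner_comm u] at hsum
      rw [inner_sub_left]
      linear_combination (-1) * hsum + e0 - (inner ℝ F (ofCont T (fun t => ((t - e) / (s - e)) • v)
        (hψ.continuous.smul continuous_const)) - inner ℝ (A u)
        (ofCont T (fun t => ((t - e) / (s - e)) • v)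
        (hψ.continuous.smul continuous_const))) * hσ.mul_self
    have : U s - g = 0 := by
      refine hd.induction_on (p := fun x => inner ℝ (U s - g) x = 0) (U s - g)
        (isClosed_eq (by fun_prop) continuous_const) key |> inner_self_eq_zero.1
    exact sub_eq_zero.1 this
  · rw [smul_smul, hσ.mul_self, one_smul, sub_add_cancel]

end Parabolic

/-! ### Measurability in time and multiplication operators. -/

section WeakMeasurability

/-- Pettis' theorem in separable Hilbert spaces. -/
theorem stronglyMeasurable_of_inner {α E : Type*} [MeasurableSpace α] [NormedAddCommGroup E]
    [InnerProductSpace ℝ E] [CompleteSpace E] [SecondCountableTopology E] {f : α → E}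
    (hf : ∀ v, Measurable fun a => inner ℝ v (f a)) : StronglyMeasurable f := by
  -- The spans of the first k terms of a dense sequence. Projections of f onto them are finite sums
  -- with measurable coefficients, and they converge pointwise to f.
  let U : ℕ → Submodule ℝ E := fun k =>
    Submodule.span ℝ (TopologicalSpace.denseSeq E '' (Finset.range k : Set ℕ))
  have hfin : ∀ k, FiniteDimensional ℝ (U k) := fun k =>
    FiniteDimensional.span_of_finite ℝ ((Finset.finite_toSet _).image _)
  have hmono : Monotone U := fun k m hkm => Submodule.span_mono
    (image_mono (Finset.coe_subset.2 (Finset.range_mono hkm)))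
  have hdense : ⊤ ≤ (⨆ k, U k).topologicalClosure := by
    intro x _
    refine closure_mono ?_ ((TopologicalSpace.denseRange_denseSeq E) x)
    rintro _ ⟨k, rfl⟩
    refine Submodule.mem_iSup_of_mem (k + 1) (Submodule.subset_span ?_)
    exact ⟨k, Finset.mem_coe.2 (Finset.self_mem_range_succ k), rfl⟩
  refine stronglyMeasurable_of_tendsto atTop (f := fun k a => (U k).starProjection (f a)) (fun k => ?_)
    (tendsto_pi_nhds.2 fun a => Submodule.starProjection_tendsto_self U hmono (f a) hdense)
  have e : (fun a => (U k).starProjection (f a))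
      = fun a => ∑ j, inner ℝ (stdOrthonormalBasis ℝ (U k) j : E) (f a) •
        (stdOrthonormalBasis ℝ (U k) j : E) := by
    ext a
    rw [(stdOrthonormalBasis ℝ (U k)).starProjection_eq_sum_rankOne]
    simp
  rw [e]
  exact Finset.stronglyMeasurable_fun_sum _ fun j _ => (hf _).stronglyMeasurable.smul_const _

/-- (v,t) ↦ A t v is a Carathéodory function, continuous in v and measurable in t, hence jointly
measurable on a separable space. So t ↦ A t (u t) is measurable for every u. -/
theorem exists_pointwise_operator {E F : Type} [NormedAddCommGroup E] [NormedSpace ℝ E]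
    [SecondCountableTopology E] [NormedAddCommGroup F] [NormedSpace ℝ F] (T : ℝ) (A : ℝ → E →L[ℝ] F)
    {K : ℝ} (hA : ∀ t, ‖A t‖ ≤ K) (hm : ∀ v, StronglyMeasurable fun t => A t v) :
    ∃ L : L2T T E →L[ℝ] L2T T F, (∀ u, ‖L u‖ ≤ K * ‖u‖) ∧
      ∀ u, ∀ᵐ t ∂volume.restrict (Ioo 0 T), L u t = A t (u t) := by
  borelize E
  have hunc : StronglyMeasurable (Function.uncurry fun (v : E) (t : ℝ) => A t v) :=
    stronglyMeasurable_uncurry_of_continuous_of_stronglyMeasurable (fun t => (A t).continuous) hm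
  have hbd : ∀ t v, ‖A t v‖ ≤ K * ‖v‖ := fun t v =>
    ((A t).le_opNorm v).trans (by gcongr; exact hA t)
  have hmem : ∀ u : L2T T E, MemLp (fun t => A t (u t)) 2 (volume.restrict (Ioo (0 : ℝ) T)) :=
    fun u => (Lp.memLp u).of_le_mul (c := K)
      (hunc.comp_measurable ((Lp.stronglyMeasurable u).measurable.prodMk measurable_id)).aestronglyMeasurable
      (Eventually.of_forall fun t => hbd t _)
  have hco : ∀ u, ∀ᵐ t ∂volume.restrict (Ioo 0 T), (hmem u).toLp _ t = A t (u t) :=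
    fun u => (hmem u).coeFn_toLp
  let L₀ : L2T T E →ₗ[ℝ] L2T T F :=
    { toFun := fun u => (hmem u).toLp _
      map_add' := fun u v => by
        refine Lp.ext ?_
        filter_upwards [hco (u + v), hco u, hco v, Lp.coeFn_add u v,
          Lp.coeFn_add ((hmem u).toLp _) ((hmem v).toLp _)] with t h1 h2 h3 h4 h5
        rw [h1, h4, h5, Pi.add_apply, Pi.add_apply, h2, h3, map_add]
      map_smul' := fun c u => by
        refine Lp.ext ?_
        filter_upwards [hco (c • u), hco u, Lp.coeFn_smul c u,
          Lp.coeFn_smul c ((hmem u).toLp _)] with t h1 h2 h4 h5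
        rw [h1, h4, RingHom.id_apply, h5, Pi.smul_apply, Pi.smul_apply, h2, map_smul] }
  have hnorm : ∀ u, ‖L₀ u‖ ≤ K * ‖u‖ := fun u => by
    refine Lp.norm_le_mul_norm_of_ae_le_mul ?_
    filter_upwards [hco u] with t ht
    change ‖(hmem u).toLp _ t‖ ≤ _
    rw [ht]
    exact hbd t _
  exact ⟨L₀.mkContinuous K hnorm, hnorm, hco⟩

theorem exists_mul_operator {α : Type} [MeasurableSpace α] (ν : Measure α) {b : α → ℝ}
    (hb : StronglyMeasurable b) {K : ℝ} (hK : 0 ≤ K) (hbK : ∀ x, |b x| ≤ K) :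
    ∃ L : Lp ℝ 2 ν →L[ℝ] Lp ℝ 2 ν, ‖L‖ ≤ K ∧ ∀ g, L g =ᵐ[ν] fun x => b x * g x := by
  have hmem : ∀ g : Lp ℝ 2 ν, MemLp (fun x => b x * g x) 2 ν := fun g =>
    (Lp.memLp g).of_le_mul (c := K) (hb.aestronglyMeasurable.mul (Lp.aestronglyMeasurable g))
      (Eventually.of_forall fun x => by rw [norm_mul]; gcongr; exact hbK x)
  let L₀ : Lp ℝ 2 ν →ₗ[ℝ] Lp ℝ 2 ν :=
    { toFun := fun g => (hmem g).toLp _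
      map_add' := fun g h => by
        refine Lp.ext ?_
        filter_upwards [(hmem (g + h)).coeFn_toLp, (hmem g).coeFn_toLp, (hmem h).coeFn_toLp,
          Lp.coeFn_add g h, Lp.coeFn_add ((hmem g).toLp _) ((hmem h).toLp _)] with t h1 h2 h3 h4 h5
        rw [h1, h4, h5, Pi.add_apply, Pi.add_apply, h2, h3, mul_add]
      map_smul' := fun c g => by
        refine Lp.ext ?_
        filter_upwards [(hmem (c • g)).coeFn_toLp, (hmem g).coeFn_toLp, Lp.coeFn_smul c g,
          Lp.coeFn_smul c ((hmem g).toLp _)] with t h1 h2 h4 h5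
        rw [h1, h4, RingHom.id_apply, h5, Pi.smul_apply, Pi.smul_apply, h2, smul_eq_mul, smul_eq_mul]
        ring }
  refine ⟨L₀.mkContinuous K fun g => ?_, LinearMap.mkContinuous_norm_le _ hK _,
    fun g => (hmem g).coeFn_toLp⟩
  refine Lp.norm_le_mul_norm_of_ae_le_mul ?_
  filter_upwards [(hmem g).coeFn_toLp] with x hx
  change ‖(hmem g).toLp _ x‖ ≤ _
  rw [hx, norm_mul]
  gcongr
  exact hbK x

theorem eLpNorm_two_rpow {α F : Type*} [MeasurableSpace α] [NormedAddCommGroup F] (f : α → F)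
    (μ : Measure α) : eLpNorm f 2 μ ^ (2 : ℝ) = ∫⁻ x, ‖f x‖ₑ ^ (2 : ℝ) ∂μ := by
  rw [eLpNorm_eq_lintegral_rpow_enorm_toReal (by norm_num) (by norm_num), ← ENNReal.rpow_mul,
    ENNReal.toReal_ofNat]
  norm_num

variable {n : ℕ} {Ω : Set (Rn n)}

instance : SecondCountableTopology (L2 Ω) :=
  haveI : Fact ((2 : ℝ≥0∞) ≠ ⊤) := ⟨by norm_num⟩
  inferInstance

theorem restrict_cyl_eq_prod (A : Set (Rn n)) (T : ℝ) :
    (volume.restrict (cyl A T) : Measure (Rn n × ℝ))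
      = (volume.restrict A).prod (volume.restrict (Ioo 0 T)) := by
  rw [Measure.prod_restrict, ← Measure.volume_eq_prod]

theorem ae_ae_of_ae_cyl {A : Set (Rn n)} {T : ℝ} {p : Rn n × ℝ → Prop}
    (h : ∀ᵐ z ∂volume.restrict (cyl A T), p z) :
    ∀ᵐ t ∂volume.restrict (Ioo 0 T), ∀ᵐ x ∂volume.restrict A, p (x, t) := by
  rw [restrict_cyl_eq_prod] at h
  exact Measure.ae_ae_of_ae_prod (Measure.measurePreserving_swap.quasiMeasurePreserving.ae h)

theorem L2_inner_eq (g h : L2 Ω) : inner ℝ g h = ∫ x in Ω, g x * h x := by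
  rw [L2.inner_def]
  simp [mul_comm]

/-- Multiplication by an essentially bounded function of `(x,t)` on `L²(0,T;L²(Ω))`. -/
theorem exists_cyl_mul_operator (T : ℝ) {b : Rn n × ℝ → ℝ} (hb : StronglyMeasurable b) {K : ℝ}
    (hK : 0 ≤ K) (hbK : ∀ᵐ z ∂volume.restrict (cyl Ω T), |b z| ≤ K) :
    ∃ L : L2T T (L2 Ω) →L[ℝ] L2T T (L2 Ω), (∀ u, ‖L u‖ ≤ K * ‖u‖) ∧
      ∀ u, ∀ᵐ t ∂volume.restrict (Ioo 0 T), ∀ᵐ x ∂volume.restrict Ω, L u t x = b (x, t) * u t x := by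
  -- Truncation makes the bound hold everywhere and not just almost everywhere, so that every time
  -- slice defines a bounded operator.
  let b' : Rn n × ℝ → ℝ := fun z => max (-K) (min (b z) K)
  have hb' : StronglyMeasurable b' :=
    stronglyMeasurable_const.sup (hb.inf stronglyMeasurable_const)
  have hbd : ∀ z, |b' z| ≤ K := fun z =>
    abs_le.2 ⟨le_max_left _ _, max_le (by linarith) (min_le_right _ _)⟩
  have hsl : ∀ t, StronglyMeasurable fun x => b' (x, t) := fun t =>
    hb'.comp_measurable measurable_prodMk_right
  choose A hA hA' using fun t => exists_mul_operator (volume.restrict Ω) (hsl t) hK (fun x => hbd (x, t))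
  obtain ⟨L, h1, h2⟩ := exists_pointwise_operator T A hA (fun g => by
    -- By Pettis only scalar products with fixed v have to be measurable, and these are parameter
    -- integrals.
    refine stronglyMeasurable_of_inner fun v => ?_
    have e : (fun t => inner ℝ v (A t g)) = fun t => ∫ x in Ω, v x * (b' (x, t) * g x) := by
      ext t
      rw [L2_inner_eq]
      refine integral_congr_ae ?_
      filter_upwards [hA' t g] with x hx
      rw [hx]
    rw [e]
    refine (StronglyMeasurable.integral_prod_right' (f := fun z : ℝ × Rn n =>
      v z.2 * (b' (z.2, z.1) * g z.2)) ?_).measurable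
    exact ((Lp.stronglyMeasurable v).comp_measurable measurable_snd).mul
      ((hb'.comp_measurable measurable_swap).mul
        ((Lp.stronglyMeasurable g).comp_measurable measurable_snd)))
  refine ⟨L, h1, fun u => ?_⟩
  filter_upwards [h2 u, ae_ae_of_ae_cyl hbK] with t a1 a2
  rw [a1]
  filter_upwards [hA' t (u t), a2] with x e1 e2
  rw [e1]
  congr 1
  change max (-K) (min (b (x, t)) K) = b (x, t)
  rw [min_eq_left (abs_le.1 e2).2, max_eq_right (abs_le.1 e2).1]

/-- A function in `L²(Ω × (0,T))` as an element of `L²(0,T;L²(Ω))`. -/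
theorem exists_slice {T : ℝ} {f : Rn n × ℝ → ℝ} (hf : StronglyMeasurable f)
    (hf2 : MemLp f 2 (volume.restrict (cyl Ω T))) :
    ∃ G : L2T T (L2 Ω), ‖G‖ ≤ (eLpNorm f 2 (volume.restrict (cyl Ω T))).toReal ∧
      ∀ᵐ t ∂volume.restrict (Ioo 0 T), ∀ᵐ x ∂volume.restrict Ω, G t x = f (x, t) := by
  classical
  let N : ℝ → ℝ≥0∞ := fun t => ∫⁻ x in Ω, ‖f (x, t)‖ₑ ^ (2 : ℝ)
  have hsq : Measurable fun z : ℝ × Rn n => ‖f (z.2, z.1)‖ₑ ^ (2 : ℝ) :=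
    ((hf.comp_measurable measurable_swap).enorm.pow_const _)
  have hN : Measurable N := hsq.lintegral_prod_right'
  have hNint : ∫⁻ t in Ioo 0 T, N t = eLpNorm f 2 (volume.restrict (cyl Ω T)) ^ (2 : ℝ) := by
    rw [eLpNorm_two_rpow, restrict_cyl_eq_prod,
      lintegral_prod_symm _ (hf.enorm.pow_const (2 : ℝ)).aemeasurable]
  have hfin : ∫⁻ t in Ioo 0 T, N t ≠ ⊤ := by
    rw [hNint]
    exact ENNReal.rpow_ne_top_of_nonneg zero_le_two hf2.2.ne
  have hsl : ∀ t, StronglyMeasurable fun x => f (x, t) := fun t =>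
    hf.comp_measurable measurable_prodMk_right
  have hnorm : ∀ t, eLpNorm (fun x => f (x, t)) 2 (volume.restrict Ω) ^ (2 : ℝ) = N t := fun t =>
    eLpNorm_two_rpow _ _
  have hmem : ∀ t, N t < ⊤ → MemLp (fun x => f (x, t)) 2 (volume.restrict Ω) := fun t ht => by
    refine ⟨(hsl t).aestronglyMeasurable, ?_⟩
    rw [← hnorm] at ht
    exact (ENNReal.rpow_lt_top_iff_of_pos zero_lt_two).1 ht
  -- Slices that are not square integrable are replaced by 0; by Fubini they occur only for a null
  -- set of times.
  let G₀ : ℝ → L2 Ω := fun t => if h : N t < ⊤ then (hmem t h).toLp _ else 0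
  have hG₀ : ∀ t, N t < ⊤ → G₀ t =ᵐ[volume.restrict Ω] fun x => f (x, t) := fun t ht => by
    simp only [G₀, dif_pos ht]
    exact (hmem t ht).coeFn_toLp
  have hG₀m : StronglyMeasurable G₀ := by
    refine stronglyMeasurable_of_inner fun v => ?_
    have e : (fun t => inner ℝ v (G₀ t)) = {t | N t < ⊤}.indicator fun t => ∫ x in Ω, v x * f (x, t) := by
      ext t
      by_cases ht : N t < ⊤
      · rw [indicator_of_mem (by exact ht), L2_inner_eq]
        refine integral_congr_ae ?_
        filter_upwards [hG₀ t ht] with x hx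
        rw [hx]
      · rw [indicator_of_notMem (by exact ht)]
        simp only [G₀, dif_neg ht, inner_zero_right]
    rw [e]
    refine Measurable.indicator ?_ (measurableSet_lt hN measurable_const)
    refine (StronglyMeasurable.integral_prod_right' (f := fun z : ℝ × Rn n =>
      v z.2 * f (z.2, z.1)) ?_).measurable
    exact ((Lp.stronglyMeasurable v).comp_measurable measurable_snd).mul
      (hf.comp_measurable measurable_swap)
  have hle : ∀ t, ‖G₀ t‖ₑ ^ (2 : ℝ) ≤ N t := fun t => by
    by_cases ht : N t < ⊤
    · rw [← hnorm, Lp.enorm_def, eLpNorm_congr_ae (hG₀ t ht)]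
    · simp only [G₀, dif_neg ht, enorm_zero]
      simp
  have hG₀le : eLpNorm G₀ 2 (volume.restrict (Ioo 0 T)) ≤ eLpNorm f 2 (volume.restrict (cyl Ω T)) := by
    rw [← ENNReal.rpow_le_rpow_iff (z := 2) zero_lt_two, ← hNint, eLpNorm_two_rpow]
    exact lintegral_mono hle
  have hG₀mem : MemLp G₀ 2 (volume.restrict (Ioo 0 T)) :=
    ⟨hG₀m.aestronglyMeasurable, hG₀le.trans_lt hf2.2⟩
  refine ⟨hG₀mem.toLp _, ?_, ?_⟩
  · rw [Lp.norm_toLp]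
    exact ENNReal.toReal_mono hf2.2.ne hG₀le
  · filter_upwards [hG₀mem.coeFn_toLp, ae_lt_top hN hfin] with t h1 h2
    rw [h1]
    exact hG₀ t h2

/-- A function in `L²(O × (0,T))`, extended by zero, as an element of `L²(0,T;L²(Ω))`. -/
theorem exists_extension_slice {T : ℝ} {O : Set (Rn n)} (hO : MeasurableSet O) (hOΩ : O ⊆ Ω)
    (f : Lp ℝ 2 (volume.restrict (cyl O T))) :
    ∃ G : L2T T (L2 Ω), ‖G‖ ≤ ‖f‖ ∧ ∀ᵐ t ∂volume.restrict (Ioo 0 T), ∀ᵐ x ∂volume.restrict Ω,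
      G t x = O.indicator (fun x => f (x, t)) x := by
  have hc : MeasurableSet (O ×ˢ (univ : Set ℝ)) := hO.prod MeasurableSet.univ
  have hinter : (O ×ˢ (univ : Set ℝ)) ∩ cyl Ω T = cyl O T := by
    rw [cyl, prod_inter_prod, univ_inter, inter_eq_left.2 hOΩ]
  have hnorm : eLpNorm ((O ×ˢ (univ : Set ℝ)).indicator f) 2 (volume.restrict (cyl Ω T))
      = eLpNorm f 2 (volume.restrict (cyl O T)) := by
    rw [eLpNorm_indicator_eq_eLpNorm_restrict hc, Measure.restrict_restrict hc, hinter]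
  obtain ⟨G, h1, h2⟩ := exists_slice (Ω := Ω) (T := T) ((Lp.stronglyMeasurable f).indicator hc)
    ⟨((Lp.stronglyMeasurable f).indicator hc).aestronglyMeasurable, by
      rw [hnorm]; exact (Lp.memLp f).2⟩
  refine ⟨G, ?_, ?_⟩
  · rwa [hnorm, ← Lp.norm_def] at h1
  · filter_upwards [h2] with t ht
    filter_upwards [ht] with x hx
    rw [hx]
    by_cases hxO : x ∈ O
    · rw [indicator_of_mem (show (x, t) ∈ O ×ˢ (univ : Set ℝ) from ⟨hxO, mem_univ _⟩),
        indicator_of_mem hxO]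
    · rw [indicator_of_notMem (fun h' : (x, t) ∈ O ×ˢ (univ : Set ℝ) => hxO h'.1),
        indicator_of_notMem hxO]

end WeakMeasurability

/-! ### The H² norm on test functions and density of H₀²(Ω) in L²(Ω). -/

section TestFunctions

variable {n : ℕ} {Ω : Set (Rn n)}

theorem IsTest.memLp {η : Rn n → ℝ} (h : IsTest Ω η) : MemLp η 2 (volume.restrict Ω) :=
  (h.contDiff.continuous.memLp_of_hasCompactSupport h.hasCompactSupport).restrict _

theorem IsTest.integrable_mul {η θ : Rn n → ℝ} (h : IsTest Ω η) (h' : IsTest Ω θ) :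
    Integrable (fun x => η x * θ x) :=
  (h.contDiff.continuous.mul h'.contDiff.continuous).integrable_of_hasCompactSupport
    (HasCompactSupport.mul_right h.hasCompactSupport)

theorem IsTest.integral_pderiv_mul {η θ : Rn n → ℝ} (h : IsTest Ω η) (h' : IsTest Ω θ) (i : Fin n) :
    ∫ x, FourthOrderParabolic.pderiv i η x * θ x
      = - ∫ x, η x * FourthOrderParabolic.pderiv i θ x := by
  have := integral_mul_fderiv_eq_neg_fderiv_mul_of_integrable (𝕜 := ℝ) (μ := (volume : Measure (Rn n)))
    (f := η) (g := θ) (v := EuclideanSpace.single i 1)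
    ((h.pderiv i).integrable_mul h') (h.integrable_mul (h'.pderiv i)) (h.integrable_mul h')
    (fun x _ => h.contDiff.differentiable (by simp) x)
    (fun x _ => h'.contDiff.differentiable (by simp) x)
  simp only [FourthOrderParabolic.pderiv]
  rw [this, neg_neg]

theorem IsTest.pderiv_comm {η : Rn n → ℝ} (h : IsTest Ω η) (i j : Fin n) :
    FourthOrderParabolic.pderiv i (FourthOrderParabolic.pderiv j η)
      = FourthOrderParabolic.pderiv j (FourthOrderParabolic.pderiv i η) := by
  have hd : Differentiable ℝ (fderiv ℝ η) :=
    (h.contDiff.fderiv_right (m := ∞) (by simp)).differentiable (by simp)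
  have key : ∀ k l : Fin n, ∀ x, FourthOrderParabolic.pderiv k (FourthOrderParabolic.pderiv l η) x
      = fderiv ℝ (fderiv ℝ η) x (EuclideanSpace.single k 1) (EuclideanSpace.single l 1) := by
    intro k l x
    have := ((hd x).hasFDerivAt.clm_apply
      (hasFDerivAt_const (EuclideanSpace.single l (1 : ℝ)) x)).fderiv
    change fderiv ℝ (fun y => fderiv ℝ η y (EuclideanSpace.single l 1)) x
      (EuclideanSpace.single k 1) = _
    rw [this]
    simp
  ext x
  rw [key, key]
  exact (h.contDiff.contDiffAt.isSymmSndFDerivAt (by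
    rw [minSmoothness_of_isRCLikeNormedField]
    exact (WithTop.coe_le_coe (b := (2 : ℕ∞)) (a := ⊤)).2 le_top)) _ _

/-- Both sides become the same integral after one integration by parts in the variable j, since
partial derivatives commute. Summed over i and j, this makes the L² norm of the Hessian that of the
Laplacian. -/
theorem IsTest.integral_sq_hessian {η : Rn n → ℝ} (h : IsTest Ω η) (i j : Fin n) :
    ∫ x, FourthOrderParabolic.pderiv j (FourthOrderParabolic.pderiv i η) x
        * FourthOrderParabolic.pderiv j (FourthOrderParabolic.pderiv i η) x
      = ∫ x, FourthOrderParabolic.pderiv i (FourthOrderParabolic.pderiv i η) x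
        * FourthOrderParabolic.pderiv j (FourthOrderParabolic.pderiv j η) x := by
  rw [(h.pderiv i).integral_pderiv_mul ((h.pderiv i).pderiv j),
    (h.pderiv i).integral_pderiv_mul ((h.pderiv j).pderiv j), (h.pderiv i).pderiv_comm j j,
    h.pderiv_comm j i, (h.pderiv j).pderiv_comm j i]

/-- The classical Laplacian. -/
def laplace (η : Rn n → ℝ) (x : Rn n) : ℝ := ∑ i, pderiv i (pderiv i η) x

theorem IsTest.integral_laplace_sq {η : Rn n → ℝ} (h : IsTest Ω η) :
    ∑ i, ∑ j, ∫ x, FourthOrderParabolic.pderiv j (FourthOrderParabolic.pderiv i η) x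
        * FourthOrderParabolic.pderiv j (FourthOrderParabolic.pderiv i η) x
      = ∫ x, laplace η x * laplace η x := by
  simp only [h.integral_sq_hessian, laplace, Finset.sum_mul_sum]
  rw [integral_finsetSum _ fun i _ => integrable_finsetSum _ fun j _ =>
    ((h.pderiv i).pderiv i).integrable_mul ((h.pderiv j).pderiv j)]
  refine Finset.sum_congr rfl fun i _ => ?_
  rw [integral_finsetSum _ fun j _ => ((h.pderiv i).pderiv i).integrable_mul ((h.pderiv j).pderiv j)]

theorem IsTest.integral_gradient_sq {η : Rn n → ℝ} (h : IsTest Ω η) :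
    ∑ i, ∫ x, FourthOrderParabolic.pderiv i η x * FourthOrderParabolic.pderiv i η x
      = - ∫ x, η x * laplace η x := by
  simp only [laplace, Finset.mul_sum]
  rw [integral_finsetSum _ fun i _ => h.integrable_mul ((h.pderiv i).pderiv i), ← Finset.sum_neg_distrib]
  exact Finset.sum_congr rfl fun i _ => h.integral_pderiv_mul (h.pderiv i) i

theorem IsTest.laplace {η : Rn n → ℝ} (h : IsTest Ω η) :
    Integrable (fun x => η x * laplace η x) ∧ Integrable (fun x => laplace η x * laplace η x) := by
  constructor
  · simp only [FourthOrderParabolic.laplace, Finset.mul_sum]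
    exact integrable_finsetSum _ fun i _ => h.integrable_mul ((h.pderiv i).pderiv i)
  · simp only [FourthOrderParabolic.laplace, Finset.sum_mul_sum]
    exact integrable_finsetSum _ fun i _ => integrable_finsetSum _ fun j _ =>
      ((h.pderiv i).pderiv i).integrable_mul ((h.pderiv j).pderiv j)

theorem IsTest.eq_zero {η : Rn n → ℝ} (h : IsTest Ω η) {x : Rn n} (hx : x ∉ Ω) : η x = 0 :=
  image_eq_zero_of_notMem_tsupport fun h' => hx (h.tsupport_subset h')

theorem IsTest.setIntegral_eq {f : Rn n → ℝ} (h : ∀ x ∉ Ω, f x = 0) : ∫ x in Ω, f x = ∫ x, f x :=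
  setIntegral_eq_integral_of_forall_compl_eq_zero h

/-- The second derivatives contribute exactly ‖Δη‖², and the gradient -∫ η Δη ≤ (‖η‖² + ‖Δη‖²)/2.
The total is at most 3/2 of the bracket, hence at most twice it. -/
theorem norm_sq_le_of_test {J : Jet Ω} (hJ : J ∈ testJets Ω) :
    ‖J‖ ^ 2 ≤ 2 * (‖J (Sum.inl ())‖ ^ 2 + ‖∑ i : Fin n, J (Sum.inr (Sum.inr (i, i)))‖ ^ 2) := by
  obtain ⟨η, h, hJ⟩ := hJ
  have e : ∀ k, ‖J k‖ ^ 2 = ∫ x, jetFun η k x * jetFun η k x := fun k => by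
    rw [← real_inner_self_eq_norm_sq, L2_inner_eq, ← IsTest.setIntegral_eq (Ω := Ω)]
    · refine integral_congr_ae ?_
      filter_upwards [hJ k] with x hx
      rw [hx]
    · intro x hx
      rw [(h.jetFun k).eq_zero hx, zero_mul]
  have el : ‖∑ i : Fin n, J (Sum.inr (Sum.inr (i, i)))‖ ^ 2 = ∫ x, laplace η x * laplace η x := by
    rw [← real_inner_self_eq_norm_sq, L2_inner_eq, ← IsTest.setIntegral_eq (Ω := Ω)]
    · refine integral_congr_ae ?_
      filter_upwards [ae_all_iff.2 hJ, Lp.coeFn_finsetSum Finset.univ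
        fun i : Fin n => J (Sum.inr (Sum.inr (i, i)))] with x hx hs
      rw [hs, Finset.sum_apply]
      simp only [hx]
      rfl
    · intro x hx
      have : laplace η x = 0 := Finset.sum_eq_zero fun i _ => ((h.pderiv i).pderiv i).eq_zero hx
      rw [this, zero_mul]
  rw [PiLp.norm_sq_eq_of_L2, el]
  simp only [Fintype.sum_sum_type, Fintype.sum_prod_type, Finset.univ_unique, Finset.sum_singleton, e]
  have e1 := h.integral_gradient_sq
  have e2 := h.integral_laplace_sq
  have e3 : - ∫ x, η x * laplace η x ≤ 1 / 2 * ((∫ x, η x * η x) + ∫ x, laplace η x * laplace η x) := by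
    rw [← integral_add (h.integrable_mul h) h.laplace.2, ← integral_neg, ← integral_const_mul]
    refine integral_mono h.laplace.1.neg (((h.integrable_mul h).add h.laplace.2).const_mul _) fun x => ?_
    simp only
    nlinarith [sq_nonneg (η x + laplace η x)]
  have p1 : 0 ≤ ∫ x, η x * η x := integral_nonneg fun x => mul_self_nonneg _
  have p2 : 0 ≤ ∫ x, laplace η x * laplace η x := integral_nonneg fun x => mul_self_nonneg _
  simp only [jetFun]
  change (∫ x, η x * η x) + ((∑ i, ∫ x, pderiv i η x * pderiv i η x)
    + ∑ i, ∑ j, ∫ x, pderiv j (pderiv i η) x * pderiv j (pderiv i η) x)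
    ≤ 2 * ((∫ x, η x * η x) + ∫ x, laplace η x * laplace η x)
  rw [e1, e2]
  linarith

namespace H02

/-- The `H²` norm is controlled by the `L²` norms of the function and of its Laplacian. -/
theorem norm_sq_le (v : H02 Ω) : ‖v‖ ^ 2 ≤ 2 * (‖val v‖ ^ 2 + ‖lap v‖ ^ 2) := by
  have hcl : IsClosed {J : Jet Ω | ‖J‖ ^ 2
      ≤ 2 * (‖J (Sum.inl ())‖ ^ 2 + ‖∑ i : Fin n, J (Sum.inr (Sum.inr (i, i)))‖ ^ 2)} := by
    refine isClosed_le (by fun_prop) ?_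
    have h1 : Continuous fun J : Jet Ω => J (Sum.inl ()) := PiLp.continuous_apply 2 _ _
    have h2 : Continuous fun J : Jet Ω => ∑ i : Fin n, J (Sum.inr (Sum.inr (i, i))) :=
      continuous_finsetSum _ fun i _ => PiLp.continuous_apply 2 _ _
    fun_prop
  have key := closure_minimal (fun J hJ => norm_sq_le_of_test hJ) hcl v.2
  have e : lap v = ∑ i : Fin n, (v.1 : Jet Ω) (Sum.inr (Sum.inr (i, i))) := by
    simp only [lap, sum_apply]
    rfl
  rw [e]
  exact key

theorem norm_jet_le (k : JetIdx n) (v : H02 Ω) : ‖jet k v‖ ≤ ‖v‖ := PiLp.norm_apply_le (v.1 : Jet Ω) k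

/-- A test function as an element of `H₀²(Ω)`. -/
def ofTest {η : Rn n → ℝ} (h : IsTest Ω η) : H02 Ω :=
  ⟨WithLp.toLp 2 fun k => (h.jetFun k).memLp.toLp _,
    subset_closure ⟨η, h, fun k => (h.jetFun k).memLp.coeFn_toLp⟩⟩

theorem val_ofTest {η : Rn n → ℝ} (h : IsTest Ω η) : val (ofTest h) =ᵐ[volume.restrict Ω] η :=
  h.memLp.coeFn_toLp

/-- A function orthogonal to the image is orthogonal to all test functions and vanishes by the
fundamental lemma of the calculus of variations. -/
theorem denseRange_val (hΩ : IsOpen Ω) : DenseRange (val : H02 Ω → L2 Ω) := by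
  have h1 : (val (Ω := Ω)).rangeᗮ = ⊥ := by
    rw [Submodule.eq_bot_iff]
    intro g hg
    have h := hΩ.ae_eq_zero_of_integral_contDiff_smul_eq_zero (μ := volume) (f := g)
      (fun x _ => by
        obtain ⟨s, hs, hi⟩ := ((Lp.memLp g).locallyIntegrable (by norm_num)) x
        refine ⟨s ∩ Ω, inter_mem (mem_nhdsWithin_of_mem_nhds hs) self_mem_nhdsWithin, ?_⟩
        rwa [IntegrableOn, Measure.restrict_restrict' hΩ.measurableSet] at hi)
      (fun η a1 a2 a3 => by
        have hη : IsTest Ω η := ⟨a1, a2, a3⟩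
        have h0 : inner ℝ (val (ofTest hη)) g = 0 :=
          (Submodule.mem_orthogonal _ _).1 hg _ ⟨ofTest hη, rfl⟩
        rw [L2_inner_eq] at h0
        rw [← IsTest.setIntegral_eq (Ω := Ω) (fun x hx => by rw [hη.eq_zero hx, zero_smul]), ← h0]
        refine integral_congr_ae ?_
        filter_upwards [val_ofTest hη] with x hx
        rw [hx, smul_eq_mul])
    exact (Lp.eq_zero_iff_ae_eq_zero).2 ((ae_restrict_iff' hΩ.measurableSet).2 h)
  have h2 := Submodule.topologicalClosure_eq_top_iff.2 h1
  rw [← Submodule.dense_iff_topologicalClosure_eq_top] at h2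
  exact h2

end H02

end TestFunctions

/-! ### The coupled forward–backward system: fixed point, uniqueness and bound. -/

theorem le_of_coupled_inequality {K a f S x N : ℝ} (hK : 0 < K) (ha : 0 ≤ a) (hf : 0 ≤ f)
    (hS : 0 ≤ S) (hN : 0 ≤ N) (h : x ≤ K * (a + f) + 1 / 2 * (x + S)) :
    x ≤ (2 * K + 1) * (a + f + S) ∧
      f + 1 / (2 * K) * (x + S) + N * x ≤ (1 + 2 / K + N) * (2 * K + 1) * (a + f + S) := by
  set R := (2 * K + 1) * (a + f + S) with hR
  have h0 : 0 ≤ K * (a + f + S) := by positivity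
  -- Absorbing x/2 on the left gives x ≤ 2K(a + f) + S.
  have hx : x ≤ R := by rw [hR]; nlinarith [mul_nonneg hK.le hS]
  have hfR : f ≤ R := by rw [hR]; linarith
  have hSR : S ≤ R := by rw [hR]; linarith
  have h1 : 0 ≤ 1 / K * R := by positivity
  have h2 : 1 / (2 * K) * (x + S) ≤ 1 / K * R := by
    calc 1 / (2 * K) * (x + S) ≤ 1 / (2 * K) * (R + R) := by gcongr
      _ = 1 / K * R := by field_simp; ring
  refine ⟨hx, ?_⟩
  have h3 : N * x ≤ N * R := by gcongr
  have h4 : (1 + 2 / K + N) * (2 * K + 1) * (a + f + S) = R + 2 * (1 / K * R) + N * R := by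
    rw [hR]; ring
  rw [h4]
  linarith

section CoupledSystem

set_option linter.unusedSectionVars false

variable {V H : Type} [NormedAddCommGroup V] [InnerProductSpace ℝ V] [CompleteSpace V]
  [NormedAddCommGroup H] [InnerProductSpace ℝ H] [CompleteSpace H]

/-- `u`, with time derivative `y`, solves `σ y + A u = F`, `u(s) = g`. -/
structure IsCauchySolution {T : ℝ} (i : V →L[ℝ] H) (A : L2T T V →L[ℝ] L2T T V) (σ s : ℝ)
    (F : L2T T V) (g : H) (u y : L2T T V) : Prop where
  hasWeakDeriv : HasWeakDeriv i u y
  trace : ∃ U, IsRep i u U ∧ U s = g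
  equation : σ • y + A u = F

theorem IsCauchySolution.sub {T : ℝ} {i : V →L[ℝ] H} {A : L2T T V →L[ℝ] L2T T V} {σ s : ℝ}
    {F F' : L2T T V} {g g' : H} {u y u' y' : L2T T V} (h : IsCauchySolution i A σ s F g u y)
    (h' : IsCauchySolution i A σ s F' g' u' y') :
    IsCauchySolution i A σ s (F - F') (g - g') (u - u') (y - y') where
  hasWeakDeriv := h.hasWeakDeriv.sub h'.hasWeakDeriv
  trace := by
    obtain ⟨U, h1, h2⟩ := h.trace
    obtain ⟨U', h1', h2'⟩ := h'.trace
    exact ⟨U - U', h1.sub h1', by rw [Pi.sub_apply, h2, h2']⟩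
  equation := by
    rw [← h.equation, ← h'.equation, map_sub, smul_sub]
    abel

variable {T : ℝ} {i : V →L[ℝ] H} {A A' : L2T T V →L[ℝ] L2T T V} {c l : ℝ}

theorem IsCauchySolution.norm_le (hT : 0 < T) (hi : Function.Injective i) (hA : IsGarding i A c l)
    (hc : 0 < c) (hl : 0 ≤ l) {σ s e : ℝ} (hσ : IsTimeDirection T σ s e) {F : L2T T V} {g : H}
    {u y : L2T T V} (h : IsCauchySolution i A σ s F g u y) :
    ‖u‖ ≤ energyConst T c l * (‖g‖ + ‖F‖) := by
  obtain ⟨U, h1, h2⟩ := h.trace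
  have := (hA.energy hT hi hc hl hσ h.hasWeakDeriv h1).1
  rwa [h2, h.equation] at this

theorem IsCauchySolution.norm_deriv_le {σ s e : ℝ} (hσ : IsTimeDirection T σ s e) {F : L2T T V}
    {g : H} {u y : L2T T V} (h : IsCauchySolution i A σ s F g u y) : ‖y‖ ≤ ‖F‖ + ‖A u‖ := by
  have e : σ • y = F - A u := by rw [← h.equation, add_sub_cancel_right]
  have : ‖y‖ = ‖σ • y‖ := by rw [norm_smul, Real.norm_eq_abs, hσ.abs_eq, one_mul]
  rw [this, e]
  exact norm_sub_le _ _

theorem IsGarding.exists_isCauchySolution (hT : 0 < T) (hi : Function.Injective i) (hd : DenseRange i)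
    (hA : IsGarding i A c l) (hAA : ∀ u z, inner ℝ (A u) z = inner ℝ u (A' z)) (hc : 0 < c)
    (hl : 0 ≤ l) {σ s e : ℝ} (hσ : IsTimeDirection T σ s e) (F : L2T T V) (g : H) :
    ∃ u y, IsCauchySolution i A σ s F g u y := by
  obtain ⟨u, y, U, h1, h2, h3, h4⟩ := hA.exists_solution hT hi hd hAA hc hl hσ F g
  exact ⟨u, y, h1, ⟨U, h2, h3⟩, h4⟩

variable {ι : Type*} [Fintype ι] {P D : ι → L2T T V →L[ℝ] L2T T V} {m α : ι → ℝ}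

theorem forward_dir (T : ℝ) : IsTimeDirection T 1 0 T := Or.inl ⟨rfl, rfl, rfl⟩

theorem backward_dir (T : ℝ) : IsTimeDirection T (-1) T 0 := Or.inr ⟨rfl, rfl, rfl⟩

theorem norm_sum_coupling_le (hP : ∀ k u, ‖P k u‖ ≤ ‖u‖) (hm : ∀ k, 0 ≤ m k) (φ : ι → L2T T V) :
    ‖∑ k, m k • P k (φ k)‖ ≤ ∑ k, m k * ‖φ k‖ := by
  refine norm_sum_le_of_le _ fun k _ => ?_
  rw [norm_smul, Real.norm_of_nonneg (hm k)]
  exact mul_le_mul_of_nonneg_left (hP k _) (hm k)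

/-- For weak coupling, the map that sends `u` to the state driven by the adjoint states of `u` is a
contraction. -/
theorem norm_sub_le_of_coupled (hT : 0 < T) (hi : Function.Injective i) (hA : IsGarding i A c l)
    (hA' : IsGarding i A' c l) (hc : 0 < c) (hl : 0 ≤ l) (hP : ∀ k u, ‖P k u‖ ≤ ‖u‖)
    (hD : ∀ k u, ‖D k u‖ ≤ ‖u‖) (hm : ∀ k, 0 ≤ m k) (hα : ∀ k, 0 ≤ α k)
    (hsmall : ∑ k, m k * α k ≤ 1 / (2 * energyConst T c l ^ 2)) {F : L2T T V} {g : H}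
    {E : ι → L2T T V} {u u' w y w' y' : L2T T V} {φ ψ φ' ψ' : ι → L2T T V}
    (hw : IsCauchySolution i A 1 0 (F - ∑ k, m k • P k (φ k)) g w y)
    (hφ : ∀ k, IsCauchySolution i A' (-1) T (α k • (D k u - E k)) 0 (φ k) (ψ k))
    (hw' : IsCauchySolution i A 1 0 (F - ∑ k, m k • P k (φ' k)) g w' y')
    (hφ' : ∀ k, IsCauchySolution i A' (-1) T (α k • (D k u' - E k)) 0 (φ' k) (ψ' k)) :
    ‖w - w'‖ ≤ 1 / 2 * ‖u - u'‖ := by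
  set K := energyConst T c l with hK
  have hK0 : 0 < K := energyConst_pos hc
  have e1 : ∀ k, ‖φ k - φ' k‖ ≤ K * (α k * ‖u - u'‖) := fun k => by
    have := ((hφ k).sub (hφ' k)).norm_le hT hi hA' hc hl (backward_dir T)
    rw [sub_zero, norm_zero, zero_add, ← smul_sub, sub_sub_sub_cancel_right, ← map_sub, norm_smul,
      Real.norm_of_nonneg (hα k)] at this
    refine this.trans ?_
    have := hD k (u - u')
    have := hα k
    gcongr
  have e2 := (hw.sub hw').norm_le hT hi hA hc hl (forward_dir T)
  have e3 : F - ∑ k, m k • P k (φ k) - (F - ∑ k, m k • P k (φ' k))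
      = -∑ k, m k • P k (φ k - φ' k) := by
    simp only [map_sub, smul_sub, Finset.sum_sub_distrib]
    abel
  rw [sub_self, norm_zero, zero_add, e3, norm_neg] at e2
  have e4 := norm_sum_coupling_le hP hm (fun k => φ k - φ' k)
  -- One factor K comes from the adjoint problems and one from the state problem; the smallness
  -- condition turns K² into 1/2.
  calc ‖w - w'‖ ≤ K * ∑ k, m k * (K * (α k * ‖u - u'‖)) := e2.trans (by
        refine mul_le_mul_of_nonneg_left (e4.trans ?_) hK0.le
        exact Finset.sum_le_sum fun k _ => mul_le_mul_of_nonneg_left (e1 k) (hm k))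
    _ = K ^ 2 * (∑ k, m k * α k) * ‖u - u'‖ := by
        rw [Finset.mul_sum, Finset.mul_sum, Finset.sum_mul]
        exact Finset.sum_congr rfl fun k _ => by ring
    _ ≤ K ^ 2 * (1 / (2 * K ^ 2)) * ‖u - u'‖ := by gcongr
    _ = 1 / 2 * ‖u - u'‖ := by field_simp

/-- Existence for the coupled system. -/
theorem exists_coupled (hT : 0 < T) (hi : Function.Injective i) (hd : DenseRange i)
    (hA : IsGarding i A c l) (hAA : ∀ u z, inner ℝ (A u) z = inner ℝ u (A' z)) (hc : 0 < c)
    (hl : 0 ≤ l) (hP : ∀ k u, ‖P k u‖ ≤ ‖u‖) (hD : ∀ k u, ‖D k u‖ ≤ ‖u‖) (hm : ∀ k, 0 ≤ m k)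
    (hα : ∀ k, 0 ≤ α k) (hsmall : ∑ k, m k * α k ≤ 1 / (2 * energyConst T c l ^ 2)) (F : L2T T V)
    (g : H) (E : ι → L2T T V) :
    ∃ (u y : L2T T V) (φ ψ : ι → L2T T V),
      IsCauchySolution i A 1 0 (F - ∑ k, m k • P k (φ k)) g u y ∧
      ∀ k, IsCauchySolution i A' (-1) T (α k • (D k u - E k)) 0 (φ k) (ψ k) := by
  have hA' := hA.transpose hAA
  have hAA' : ∀ u z, inner ℝ (A' u) z = inner ℝ u (A z) := fun u z => by
    rw [real_inner_comm, ← hAA, real_inner_comm]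
  -- For each u, first the adjoint states driven by u, then the state N u driven by those. A fixed
  -- point of N solves the coupled system.
  choose φ ψ hφ using fun (u : L2T T V) (k : ι) =>
    hA'.exists_isCauchySolution hT hi hd hAA' hc hl (backward_dir T) (α k • (D k u - E k)) 0
  choose N y hN using fun u : L2T T V =>
    hA.exists_isCauchySolution hT hi hd hAA hc hl (forward_dir T) (F - ∑ k, m k • P k (φ u k)) g
  have hcon : ContractingWith (1 / 2) N := by
    refine ⟨by norm_num, LipschitzWith.of_dist_le_mul fun u u' => ?_⟩
    rw [dist_eq_norm, dist_eq_norm]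
    exact norm_sub_le_of_coupled hT hi hA hA' hc hl hP hD hm hα hsmall (hN u) (hφ u) (hN u') (hφ u')
  set u := ContractingWith.fixedPoint N hcon with hu
  have hfix : N u = u := hcon.fixedPoint_isFixedPt
  have h := hN u
  rw [hfix] at h
  exact ⟨u, y u, φ u, ψ u, h, hφ u⟩

/-- Uniqueness for the coupled system. -/
theorem coupled_unique (hT : 0 < T) (hi : Function.Injective i)
    (hA : IsGarding i A c l) (hAA : ∀ u z, inner ℝ (A u) z = inner ℝ u (A' z)) (hc : 0 < c)
    (hl : 0 ≤ l) (hP : ∀ k u, ‖P k u‖ ≤ ‖u‖) (hD : ∀ k u, ‖D k u‖ ≤ ‖u‖) (hm : ∀ k, 0 ≤ m k)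
    (hα : ∀ k, 0 ≤ α k) (hsmall : ∑ k, m k * α k ≤ 1 / (2 * energyConst T c l ^ 2)) {F : L2T T V}
    {g : H} {E : ι → L2T T V} {u y u' y' : L2T T V} {φ ψ φ' ψ' : ι → L2T T V}
    (hu : IsCauchySolution i A 1 0 (F - ∑ k, m k • P k (φ k)) g u y)
    (hφ : ∀ k, IsCauchySolution i A' (-1) T (α k • (D k u - E k)) 0 (φ k) (ψ k))
    (hu' : IsCauchySolution i A 1 0 (F - ∑ k, m k • P k (φ' k)) g u' y')
    (hφ' : ∀ k, IsCauchySolution i A' (-1) T (α k • (D k u' - E k)) 0 (φ' k) (ψ' k)) :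
    u = u' ∧ φ = φ' := by
  have hA' := hA.transpose hAA
  -- Every solution is its own image, so the contraction estimate bounds ‖u - u'‖ by half of itself.
  have h := norm_sub_le_of_coupled hT hi hA hA' hc hl hP hD hm hα hsmall hu hφ hu' hφ'
  have h0 : ‖u - u'‖ = 0 := le_antisymm (by linarith [norm_nonneg (u - u')]) (norm_nonneg _)
  have huu : u = u' := sub_eq_zero.1 (norm_eq_zero.1 h0)
  refine ⟨huu, funext fun k => ?_⟩
  subst huu
  have := ((hφ k).sub (hφ' k)).norm_le hT hi hA' hc hl (backward_dir T)
  rw [sub_self, sub_self, norm_zero, norm_zero, add_zero, mul_zero] at this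
  exact sub_eq_zero.1 (norm_le_zero_iff.1 this)

/-- The a priori bound for the coupled system. -/
theorem coupled_norm_le (hT : 0 < T) (hi : Function.Injective i)
    (hA : IsGarding i A c l) (hAA : ∀ u z, inner ℝ (A u) z = inner ℝ u (A' z)) (hc : 0 < c)
    (hl : 0 ≤ l) (hP : ∀ k u, ‖P k u‖ ≤ ‖u‖) (hD : ∀ k u, ‖D k u‖ ≤ ‖u‖) (hm : ∀ k, 0 ≤ m k)
    (hα : ∀ k, 0 ≤ α k) (hsmall : ∑ k, m k * α k ≤ 1 / (2 * energyConst T c l ^ 2)) {F : L2T T V}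
    {g : H} {E : ι → L2T T V} {u y : L2T T V} {φ ψ : ι → L2T T V}
    (hu : IsCauchySolution i A 1 0 (F - ∑ k, m k • P k (φ k)) g u y)
    (hφ : ∀ k, IsCauchySolution i A' (-1) T (α k • (D k u - E k)) 0 (φ k) (ψ k)) {KA : ℝ}
    (hKA : ∀ u, ‖A u‖ ≤ KA * ‖u‖) (hKA0 : 0 ≤ KA) :
    ‖u‖ ≤ (2 * energyConst T c l + 1) * (‖g‖ + ‖F‖ + ∑ k, ‖E k‖) ∧
      ‖y‖ ≤ (1 + 2 / energyConst T c l + KA) * (2 * energyConst T c l + 1)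
        * (‖g‖ + ‖F‖ + ∑ k, ‖E k‖) := by
  have hA' := hA.transpose hAA
  set K := energyConst T c l with hK
  have hK0 : 0 < K := energyConst_pos hc
  set S := ∑ k, ‖E k‖ with hS
  have hS0 : 0 ≤ S := Finset.sum_nonneg fun k _ => norm_nonneg _
  have hEk : ∀ k, ‖E k‖ ≤ S := fun k =>
    Finset.single_le_sum (f := fun k => ‖E k‖) (fun k _ => norm_nonneg _) (Finset.mem_univ k)
  have e1 : ∀ k, ‖φ k‖ ≤ K * (α k * (‖u‖ + S)) := fun k => by
    have := (hφ k).norm_le hT hi hA' hc hl (backward_dir T)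
    rw [norm_zero, zero_add, norm_smul, Real.norm_of_nonneg (hα k)] at this
    refine this.trans ?_
    have h1 := (norm_sub_le (D k u) (E k)).trans (add_le_add (hD k u) (hEk k))
    have := hα k
    gcongr
  have e2 : ‖∑ k, m k • P k (φ k)‖ ≤ 1 / (2 * K) * (‖u‖ + S) := by
    calc _ ≤ ∑ k, m k * (K * (α k * (‖u‖ + S))) := (norm_sum_coupling_le hP hm φ).trans
          (Finset.sum_le_sum fun k _ => mul_le_mul_of_nonneg_left (e1 k) (hm k))
      _ = K * (∑ k, m k * α k) * (‖u‖ + S) := by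
          rw [Finset.mul_sum, Finset.sum_mul]
          exact Finset.sum_congr rfl fun k _ => by ring
      _ ≤ K * (1 / (2 * K ^ 2)) * (‖u‖ + S) := by gcongr
      _ = 1 / (2 * K) * (‖u‖ + S) := by field_simp
  have e3 : ‖F - ∑ k, m k • P k (φ k)‖ ≤ ‖F‖ + 1 / (2 * K) * (‖u‖ + S) :=
    (norm_sub_le _ _).trans (by gcongr)
  have e4 := hu.norm_le hT hi hA hc hl (forward_dir T)
  -- The energy estimate multiplies the coupling term (‖u‖ + S)/(2K) by K, which leaves a
  -- coefficient 1/2 that can be absorbed.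
  have e5 : ‖u‖ ≤ K * (‖g‖ + ‖F‖) + 1 / 2 * (‖u‖ + S) := by
    refine e4.trans ?_
    calc K * (‖g‖ + ‖F - ∑ k, m k • P k (φ k)‖)
        ≤ K * (‖g‖ + (‖F‖ + 1 / (2 * K) * (‖u‖ + S))) := by gcongr
      _ = _ := by field_simp; ring
  have hg := norm_nonneg g
  have hF := norm_nonneg F
  have e6 := le_of_coupled_inequality hK0 hg hF hS0 hKA0 e5
  exact ⟨e6.1, (hu.norm_deriv_le (forward_dir T)).trans ((add_le_add e3 (hKA u)).trans e6.2)⟩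

end CoupledSystem

/-! ### Riesz representatives and the space X. -/

section Riesz

variable {V : Type} [NormedAddCommGroup V] [InnerProductSpace ℝ V] [CompleteSpace V]

/-- The Riesz isomorphism `V → V*` of a real Hilbert space. -/
def riesz : V ≃ₗᵢ[ℝ] StrongDual ℝ V := InnerProductSpace.toDual ℝ V

theorem riesz_apply (v w : V) : riesz v w = inner ℝ v w := rfl

theorem inner_riesz_symm (g : StrongDual ℝ V) (v : V) : inner ℝ (riesz.symm g) v = g v := by
  rw [← riesz_apply, riesz.apply_symm_apply]

/-- The Riesz isomorphism as a continuous linear map. -/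
def rieszL : V →L[ℝ] StrongDual ℝ V := (riesz (V := V)).toContinuousLinearEquiv

/-- The inverse of the Riesz isomorphism as a continuous linear map. -/
def rieszSymmL : StrongDual ℝ V →L[ℝ] V := (riesz (V := V)).symm.toContinuousLinearEquiv

theorem norm_lift_rieszL_le {T : ℝ} (u : L2T T V) : ‖lift T rieszL u‖ ≤ ‖u‖ := by
  refine Lp.norm_le_norm_of_ae_le ?_
  filter_upwards [coeFn_lift rieszL u] with t ht
  rw [ht]
  exact (riesz.norm_map (u t)).le

theorem lift_rieszL_rieszSymmL {T : ℝ} (g : L2T T (StrongDual ℝ V)) :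
    lift T rieszL (lift T rieszSymmL g) = g := by
  refine Lp.ext ?_
  filter_upwards [coeFn_lift rieszL (lift T rieszSymmL g), coeFn_lift rieszSymmL g] with t h1 h2
  rw [h1, h2]
  exact riesz.apply_symm_apply _

end Riesz

section StateSpace

variable {n : ℕ} {Ω : Set (Rn n)} {T : ℝ}

/-- The embedding of H₀² into H⁻² is the Riesz isomorphism composed with `gram H02.val`. The
isomorphism commutes with integrals and is injective, so derivatives in H⁻² and their
representatives in H₀² carry the same information. -/
theorem isTimeDeriv_lift_iff {u y : L2T T (H02 Ω)} :
    IsTimeDeriv u (lift T rieszL y) ↔ HasWeakDeriv H02.val u y := by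
  refine forall_congr' fun ψ => forall_congr' fun h1 => forall_congr' fun h2 => forall_congr' fun _ => ?_
  have hd : Continuous (deriv ψ) := h1.continuous_deriv (by simp)
  have e1 : ∫ t in Ioo 0 T, deriv ψ t • H02.toDual (u t)
      = rieszL (∫ t in Ioo 0 T, deriv ψ t • gram H02.val (u t)) := by
    rw [← ContinuousLinearMap.integral_comp_comm _ (integrableOn_smul_gram H02.val hd h2.deriv u)]
    refine integral_congr_ae (Eventually.of_forall fun t => ?_)
    simp only [map_smul]
    congr 1
    ext v
    exact (gram_inner H02.val (u t) v).symm
  have e2 : ∫ t in Ioo 0 T, ψ t • lift T rieszL y t = rieszL (∫ t in Ioo 0 T, ψ t • y t) := by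
    rw [← ContinuousLinearMap.integral_comp_comm _
      (test_smul_integrable (L2T_integrableOn y) h1.continuous h2)]
    refine integral_congr_ae ?_
    filter_upwards [coeFn_lift rieszL y] with t ht
    rw [ht, map_smul]
  rw [e1, e2, ← map_neg]
  exact (riesz (V := H02 Ω)).injective.eq_iff

namespace X

/-- The Riesz representative of the time derivative. -/
def der (w : X Ω T) : L2T T (H02 Ω) := lift T rieszSymmL w.deriv

theorem lift_der (w : X Ω T) : lift T rieszL w.der = w.deriv := lift_rieszL_rieszSymmL _

theorem hasWeakDeriv (w : X Ω T) : HasWeakDeriv H02.val w.toL2 w.der := by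
  rw [← isTimeDeriv_lift_iff, lift_der]
  exact w.isTimeDeriv

theorem inner_der (w : X Ω T) : ∀ᵐ t ∂volume.restrict (Ioo 0 T), ∀ v,
    inner ℝ (w.der t) v = w.deriv t v := by
  filter_upwards [coeFn_lift rieszSymmL w.deriv] with t ht v
  rw [der, ht]
  exact inner_riesz_symm _ _

/-- The element of `X` with given Riesz representative of the time derivative. -/
def ofWeakDeriv {u y : L2T T (H02 Ω)} (h : HasWeakDeriv H02.val u y) : X Ω T :=
  ⟨WithLp.toLp 2 (u, lift T rieszL y), isTimeDeriv_lift_iff.2 h⟩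

theorem der_ofWeakDeriv {u y : L2T T (H02 Ω)} (h : HasWeakDeriv H02.val u y) :
    (ofWeakDeriv h).der = y := (ofWeakDeriv h).hasWeakDeriv.unique h

/-- The second component of the pair is determined by the first, by uniqueness of the weak time
derivative. -/
theorem ext_toL2 {w w' : X Ω T} (h : w.toL2 = w'.toL2) : w = w' := by
  have hd : w.deriv = w'.deriv := IsTimeDeriv.unique w.isTimeDeriv (h ▸ w'.isTimeDeriv)
  refine Subtype.ext ?_
  have e : ∀ p : WithLp 2 (L2T T (H02 Ω) × L2T T (Hm2 Ω)), p = WithLp.toLp 2 (p.fst, p.snd) :=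
    fun p => rfl
  rw [e w.1, e w'.1]
  exact congrArg (WithLp.toLp 2) (Prod.ext h hd)

theorem norm_le_add (w : X Ω T) : ‖w‖ ≤ ‖w.toL2‖ + ‖w.der‖ := by
  have h : ‖w.deriv‖ ≤ ‖w.der‖ := by
    conv_lhs => rw [← lift_der]
    exact norm_lift_rieszL_le _
  rw [norm_eq]
  refine Real.sqrt_le_iff.2 ⟨by positivity, ?_⟩
  nlinarith [norm_nonneg w.toL2, norm_nonneg w.deriv, mul_nonneg (norm_nonneg w.toL2) (norm_nonneg w.der)]

end X

end StateSpace

/-! ### Operators local in time and multiplication by functions of (x,t). -/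

section LocalOperators

variable {E F G : Type} [NormedAddCommGroup E] [NormedSpace ℝ E] [NormedAddCommGroup F]
  [NormedSpace ℝ F] [NormedAddCommGroup G] [NormedSpace ℝ G] {T : ℝ}

/-- Operators which commute with multiplication by functions of time. -/
def IsLocal (A : L2T T E →L[ℝ] L2T T F) : Prop :=
  ∀ (e : ℝ → ℝ) (he : Continuous e) (u : L2T T E), A (timeMul e he u) = timeMul e he (A u)

theorem IsLocal.comp {B : L2T T F →L[ℝ] L2T T G} {A : L2T T E →L[ℝ] L2T T F} (hB : IsLocal B)
    (hA : IsLocal A) : IsLocal (B.comp A) := fun e he u => by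
  rw [ContinuousLinearMap.comp_apply, hA, hB]; rfl

theorem timeMul_add {e : ℝ → ℝ} (he : Continuous e) (u v : L2T T E) :
    timeMul e he (u + v) = timeMul e he u + timeMul e he v := by
  refine Lp.ext ?_
  filter_upwards [coeFn_timeMul he (u + v), coeFn_timeMul he u, coeFn_timeMul he v,
    Lp.coeFn_add u v, Lp.coeFn_add (timeMul e he u) (timeMul e he v)] with t h1 h2 h3 h4 h5
  rw [h1, h4, h5, Pi.add_apply, Pi.add_apply, h2, h3, smul_add]

theorem IsLocal.add {A B : L2T T E →L[ℝ] L2T T F} (hA : IsLocal A) (hB : IsLocal B) :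
    IsLocal (A + B) := fun e he u => by
  rw [add_apply, add_apply, hA, hB, timeMul_add]

theorem isLocal_zero : IsLocal (0 : L2T T E →L[ℝ] L2T T F) := fun e he u => by
  refine Lp.ext ?_
  have h0 : ∀ᵐ t ∂volume.restrict (Ioo 0 T), (0 : L2T T F) t = 0 := Lp.coeFn_zero F 2 _
  filter_upwards [coeFn_timeMul he (0 : L2T T F), h0] with t h1 h2
  rw [zero_apply, zero_apply, h1, h2, smul_zero]

theorem IsLocal.sum {κ : Type*} (s : Finset κ) {A : κ → L2T T E →L[ℝ] L2T T F}
    (hA : ∀ k, IsLocal (A k)) : IsLocal (∑ k ∈ s, A k) :=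
  Finset.sum_induction _ IsLocal (fun _ _ => IsLocal.add) isLocal_zero fun k _ => hA k

theorem isLocal_lift (L : E →L[ℝ] F) : IsLocal (lift T L) := fun e he u => by
  refine Lp.ext ?_
  filter_upwards [coeFn_lift L (timeMul e he u), coeFn_timeMul he u, coeFn_timeMul he (lift T L u),
    coeFn_lift L u] with t h1 h2 h3 h4
  rw [h1, h2, h3, h4, map_smul]

end LocalOperators

section Multiplication

variable {n : ℕ} {Ω : Set (Rn n)} {T : ℝ}

/-- `L` is multiplication by the function `b` of `(x,t)`. -/
def IsMulOperator (b : Rn n × ℝ → ℝ) (L : L2T T (L2 Ω) →L[ℝ] L2T T (L2 Ω)) : Prop :=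
  ∀ u, ∀ᵐ t ∂volume.restrict (Ioo 0 T), ∀ᵐ x ∂volume.restrict Ω, L u t x = b (x, t) * u t x

theorem IsMulOperator.inner_symm {b : Rn n × ℝ → ℝ} {L : L2T T (L2 Ω) →L[ℝ] L2T T (L2 Ω)}
    (h : IsMulOperator b L) (u v : L2T T (L2 Ω)) : inner ℝ (L u) v = inner ℝ u (L v) := by
  rw [L2T_inner, L2T_inner]
  refine integral_congr_ae ?_
  filter_upwards [h u, h v] with t h1 h2
  rw [L2_inner_eq, L2_inner_eq]
  refine integral_congr_ae ?_
  filter_upwards [h1, h2] with x e1 e2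
  rw [e1, e2]
  ring

theorem IsMulOperator.isLocal {b : Rn n × ℝ → ℝ} {L : L2T T (L2 Ω) →L[ℝ] L2T T (L2 Ω)}
    (h : IsMulOperator b L) : IsLocal L := fun e he u => by
  refine Lp.ext ?_
  filter_upwards [h (timeMul e he u), h u, coeFn_timeMul he u, coeFn_timeMul he (L u)]
    with t h1 h2 h3 h4
  rw [h4]
  refine Lp.ext ?_
  filter_upwards [h1, h2, Lp.coeFn_smul (e t) (u t), Lp.coeFn_smul (e t) (L u t)] with x e1 e2 e3 e4
  rw [e1, e4, Pi.smul_apply, e2, h3, e3, Pi.smul_apply, smul_eq_mul, smul_eq_mul]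
  ring

theorem exists_isMulOperator_indicator (T : ℝ) {O : Set (Rn n)} (hO : MeasurableSet O) :
    ∃ L : L2T T (L2 Ω) →L[ℝ] L2T T (L2 Ω), (∀ u, ‖L u‖ ≤ ‖u‖) ∧
      IsMulOperator (fun z => O.indicator 1 z.1) L := by
  have hm : StronglyMeasurable fun z : Rn n × ℝ => O.indicator (1 : Rn n → ℝ) z.1 :=
    (stronglyMeasurable_one.indicator hO).comp_measurable measurable_fst
  obtain ⟨L, h1, h2⟩ := exists_cyl_mul_operator (Ω := Ω) T hm zero_le_one (Eventually.of_forall fun z => by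
    by_cases hz : z.1 ∈ O
    · simp [hz]
    · simp [hz])
  exact ⟨L, fun u => by simpa using h1 u, h2⟩

/-- The values of a lie in a normed space F so that one statement serves the scalar coefficient and
each component of B, which is bounded pointwise by |B|. -/
theorem exists_isMulOperator_of_norm_le {F : Type} [NormedAddCommGroup F]
    (a : Lp F ⊤ (volume.restrict (cyl Ω T))) {b : Rn n × ℝ → ℝ} (hb : StronglyMeasurable b)
    (hba : ∀ z, |b z| ≤ ‖a z‖) {M : ℝ} (hM : 0 ≤ M) (ha : ‖a‖ ≤ M) :
    ∃ L : L2T T (L2 Ω) →L[ℝ] L2T T (L2 Ω), (∀ u, ‖L u‖ ≤ M * ‖u‖) ∧ IsMulOperator b L := by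
  have h : ∀ᵐ z ∂volume.restrict (cyl Ω T), ‖a z‖ ≤ ‖a‖ := by
    have e : eLpNormEssSup a (volume.restrict (cyl Ω T)) = ENNReal.ofReal ‖a‖ := by
      rw [← eLpNorm_exponent_top, Lp.norm_def, ENNReal.ofReal_toReal (Lp.eLpNorm_ne_top a)]
    filter_upwards [ae_le_eLpNormEssSup (f := a) (μ := volume.restrict (cyl Ω T))] with z hz
    rw [e, ← ofReal_norm] at hz
    exact (ENNReal.ofReal_le_ofReal_iff (norm_nonneg _)).1 hz
  refine exists_cyl_mul_operator (Ω := Ω) T hb hM ?_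
  filter_upwards [h] with z hz
  exact ((hba z).trans hz).trans ha

/-- Integration over a subset of `Ω` as an inner product in `L²(Ω)`. -/
theorem setIntegral_mul_eq_inner {O : Set (Rn n)} (hO : MeasurableSet O) (hOΩ : O ⊆ Ω)
    {f : Rn n → ℝ} {g : L2 Ω} (hg : ∀ᵐ x ∂volume.restrict Ω, g x = O.indicator f x) (h : L2 Ω) :
    ∫ x in O, f x * h x = inner ℝ g h := by
  have e : ∫ x in O, f x * h x = ∫ x in Ω, O.indicator (fun x => f x * h x) x := by
    rw [integral_indicator hO, Measure.restrict_restrict hO, inter_eq_left.2 hOΩ]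
  rw [e, L2_inner_eq]
  refine integral_congr_ae ?_
  filter_upwards [hg] with x hx
  rw [hx, indicator_mul_left]

end Multiplication

/-! ### The operators Δ² + a + B·∇ and Δ² + a - ∇·(B ·), and the weak formulations. -/

section FourthOrderOperator

variable {n : ℕ} {Ω : Set (Rn n)} {T : ℝ}

theorem inner_lift_adjoint {E F : Type} [NormedAddCommGroup E] [InnerProductSpace ℝ E] [CompleteSpace E]
    [NormedAddCommGroup F] [InnerProductSpace ℝ F] [CompleteSpace F] (L : E →L[ℝ] F)
    (u : L2T T F) (v : L2T T E) :
    inner ℝ (lift T (ContinuousLinearMap.adjoint L) u) v = inner ℝ u (lift T L v) := by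
  rw [inner_lift_left, ContinuousLinearMap.adjoint_adjoint]

/-- The operator `Δ² + a + B·∇` on `L²(0,T;H₀²(Ω))`, for given multiplication operators. -/
def stateOp (La : L2T T (L2 Ω) →L[ℝ] L2T T (L2 Ω)) (LB : Fin n → L2T T (L2 Ω) →L[ℝ] L2T T (L2 Ω)) :
    L2T T (H02 Ω) →L[ℝ] L2T T (H02 Ω) :=
  (lift T (ContinuousLinearMap.adjoint H02.lap)).comp (lift T H02.lap)
    + (lift T (ContinuousLinearMap.adjoint H02.val)).comp (La.comp (lift T H02.val))
    + ∑ j, (lift T (ContinuousLinearMap.adjoint H02.val)).comp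
        ((LB j).comp (lift T (H02.partialD j)))

/-- The operator `Δ² + a - ∇·(B ·)` on `L²(0,T;H₀²(Ω))`, for given multiplication operators. -/
def adjointOp (La : L2T T (L2 Ω) →L[ℝ] L2T T (L2 Ω)) (LB : Fin n → L2T T (L2 Ω) →L[ℝ] L2T T (L2 Ω)) :
    L2T T (H02 Ω) →L[ℝ] L2T T (H02 Ω) :=
  (lift T (ContinuousLinearMap.adjoint H02.lap)).comp (lift T H02.lap)
    + (lift T (ContinuousLinearMap.adjoint H02.val)).comp (La.comp (lift T H02.val))
    + ∑ j, (lift T (ContinuousLinearMap.adjoint (H02.partialD j))).comp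
        ((LB j).comp (lift T H02.val))

variable {La : L2T T (L2 Ω) →L[ℝ] L2T T (L2 Ω)} {LB : Fin n → L2T T (L2 Ω) →L[ℝ] L2T T (L2 Ω)}

theorem inner_stateOp (u z : L2T T (H02 Ω)) :
    inner ℝ (stateOp La LB u) z = inner ℝ (lift T H02.lap u) (lift T H02.lap z)
      + inner ℝ (La (lift T H02.val u)) (lift T H02.val z)
      + ∑ j, inner ℝ (LB j (lift T (H02.partialD j) u)) (lift T H02.val z) := by
  simp only [stateOp, add_apply, sum_apply, ContinuousLinearMap.comp_apply, inner_add_left, sum_inner,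
    inner_lift_adjoint]

theorem inner_adjointOp (u z : L2T T (H02 Ω)) :
    inner ℝ (adjointOp La LB u) z = inner ℝ (lift T H02.lap u) (lift T H02.lap z)
      + inner ℝ (La (lift T H02.val u)) (lift T H02.val z)
      + ∑ j, inner ℝ (LB j (lift T H02.val u)) (lift T (H02.partialD j) z) := by
  simp only [adjointOp, add_apply, sum_apply, ContinuousLinearMap.comp_apply, inner_add_left, sum_inner,
    inner_lift_adjoint]

/-- Multiplication operators are symmetric, so exchanging the roles of u and z moves ∂ⱼ to the other
factor. B is never differentiated. -/
theorem inner_stateOp_eq_inner_adjointOp (ha : ∀ u v, inner ℝ (La u) v = inner ℝ u (La v))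
    (hB : ∀ j u v, inner ℝ (LB j u) v = inner ℝ u (LB j v)) (u z : L2T T (H02 Ω)) :
    inner ℝ (stateOp La LB u) z = inner ℝ u (adjointOp La LB z) := by
  rw [real_inner_comm (adjointOp La LB z), inner_stateOp, inner_adjointOp, real_inner_comm (lift T H02.lap u),
    ha, real_inner_comm (lift T H02.val u)]
  congr 1
  exact Finset.sum_congr rfl fun j _ => by rw [hB, real_inner_comm]

theorem norm_lift_jet_le (k : JetIdx n) (u : L2T T (H02 Ω)) : ‖lift T (H02.jet k) u‖ ≤ ‖u‖ := by
  refine Lp.norm_le_norm_of_ae_le ?_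
  filter_upwards [coeFn_lift (H02.jet k) u] with t ht
  rw [ht]
  exact H02.norm_jet_le k _

theorem norm_lift_adjoint_val_le (u : L2T T (L2 Ω)) :
    ‖lift T (ContinuousLinearMap.adjoint (H02.val (Ω := Ω))) u‖ ≤ ‖u‖ := by
  refine (norm_lift_le _ u).trans ?_
  have h : ‖ContinuousLinearMap.adjoint (H02.val (Ω := Ω))‖ ≤ 1 := by
    rw [LinearIsometryEquiv.norm_map]
    exact ContinuousLinearMap.opNorm_le_bound _ zero_le_one fun v => by
      rw [one_mul]; exact H02.norm_jet_le _ v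
  simpa using mul_le_mul_of_nonneg_right h (norm_nonneg u)

theorem norm_stateOp_le {M : ℝ} (hM : 0 ≤ M) (ha : ∀ u, ‖La u‖ ≤ M * ‖u‖)
    (hB : ∀ j u, ‖LB j u‖ ≤ M * ‖u‖) (u : L2T T (H02 Ω)) :
    ‖stateOp La LB u‖ ≤ (‖(ContinuousLinearMap.adjoint (H02.lap (Ω := Ω))).comp H02.lap‖ + M + n * M)
      * ‖u‖ := by
  simp only [stateOp, add_apply, sum_apply, ContinuousLinearMap.comp_apply]
  have h1 := norm_lift_le ((ContinuousLinearMap.adjoint (H02.lap (Ω := Ω))).comp H02.lap) u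
  rw [← lift_lift] at h1
  have h2 : ‖lift T (ContinuousLinearMap.adjoint H02.val) (La (lift T H02.val u))‖ ≤ M * ‖u‖ :=
    (norm_lift_adjoint_val_le _).trans ((ha _).trans (by gcongr; exact norm_lift_jet_le _ u))
  have h3 : ‖∑ j, lift T (ContinuousLinearMap.adjoint H02.val) (LB j (lift T (H02.partialD j) u))‖
      ≤ ∑ _j : Fin n, M * ‖u‖ := norm_sum_le_of_le _ fun j _ =>
    (norm_lift_adjoint_val_le _).trans ((hB j _).trans (by gcongr; exact norm_lift_jet_le _ u))
  rw [Finset.sum_const, Finset.card_univ, Fintype.card_fin, nsmul_eq_mul] at h3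
  refine (norm_add_le _ _).trans ((add_le_add ((norm_add_le _ _).trans (add_le_add h1 h2)) h3).trans ?_)
  apply le_of_eq
  ring

theorem norm_sq_le_lift (w : L2T T (H02 Ω)) :
    ‖w‖ ^ 2 ≤ 2 * (‖lift T H02.val w‖ ^ 2 + ‖lift T H02.lap w‖ ^ 2) := by
  have hsq : ∀ {E : Type} [NormedAddCommGroup E] (u : L2T T E),
      IntegrableOn (fun t => ‖u t‖ ^ 2) (Ioo 0 T) := fun u => (Lp.memLp u).integrable_norm_pow (by norm_num)
  rw [L2T_norm_sq, L2T_norm_sq, L2T_norm_sq, ← integral_add (hsq _) (hsq _), ← integral_const_mul]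
  refine integral_mono_ae (hsq w) (((hsq _).add (hsq _)).const_mul _) ?_
  filter_upwards [coeFn_lift H02.val w, coeFn_lift H02.lap w] with t h1 h2
  simp only [h1, h2]
  exact H02.norm_sq_le (w t)

/-- With x = ‖w‖_{L²(Q)}, the H² bound gives ‖Δw‖² ≥ ‖w‖²/2 - x². The potential costs at most M x²,
and the drift n M ‖w‖ x ≤ ‖w‖²/4 + (n M x)². Half minus a quarter leaves the constant 1/4, and the
multiples of x² add up to l. -/
theorem isGarding_stateOp {M : ℝ} (hM : 0 ≤ M) (ha : ∀ u, ‖La u‖ ≤ M * ‖u‖)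
    (hB : ∀ j u, ‖LB j u‖ ≤ M * ‖u‖) (hla : IsLocal La) (hlB : ∀ j, IsLocal (LB j)) :
    IsGarding (H02.val (Ω := Ω)) (stateOp La LB) (1 / 4) (1 + M + (n * M) ^ 2) where
  coercive w := by
    rw [inner_stateOp, inner_lift_gram, real_inner_self_eq_norm_sq, real_inner_self_eq_norm_sq]
    have h0 := norm_sq_le_lift w
    set x := ‖lift T H02.val w‖
    have hx : 0 ≤ x := norm_nonneg _
    have h1 : |inner ℝ (La (lift T H02.val w)) (lift T H02.val w)| ≤ M * x * x :=
      (abs_real_inner_le_norm _ _).trans (by gcongr; exact ha _)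
    have h2 : |∑ j, inner ℝ (LB j (lift T (H02.partialD j) w)) (lift T H02.val w)|
        ≤ n * (M * ‖w‖ * x) := by
      refine (Finset.abs_sum_le_sum_abs _ _).trans ?_
      refine (Finset.sum_le_sum (g := fun _ => M * ‖w‖ * x) fun j _ =>
        (abs_real_inner_le_norm _ _).trans ?_).trans ?_
      · exact mul_le_mul_of_nonneg_right
          ((hB j _).trans (mul_le_mul_of_nonneg_left (norm_lift_jet_le _ w) hM)) hx
      · rw [Finset.sum_const, Finset.card_univ, Fintype.card_fin, nsmul_eq_mul]
    have h3 := (abs_le.1 h1).1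
    have h4 := (abs_le.1 h2).1
    nlinarith [sq_nonneg (1 / 2 * ‖w‖ - n * M * x)]
  comm := ((isLocal_lift _).comp (isLocal_lift _)).add ((isLocal_lift _).comp (hla.comp (isLocal_lift _)))
    |>.add (IsLocal.sum _ fun j => (isLocal_lift _).comp ((hlB j).comp (isLocal_lift _)))

/-- The exceptional null set of times does not depend on v: the formulas for the operators hold as
equalities in V or L² for almost every t, and v is paired with them afterwards. -/
theorem stateOp_apply {a : Rn n × ℝ → ℝ} {B : Rn n × ℝ → Rn n} (ha : IsMulOperator a La)
    (hB : ∀ j, IsMulOperator (fun z => B z j) (LB j)) (u : L2T T (H02 Ω)) :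
    ∀ᵐ t ∂volume.restrict (Ioo 0 T), ∀ v : H02 Ω, inner ℝ (stateOp La LB u t) v
      = (∫ x in Ω, H02.lap (u t) x * H02.lap v x)
      + (∫ x in Ω, a (x, t) * H02.val (u t) x * H02.val v x)
      + (∫ x in Ω, (∑ j, B (x, t) j * H02.partialD j (u t) x) * H02.val v x) := by
  filter_upwards [Lp.coeFn_add ((lift T (ContinuousLinearMap.adjoint H02.lap)) (lift T H02.lap u)
      + (lift T (ContinuousLinearMap.adjoint H02.val)) (La (lift T H02.val u)))
      (∑ j, (lift T (ContinuousLinearMap.adjoint H02.val)) (LB j (lift T (H02.partialD j) u))),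
    Lp.coeFn_add ((lift T (ContinuousLinearMap.adjoint H02.lap)) (lift T H02.lap u))
      ((lift T (ContinuousLinearMap.adjoint H02.val)) (La (lift T H02.val u))),
    Lp.coeFn_finsetSum Finset.univ fun j => (lift T (ContinuousLinearMap.adjoint H02.val))
      (LB j (lift T (H02.partialD j) u)),
    coeFn_lift (ContinuousLinearMap.adjoint H02.lap) (lift T H02.lap u), coeFn_lift H02.lap u,
    coeFn_lift (ContinuousLinearMap.adjoint H02.val) (La (lift T H02.val u)), coeFn_lift H02.val u,
    ae_all_iff.2 fun j => coeFn_lift (ContinuousLinearMap.adjoint H02.val)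
      (LB j (lift T (H02.partialD j) u)),
    ae_all_iff.2 fun j => coeFn_lift (H02.partialD j) u, ha (lift T H02.val u),
    ae_all_iff.2 fun j => hB j (lift T (H02.partialD j) u)] with t a1 a2 a3 a4 a5 a6 a7 a8 a9 a10 a11 v
  simp only [stateOp, add_apply, sum_apply, ContinuousLinearMap.comp_apply]
  rw [a1, Pi.add_apply, a2, Pi.add_apply, a3, Finset.sum_apply, a4, a5, a6]
  simp only [a8, inner_add_left, sum_inner, ContinuousLinearMap.adjoint_inner_left]
  rw [L2_inner_eq]
  congr 1
  · congr 1
    rw [L2_inner_eq]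
    refine integral_congr_ae ?_
    rw [a7] at a10
    filter_upwards [a10] with x hx
    rw [hx]
  · have e : ∀ᵐ x ∂volume.restrict Ω, (∑ j, B (x, t) j * H02.partialD j (u t) x) * H02.val v x
        = ∑ j, LB j (lift T (H02.partialD j) u) t x * H02.val v x := by
      filter_upwards [ae_all_iff.2 a11] with x hx
      rw [Finset.sum_mul]
      exact Finset.sum_congr rfl fun j _ => by rw [hx, a9]
    rw [integral_congr_ae e, integral_finsetSum]
    · exact Finset.sum_congr rfl fun j _ => L2_inner_eq _ _
    · intro j _
      have := L2.integrable_inner (𝕜 := ℝ) (H02.val v) (LB j (lift T (H02.partialD j) u) t)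
      simpa using this

theorem adjointOp_apply {a : Rn n × ℝ → ℝ} {B : Rn n × ℝ → Rn n} (ha : IsMulOperator a La)
    (hB : ∀ j, IsMulOperator (fun z => B z j) (LB j)) (u : L2T T (H02 Ω)) :
    ∀ᵐ t ∂volume.restrict (Ioo 0 T), ∀ v : H02 Ω, inner ℝ (adjointOp La LB u t) v
      = (∫ x in Ω, H02.lap (u t) x * H02.lap v x)
      + (∫ x in Ω, a (x, t) * H02.val (u t) x * H02.val v x)
      + (∫ x in Ω, H02.val (u t) x * (∑ j, B (x, t) j * H02.partialD j v x)) := by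
  filter_upwards [Lp.coeFn_add ((lift T (ContinuousLinearMap.adjoint H02.lap)) (lift T H02.lap u)
      + (lift T (ContinuousLinearMap.adjoint H02.val)) (La (lift T H02.val u)))
      (∑ j, (lift T (ContinuousLinearMap.adjoint (H02.partialD j))) (LB j (lift T H02.val u))),
    Lp.coeFn_add ((lift T (ContinuousLinearMap.adjoint H02.lap)) (lift T H02.lap u))
      ((lift T (ContinuousLinearMap.adjoint H02.val)) (La (lift T H02.val u))),
    Lp.coeFn_finsetSum Finset.univ fun j => (lift T (ContinuousLinearMap.adjoint (H02.partialD j)))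
      (LB j (lift T H02.val u)),
    coeFn_lift (ContinuousLinearMap.adjoint H02.lap) (lift T H02.lap u), coeFn_lift H02.lap u,
    coeFn_lift (ContinuousLinearMap.adjoint H02.val) (La (lift T H02.val u)), coeFn_lift H02.val u,
    ae_all_iff.2 fun j => coeFn_lift (ContinuousLinearMap.adjoint (H02.partialD j))
      (LB j (lift T H02.val u)),
    ha (lift T H02.val u), ae_all_iff.2 fun j => hB j (lift T H02.val u)]
    with t a1 a2 a3 a4 a5 a6 a7 a8 a10 a11 v
  simp only [adjointOp, add_apply, sum_apply, ContinuousLinearMap.comp_apply]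
  rw [a1, Pi.add_apply, a2, Pi.add_apply, a3, Finset.sum_apply, a4, a5, a6]
  simp only [a8, inner_add_left, sum_inner, ContinuousLinearMap.adjoint_inner_left]
  rw [L2_inner_eq]
  rw [a7] at a10 a11
  congr 1
  · congr 1
    rw [L2_inner_eq]
    refine integral_congr_ae ?_
    filter_upwards [a10] with x hx
    rw [hx]
  · have e : ∀ᵐ x ∂volume.restrict Ω, H02.val (u t) x * (∑ j, B (x, t) j * H02.partialD j v x)
        = ∑ j, LB j (lift T H02.val u) t x * H02.partialD j v x := by
      filter_upwards [ae_all_iff.2 a11] with x hx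
      rw [Finset.mul_sum]
      exact Finset.sum_congr rfl fun j _ => by rw [hx]; ring
    rw [integral_congr_ae e, integral_finsetSum]
    · exact Finset.sum_congr rfl fun j _ => L2_inner_eq _ _
    · intro j _
      have := L2.integrable_inner (𝕜 := ℝ) (H02.partialD j v) (LB j (lift T H02.val u) t)
      simpa using this

/-- The operator on `L²(0,T;H₀²(Ω))` representing `(u, v) ↦ ∫∫ L(u) v`. -/
def sourceOp (L : L2T T (L2 Ω) →L[ℝ] L2T T (L2 Ω)) : L2T T (H02 Ω) →L[ℝ] L2T T (H02 Ω) :=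
  (lift T (ContinuousLinearMap.adjoint H02.val)).comp (L.comp (lift T H02.val))

theorem norm_sourceOp_le {L : L2T T (L2 Ω) →L[ℝ] L2T T (L2 Ω)} (hL : ∀ u, ‖L u‖ ≤ ‖u‖)
    (u : L2T T (H02 Ω)) : ‖sourceOp L u‖ ≤ ‖u‖ :=
  (norm_lift_adjoint_val_le _).trans ((hL _).trans (norm_lift_jet_le _ u))

theorem sourceOp_apply {O : Set (Rn n)} (hO : MeasurableSet O) (hOΩ : O ⊆ Ω)
    {L : L2T T (L2 Ω) →L[ℝ] L2T T (L2 Ω)} (hL : IsMulOperator (fun z => O.indicator 1 z.1) L)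
    (u : L2T T (H02 Ω)) : ∀ᵐ t ∂volume.restrict (Ioo 0 T), ∀ v : H02 Ω,
      inner ℝ (sourceOp L u t) v = ∫ x in O, H02.val (u t) x * H02.val v x := by
  filter_upwards [coeFn_lift (ContinuousLinearMap.adjoint H02.val) (L (lift T H02.val u)),
    coeFn_lift H02.val u, hL (lift T H02.val u)] with t h1 h2 h3 v
  rw [sourceOp, ContinuousLinearMap.comp_apply, ContinuousLinearMap.comp_apply, h1,
    ContinuousLinearMap.adjoint_inner_left]
  refine (setIntegral_mul_eq_inner hO hOΩ ?_ _).symm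
  filter_upwards [h3] with x hx
  rw [hx, h2]
  by_cases hxO : x ∈ O <;> simp [hxO]

/-- A right-hand side in `L²(O × (0,T))` as an element of `L²(0,T;H₀²(Ω))`, by duality. -/
theorem exists_source {O : Set (Rn n)} (hO : MeasurableSet O) (hOΩ : O ⊆ Ω)
    (f : Lp ℝ 2 (volume.restrict (cyl O T))) :
    ∃ F : L2T T (H02 Ω), ‖F‖ ≤ ‖f‖ ∧ ∀ᵐ t ∂volume.restrict (Ioo 0 T), ∀ v : H02 Ω,
      inner ℝ (F t) v = ∫ x in O, f (x, t) * H02.val v x ∧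
      Integrable (fun x => f (x, t) * H02.val v x) (volume.restrict O) := by
  obtain ⟨G, h1, h2⟩ := exists_extension_slice hO hOΩ f
  refine ⟨lift T (ContinuousLinearMap.adjoint H02.val) G, (norm_lift_adjoint_val_le G).trans h1, ?_⟩
  filter_upwards [h2, coeFn_lift (ContinuousLinearMap.adjoint H02.val) G] with t a1 a2 v
  rw [a2, ContinuousLinearMap.adjoint_inner_left]
  refine ⟨(setIntegral_mul_eq_inner hO hOΩ a1 _).symm, ?_⟩
  -- Integrability is recorded because the adjoint equation requires splitting the integral of (w -
  -- w_d) v.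
  have hi : IntegrableOn (fun x => G t x * H02.val v x) O (volume.restrict Ω) := by
    have := L2.integrable_inner (𝕜 := ℝ) (H02.val v) (G t)
    exact Integrable.integrableOn (by simpa using this)
  rw [IntegrableOn, Measure.restrict_restrict hO, inter_eq_left.2 hOΩ] at hi
  refine hi.congr ?_
  have a3 := ae_restrict_of_ae_restrict_of_subset hOΩ a1
  filter_upwards [a3, ae_restrict_mem hO] with x hx hxO
  rw [hx, indicator_of_mem hxO]

/-- A vector of H₀² is determined by its inner products with all v, so the weak equation at almost
every t is an equality in H₀² at almost every t, that is, an equality in L²(0,T;H₀²). -/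
theorem isForwardSolution_iff {O : Set (Rn n)} {Of : Fin 2 → Set (Rn n)}
    (hOf : ∀ k, MeasurableSet (Of k)) (hOfΩ : ∀ k, Of k ⊆ Ω)
    {a : Lp ℝ ⊤ (volume.restrict (cyl Ω T))} {B : Lp (Rn n) ⊤ (volume.restrict (cyl Ω T))}
    (ha : IsMulOperator a La) (hB : ∀ j, IsMulOperator (fun z => B z j) (LB j))
    {P : Fin 2 → L2T T (L2 Ω) →L[ℝ] L2T T (L2 Ω)}
    (hP : ∀ k, IsMulOperator (fun z => (Of k).indicator 1 z.1) (P k))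
    {μ : Fin 2 → ℝ} {f : Lp ℝ 2 (volume.restrict (cyl O T))} {F : L2T T (H02 Ω)}
    (hF : ∀ᵐ t ∂volume.restrict (Ioo 0 T), ∀ v : H02 Ω,
      inner ℝ (F t) v = ∫ x in O, f (x, t) * H02.val v x) {w₀ : L2 Ω} {w : X Ω T} {φ : Fin 2 → X Ω T} :
    IsForwardSolution O Of a B μ f w₀ w φ ↔ IsCauchySolution H02.val (stateOp La LB) 1 0
      (F - ∑ k, (μ k)⁻¹ • sourceOp (P k) (φ k).toL2) w₀ w.toL2 w.der := by
  have key : ∀ᵐ t ∂volume.restrict (Ioo 0 T),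
      ((((1 : ℝ) • w.der + stateOp La LB w.toL2) t
        = (F - ∑ k, (μ k)⁻¹ • sourceOp (P k) (φ k).toL2) t) ↔ ∀ v : H02 Ω,
      w.deriv t v
      + (∫ x in Ω, H02.lap (w.toL2 t) x * H02.lap v x)
      + (∫ x in Ω, a (x, t) * H02.val (w.toL2 t) x * H02.val v x)
      + (∫ x in Ω, (∑ j, B (x, t) j * H02.partialD j (w.toL2 t) x) * H02.val v x)
    = (∫ x in O, f (x, t) * H02.val v x)
      - ∑ i, (μ i)⁻¹ * (∫ x in Of i, H02.val ((φ i).toL2 t) x * H02.val v x)) := by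
    filter_upwards [Lp.coeFn_add ((1 : ℝ) • w.der) (stateOp La LB w.toL2), Lp.coeFn_smul (1 : ℝ) w.der,
      Lp.coeFn_sub F (∑ k, (μ k)⁻¹ • sourceOp (P k) (φ k).toL2),
      Lp.coeFn_finsetSum Finset.univ fun k => (μ k)⁻¹ • sourceOp (P k) (φ k).toL2,
      ae_all_iff.2 fun k => Lp.coeFn_smul (μ k)⁻¹ (sourceOp (P k) (φ k).toL2),
      ae_all_iff.2 fun k => sourceOp_apply (hOf k) (hOfΩ k) (hP k) (φ k).toL2,
      stateOp_apply ha hB w.toL2, w.inner_der, hF] with t a1 a2 a3 a4 a5 a6 a7 a8 a9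
    rw [a1, Pi.add_apply, a2, Pi.smul_apply, one_smul, a3, Pi.sub_apply, a4, Finset.sum_apply,
      ext_iff_inner_right ℝ]
    refine forall_congr' fun v => ?_
    simp only [a5, Pi.smul_apply]
    rw [inner_add_left, inner_sub_left, sum_inner, a7, a8, a9]
    simp only [real_inner_smul_left, a6]
    rw [add_assoc, add_assoc, add_assoc]
  constructor
  · intro h
    obtain ⟨U, h1, h2, h3⟩ := h.initial
    refine ⟨w.hasWeakDeriv, ⟨U, ⟨h1, h2⟩, h3⟩, Lp.ext ?_⟩
    filter_upwards [key, h.equation] with t k1 k2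
    exact k1.2 k2
  · intro h
    obtain ⟨U, ⟨h1, h2⟩, h3⟩ := h.trace
    refine ⟨?_, U, h1, h2, h3⟩
    filter_upwards [key] with t k1
    exact k1.1 (by rw [h.equation])

theorem isAdjointSolution_iff {Od : Set (Rn n)} (hOd : MeasurableSet Od) (hOdΩ : Od ⊆ Ω)
    {a : Lp ℝ ⊤ (volume.restrict (cyl Ω T))} {B : Lp (Rn n) ⊤ (volume.restrict (cyl Ω T))}
    (ha : IsMulOperator a La) (hB : ∀ j, IsMulOperator (fun z => B z j) (LB j))
    {D : L2T T (L2 Ω) →L[ℝ] L2T T (L2 Ω)} (hD : IsMulOperator (fun z => Od.indicator 1 z.1) D)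
    {α : ℝ} {wd : Lp ℝ 2 (volume.restrict (cyl Od T))} {E : L2T T (H02 Ω)}
    (hE : ∀ᵐ t ∂volume.restrict (Ioo 0 T), ∀ v : H02 Ω,
      inner ℝ (E t) v = ∫ x in Od, wd (x, t) * H02.val v x ∧
      Integrable (fun x => wd (x, t) * H02.val v x) (volume.restrict Od)) {w φ : X Ω T} :
    IsAdjointSolution Od a B α wd w φ ↔ IsCauchySolution H02.val (adjointOp La LB) (-1) T
      (α • (sourceOp D w.toL2 - E)) 0 φ.toL2 φ.der := by
  have key : ∀ᵐ t ∂volume.restrict (Ioo 0 T),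
      ((((-1 : ℝ) • φ.der + adjointOp La LB φ.toL2) t = (α • (sourceOp D w.toL2 - E)) t) ↔ ∀ v : H02 Ω,
      - φ.deriv t v
      + (∫ x in Ω, H02.lap (φ.toL2 t) x * H02.lap v x)
      + (∫ x in Ω, a (x, t) * H02.val (φ.toL2 t) x * H02.val v x)
      + (∫ x in Ω, H02.val (φ.toL2 t) x * (∑ j, B (x, t) j * H02.partialD j v x))
    = α * (∫ x in Od, (H02.val (w.toL2 t) x - wd (x, t)) * H02.val v x)) := by
    filter_upwards [Lp.coeFn_add ((-1 : ℝ) • φ.der) (adjointOp La LB φ.toL2),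
      Lp.coeFn_smul (-1 : ℝ) φ.der, Lp.coeFn_smul α (sourceOp D w.toL2 - E),
      Lp.coeFn_sub (sourceOp D w.toL2) E, sourceOp_apply hOd hOdΩ hD w.toL2,
      adjointOp_apply ha hB φ.toL2, φ.inner_der, hE] with t a1 a2 a3 a4 a5 a6 a7 a8
    rw [a1, Pi.add_apply, a2, Pi.smul_apply, a3, Pi.smul_apply, a4, Pi.sub_apply,
      ext_iff_inner_right ℝ]
    refine forall_congr' fun v => ?_
    have hi : Integrable (fun x => H02.val (w.toL2 t) x * H02.val v x) (volume.restrict Od) := by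
      have := L2.integrable_inner (𝕜 := ℝ) (H02.val v) (H02.val (w.toL2 t))
      have h' : Integrable (fun x => H02.val (w.toL2 t) x * H02.val v x) (volume.restrict Ω) := by
        simpa using this
      exact IntegrableOn.mono_set h' hOdΩ
    simp only [sub_mul]
    rw [integral_sub hi (a8 v).2, inner_add_left, real_inner_smul_left, real_inner_smul_left,
      inner_sub_left, a5, a6, a7, (a8 v).1, neg_one_mul, add_assoc, add_assoc, add_assoc]
  constructor
  · intro h
    obtain ⟨U, h1, h2, h3⟩ := h.final
    refine ⟨φ.hasWeakDeriv, ⟨U, ⟨h1, h2⟩, h3⟩, Lp.ext ?_⟩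
    filter_upwards [key, h.equation] with t k1 k2
    exact k1.2 k2
  · intro h
    obtain ⟨U, ⟨h1, h2⟩, h3⟩ := h.trace
    refine ⟨?_, U, h1, h2, h3⟩
    filter_upwards [key] with t k1
    exact k1.1 (by rw [h.equation])

end FourthOrderOperator

end FourthOrderParabolic
end

/-! ### The main theorem. -/

open FourthOrderParabolic in
theorem theorem3p2 (n : ℕ) (hn : 2 ≤ n) (Ω : Set (Rn n)) (hΩ : IsC4Domain Ω)
    (T : ℝ) (hT : 0 < T) (M : ℝ) :
    ∃ ε > (0 : ℝ), ∃ C > (0 : ℝ),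
      ∀ (a : Lp ℝ ∞ (volume.restrict (cyl Ω T))) (B : Lp (Rn n) ∞ (volume.restrict (cyl Ω T))),
      ‖a‖ ≤ M → ‖B‖ ≤ M →
      ∀ (O : Set (Rn n)) (Of Od : Fin 2 → Set (Rn n)),
      IsOpen O → O.Nonempty → O ⊆ Ω →
      (∀ i, IsOpen (Of i) ∧ (Of i).Nonempty ∧ Of i ⊆ Ω) →
      (∀ i, IsOpen (Od i) ∧ (Od i).Nonempty ∧ Od i ⊆ Ω) →
      ∀ α μ : Fin 2 → ℝ, (∀ i, 0 < α i) → (∀ i, 0 < μ i) →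
      max (α 0) (α 1) / min (μ 0) (μ 1) ≤ ε →
      ∀ (w₀ : L2 Ω) (f : Lp ℝ 2 (volume.restrict (cyl O T)))
        (wd : (i : Fin 2) → Lp ℝ 2 (volume.restrict (cyl (Od i) T))),
      ∃ w : X Ω T, ∃ φ : Fin 2 → X Ω T,
        (IsForwardSolution O Of a B μ f w₀ w φ ∧
          ∀ i, IsAdjointSolution (Od i) a B (α i) (wd i) w (φ i)) ∧
        (∀ (w' : X Ω T) (φ' : Fin 2 → X Ω T),
          IsForwardSolution O Of a B μ f w₀ w' φ' →
          (∀ i, IsAdjointSolution (Od i) a B (α i) (wd i) w' (φ' i)) → w' = w ∧ φ' = φ) ∧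
        ‖w‖ ≤ C * (‖w₀‖ + ‖f‖ + ∑ i, ‖wd i‖) := by
  -- M may be negative, in which case no coefficient satisfies the bound; |M| keeps all constants
  -- nonnegative.
  set N := |M| with hN
  have hN0 : 0 ≤ N := abs_nonneg M
  set l : ℝ := 1 + N + (n * N) ^ 2 with hl
  have hl0 : 0 ≤ l := by positivity
  have hc0 : (0 : ℝ) < 1 / 4 := by norm_num
  set K := energyConst T (1 / 4) l with hK
  have hK0 : 0 < K := energyConst_pos hc0
  set KA : ℝ := ‖(ContinuousLinearMap.adjoint (H02.lap (Ω := Ω))).comp H02.lap‖ + N + n * N with hKA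
  have hKA0 : 0 ≤ KA := by positivity
  -- Each of the two couplings may use half of the admissible 1/(2K²). C is the sum of the a priori
  -- constants for u and for its time derivative.
  refine ⟨1 / (4 * K ^ 2), by positivity, (2 * K + 1) + (1 + 2 / K + KA) * (2 * K + 1), by positivity, ?_⟩
  intro a B ha hB O Of Od hO _ hOΩ hOf hOd α μ hα hμ hε w₀ f wd
  obtain ⟨La, hLa, hLa'⟩ := exists_isMulOperator_of_norm_le a (Lp.stronglyMeasurable a)
    (fun z => le_rfl) hN0 (ha.trans (le_abs_self M))
  choose LB hLB hLB' using fun j : Fin n => exists_isMulOperator_of_norm_le B (b := fun z => B z j)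
    ((EuclideanSpace.proj (𝕜 := ℝ) j).continuous.comp_stronglyMeasurable (Lp.stronglyMeasurable B))
    (fun z => PiLp.norm_apply_le (B z) j) hN0 (hB.trans (le_abs_self M))
  choose P hP hP' using fun k : Fin 2 =>
    exists_isMulOperator_indicator (Ω := Ω) T (hOf k).1.measurableSet
  choose D hD hD' using fun k : Fin 2 =>
    exists_isMulOperator_indicator (Ω := Ω) T (hOd k).1.measurableSet
  obtain ⟨F, hF, hF'⟩ := exists_source hO.measurableSet hOΩ f
  choose E hE hE' using fun k : Fin 2 => exists_source (hOd k).1.measurableSet (hOd k).2.2 (wd k)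
  have hF'' : ∀ᵐ t ∂volume.restrict (Ioo 0 T), ∀ v : H02 Ω,
      inner ℝ (F t) v = ∫ x in O, f (x, t) * H02.val v x := by
    filter_upwards [hF'] with t ht v using (ht v).1
  have hG : IsGarding (H02.val (Ω := Ω)) (stateOp La LB) (1 / 4) l :=
    isGarding_stateOp hN0 hLa hLB hLa'.isLocal fun j => (hLB' j).isLocal
  have hAA := inner_stateOp_eq_inner_adjointOp hLa'.inner_symm fun j => (hLB' j).inner_symm
  have hi := H02.val_injective hΩ.isOpen
  have hd := H02.denseRange_val hΩ.isOpen
  have hsmall : ∑ k, (μ k)⁻¹ * α k ≤ 1 / (2 * K ^ 2) := by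
    have hk : ∀ k, (μ k)⁻¹ * α k ≤ 1 / (4 * K ^ 2) := fun k => by
      refine le_trans ?_ hε
      rw [inv_mul_eq_div]
      have h1 : α k ≤ max (α 0) (α 1) := by fin_cases k <;> simp
      have h2 : min (μ 0) (μ 1) ≤ μ k := by fin_cases k <;> simp
      have h3 : 0 < min (μ 0) (μ 1) := lt_min (hμ 0) (hμ 1)
      have h4 := (hα k).le.trans h1
      gcongr
    rw [Fin.sum_univ_two]
    calc _ ≤ 1 / (4 * K ^ 2) + 1 / (4 * K ^ 2) := add_le_add (hk 0) (hk 1)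
      _ = _ := by field_simp; norm_num
  have hμ' : ∀ k, 0 ≤ (μ k)⁻¹ := fun k => (inv_pos.2 (hμ k)).le
  have hα' : ∀ k, 0 ≤ α k := fun k => (hα k).le
  have hPs : ∀ k u, ‖sourceOp (P k) u‖ ≤ ‖u‖ := fun k => norm_sourceOp_le (hP k)
  have hDs : ∀ k u, ‖sourceOp (D k) u‖ ≤ ‖u‖ := fun k => norm_sourceOp_le (hD k)
  -- The abstract form of the problem takes mₖ = 1/μₖ, with indicator multiplications as the
  -- coupling operators.
  have hfwd : ∀ (w : X Ω T) (φ : Fin 2 → X Ω T), IsForwardSolution O Of a B μ f w₀ w φ ↔ _ :=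
    fun w φ => isForwardSolution_iff (fun k => (hOf k).1.measurableSet) (fun k => (hOf k).2.2)
      hLa' hLB' hP' hF''
  have hadj : ∀ k (w φ : X Ω T), IsAdjointSolution (Od k) a B (α k) (wd k) w φ ↔ _ :=
    fun k w φ => isAdjointSolution_iff (hOd k).1.measurableSet (hOd k).2.2 hLa' hLB' (hD' k) (hE' k)
  obtain ⟨u, y, φ, ψ, hu, hφ⟩ := exists_coupled hT hi hd hG hAA hc0 hl0 hPs hDs hμ' hα' hsmall F w₀ E
  let w : X Ω T := X.ofWeakDeriv hu.hasWeakDeriv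
  let Φ : Fin 2 → X Ω T := fun k => X.ofWeakDeriv (hφ k).hasWeakDeriv
  have hw : IsCauchySolution H02.val (stateOp La LB) 1 0
      (F - ∑ k, (μ k)⁻¹ • sourceOp (P k) (Φ k).toL2) w₀ w.toL2 w.der := by
    rw [X.der_ofWeakDeriv]
    exact hu
  have hΦ : ∀ k, IsCauchySolution H02.val (adjointOp La LB) (-1) T
      (α k • (sourceOp (D k) w.toL2 - E k)) 0 (Φ k).toL2 (Φ k).der := fun k => by
    rw [X.der_ofWeakDeriv]
    exact hφ k
  refine ⟨w, Φ, ⟨(hfwd w Φ).2 hw, fun k => (hadj k w (Φ k)).2 (hΦ k)⟩, ?_, ?_⟩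
  · intro w' φ' hw' hφ'
    have huniq := coupled_unique hT hi hG hAA hc0 hl0 hPs hDs hμ' hα' hsmall
      ((hfwd w' φ').1 hw') (fun k => (hadj k w' (φ' k)).1 (hφ' k)) hw hΦ
    exact ⟨X.ext_toL2 huniq.1, funext fun k => X.ext_toL2 (congrFun huniq.2 k)⟩
  · have hb := coupled_norm_le hT hi hG hAA hc0 hl0 hPs hDs hμ' hα' hsmall hw hΦ
      (norm_stateOp_le hN0 hLa hLB) hKA0
    rw [← hK, ← hKA] at hb
    have hsum : ‖w₀‖ + ‖F‖ + ∑ k, ‖E k‖ ≤ ‖w₀‖ + ‖f‖ + ∑ k, ‖wd k‖ := by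
      gcongr with k
      exact hE k
    calc ‖w‖ ≤ ‖w.toL2‖ + ‖w.der‖ := w.norm_le_add
      _ ≤ ((2 * K + 1) + (1 + 2 / K + KA) * (2 * K + 1)) * (‖w₀‖ + ‖F‖ + ∑ k, ‖E k‖) := by
          rw [add_mul]
          exact add_le_add hb.1 hb.2
      _ ≤ _ := by gcongr
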